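/- **Setting.** Let $p\ge 1$ be an integer. Write $T_+=E_{12}$, $T_-=E_{21}$, $U_+=E_{23}$, $U_-=E_{32}$, $T_3=\tfrac12\mathrm{diag}(1,-1,0)$, $U_3=\tfrac12\mathrm{diag}(0,1,-1)$ for elements of $\mathfrak{sl}(3,\mathbb C)$, acting in any representation of $SU(3)$ through the complexified derived representation. $Q(a,b)$ denotes the class of irreducible unitary representations of $SU(3)$ having a highest weight vector (annihilated by $T_+$ and $U_+$) with eigenvalue $a/2$ of $T_3$ and $b/2$ of $U_3$. A *Gelfand–Tsetlin (GT) basis* of a representation of class $Q(a,b)$ is an orthonormal basis $e(\nu,J)$ indexed by the integer triples $(r_+,r_-,\nu_3)$ with $0\le r_-\le b\le r_+\le a+b$, $r_-\le\nu_3\le r_+$, where $\nu=(\nu_1,\nu_2,\nu_3)$ with $\nu_1=a+2b-r_+-r_-$, $\nu_2=r_++r_--\nu_3$, and $J=\frac12(r_+-r_-)$; $e(\nu,J)$ has $T_3$-eigenvalue $t=\frac12(\nu_1-\nu_2)$ and $U_3$-eigenvalue $u=\frac12(\nu_2-\nu_3)$, the vector of label $\nu=(a+b,b,0)$, $J=b/2$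 is a highest weight vector, and $$U_-e(\nu,J)=\sqrt{(J+u)(J-u+1)}\;e((\nu_1,\nu_2-1,\nu_3+1),J),$$ $$T_-e(\nu,J)=\sqrt{\tfrac{(J-u)(a+b+J-u-\nu_3+1)(b+J-u-\nu_3)(u-J+\nu_3+1)}{2J(2J+1)}}\;e((\nu_1-1,\nu_2+1,\nu_3),J-\tfrac12)$$ $$\qquad+\sqrt{\tfrac{(J+u+1)(a+b-J-u-\nu_3)(J+u+1+\nu_3-b)(J+u+2+\nu_3)}{2(J+1)(2J+1)}}\;e((\nu_1-1,\nu_2+1,\nu_3),J+\tfrac12)$$ (terms with labels out of range are absent). For $a=0$ or $b=0$, $J$ is determined by $\nu$ and is omitted. The *induced dual basis* of the dual space is $\check e(\check\nu,J)=(-1)^{\nu_1-\nu_3}\langle e(\nu,J),\cdot\,\rangle$ with $\check\nu_i=a+b-\nu_i$. Let $\mathcal H$ carry a representation $\rho$ of class $Q(p,0)$ or $Q(0,p)$ with a GT basis $e$. $SU(3)$ acts on $\mathcal B(\mathcal H)\cong\mathcal H\otimes\mathcal H^*$ by $A^g=\rho(g)A\rho(g)^{-1}$, and on $\mathbb CP^2$,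 with base point $x_0=[1:0:0]$ and normalized invariant integral $\int f(x)\,dx=\int_{SU(3)}f(gx_0)\,dg$. As a representation $\mathcal B(\mathcal H)$, with $\langle A,R\rangle=\mathrm{tr}(A^\dagger R)$, is the orthogonal sum of one representation of each class $Q(n,n)$, $0\le n\le p$. A *coupled basis* $\{e(n;\nu,J)\}$ is the union of GT bases of these summands, with phases such that all Clebsch–Gordan coefficients $$C^{n}_{\nu_1,\nu_2;\nu J}=\langle e(n;\nu,J),\;e(\nu_1)\otimes\check e(\nu_2)\rangle$$ are real and $e(0;(0,0,0),0)=(-1)^p\mathbf 1/\sqrt{\dim\mathcal H}$. The harmonics on $\mathbb CP^2$ are $X^n_{\nu,J}(gx_0)=(n+1)^{3/2}\,\overline{\langle f(\nu,J),\tau_n(g)f((n,n,n),0)\rangle}$, for any representation $\tau_n$ of class $Q(n,n)$ with GT basis $f$. A *symbol correspondence* is an injective linear map $W:\mathcal B(\mathcal H)\to C^\infty_{\mathbb C}(\mathbb CP^2)$ with $W_{A^g}(x)=W_A(g^{-1}x)$, $W_{A^\dagger}=\overline{W_A}$ and $\int W_A(x)\,dx=\frac{2}{(p+1)(p+2)}\mathrm{tr}(A)$.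 It is *mapping-positive* if $W_A$ is real and nonnegative whenever $A$ is Hermitian with nonnegative eigenvalues, and real and strictly positive whenever $A$ is Hermitian with positive eigenvalues. Its *operator kernel* is the operator $K$ with $W_A(gx_0)=\mathrm{tr}(AK^g)$ for all $A$ and $g$. Its *characteristic numbers* (with respect to the coupled basis) are the nonzero real numbers $c_0=(-1)^p,c_1,\dots,c_p$ with $$W\Big(\sqrt{\tfrac{(p+1)(p+2)}2}\;e(n;\nu,J)\Big)=c_nX^n_{\nu,J},\qquad K=\tfrac{2}{(p+1)(p+2)}\mathbf 1+\sum_{n=1}^pc_n\sqrt{\tfrac{2(n+1)^3}{(p+1)(p+2)}}\;e(n;(n,n,n),0).$$ For an orthonormal family $(b_{j,k,l})_{j+k+l=p}$ put $\Phi_p(z)=\sum_{j+k+l=p}\sqrt{\tfrac{p!}{j!\,k!\,l!}}\,z_1^jz_2^kz_3^l\,b_{j,k,l}$ for $z\in\mathbb C^3$, and let $\sigma(z_1,z_2,z_3)=(-\bar z_3,\bar z_2,-\bar z_1)$. Let $\Pi_\nu$ be the orthogonal projector onto the weight space of weight $\nu$ (the joint eigenspace of $T_3$, $U_3$ with eigenvalues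 $\frac12(\nu_1-\nu_2)$, $\frac12(\nu_2-\nu_3)$). **Proposition.** (1) Let $\mathcal H$ be of class $Q(p,0)$, and $\Phi_p$ formed with $b_{j,k,l}=e((j,k,l))$. Then $$B_A([n])=\langle\Phi_p(n),A\,\Phi_p(n)\rangle\qquad(n\in S^5\subset\mathbb C^3)$$ is a well-defined mapping-positive symbol correspondence $B:\mathcal B(\mathcal H)\to C^\infty_{\mathbb C}(\mathbb CP^2)$, whose operator kernel is the projector $\Pi_{(p,0,0)}$ onto the highest weight space and whose characteristic numbers are $$b_n=(-1)^p\sqrt{\frac{(p+1)(p+2)}{2(n+1)^3}}\;C^{n}_{(p,0,0),(0,p,p);(n,n,n)0}\qquad(0\le n\le p).$$ (2) Let $\mathcal H$ be of class $Q(0,p)$, and $\Phi_p$ formed with $b_{j,k,l}=e((j+k,j+l,k+l))$. Then $$B^-_A([n])=\langle\Phi_p(\sigma(n)),A\,\Phi_p(\sigma(n))\rangle\qquad(n\in S^5)$$ is a well-defined mapping-positive symbol correspondence, whose operator kernel is the projector $\Pi_{(0,p,p)}$ onto the lowest weight space and whose characteristic numbers are $$b_{n-}=(-1)^p\sqrt{\frac{(p+1)(p+2)}{2(n+1)^3}}\;C^{n}_{(0,p,p),(p,0,0);(n,n,n)0}\qquad(0\le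 n\le p).$$ -/

import Mathlib

open scoped ContDiff ComplexConjugate InnerProductSpace LinearAlgebra.Projectivization

noncomputable section

namespace QuarkSymbol

universe u

/-! ### The group `SU(3)` and its normalized Haar measure -/

/-- The group `SU(3)`, with the topology induced by the space of matrices. -/
abbrev SU3 : Type := Matrix.specialUnitaryGroup (Fin 3) ℂ

instance : ContinuousInv SU3 where
  continuous_inv := by
    refine Continuous.subtype_mk (f := fun g : SU3 => star (g : Matrix (Fin 3) (Fin 3) ℂ)) ?_ _
    exact continuous_subtype_val.star

instance : IsTopologicalGroup SU3 where

instance : CompactSpace SU3 := by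
  refine (isCompact_iff_compactSpace (s := ((Matrix.specialUnitaryGroup (Fin 3) ℂ : Submonoid _) :
    Set (Matrix (Fin 3) (Fin 3) ℂ)))).1 ?_
  have hclosed : IsClosed {A : Matrix (Fin 3) (Fin 3) ℂ | A * star A = 1 ∧ A.det = 1} :=
    (isClosed_eq (by fun_prop) continuous_const).inter
      (isClosed_eq (Continuous.matrix_det continuous_id) continuous_const)
  have hset : ((Matrix.specialUnitaryGroup (Fin 3) ℂ : Submonoid _) :
      Set (Matrix (Fin 3) (Fin 3) ℂ)) = {A | A * star A = 1 ∧ A.det = 1} := by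
    ext A
    simp only [SetLike.mem_coe, Matrix.mem_specialUnitaryGroup_iff, Matrix.mem_unitaryGroup_iff,
      Set.mem_ofPred_eq]
  rw [hset]
  have hbox : IsCompact (Set.pi Set.univ fun _ : Fin 3 => Set.pi Set.univ fun _ : Fin 3 =>
      Metric.closedBall (0 : ℂ) 1) :=
    isCompact_univ_pi fun _ => isCompact_univ_pi fun _ => isCompact_closedBall _ _
  refine hbox.of_isClosed_subset hclosed ?_
  intro A hA i _ j _
  have hU : A ∈ Matrix.unitaryGroup (Fin 3) ℂ := Matrix.mem_unitaryGroup_iff.2 hA.1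
  simpa using entry_norm_bound_of_unitary hU i j

instance : MeasurableSpace SU3 := borel SU3

instance : BorelSpace SU3 := ⟨rfl⟩

/-- The Haar measure of `SU(3)` with total mass `1`. -/
def haarSU3 : MeasureTheory.Measure SU3 :=
  MeasureTheory.Measure.haarMeasure (⊤ : TopologicalSpace.PositiveCompacts SU3)

/-! ### The complex projective plane -/

/-- `ℂ³` with its standard Hermitian inner product. -/
abbrev C3 : Type := EuclideanSpace ℂ (Fin 3)

/-- The complex projective plane. -/
abbrev CP2 : Type := ℙ ℂ C3

/-- The canonical projection `S⁵ → ℂP²`. -/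
def proj (n : Metric.sphere (0 : C3) 1) : CP2 :=
  Projectivization.mk ℂ (n : C3) (ne_zero_of_mem_unit_sphere n)

/-- The defining action of `SU(3)` on `ℂ³`. -/
def actC3 (g : SU3) : C3 →ₗ[ℂ] C3 := Matrix.toEuclideanLin (g : Matrix (Fin 3) (Fin 3) ℂ)

lemma actC3_injective (g : SU3) : Function.Injective (actC3 g) := by
  have h : ((g⁻¹ : SU3) : Matrix (Fin 3) (Fin 3) ℂ) * (g : Matrix (Fin 3) (Fin 3) ℂ) = 1 :=
    congrArg Subtype.val (inv_mul_cancel g)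
  intro v w hvw
  have h2 := congrArg (fun x : C3 =>
    ((g⁻¹ : SU3) : Matrix (Fin 3) (Fin 3) ℂ).mulVec (WithLp.ofLp x)) hvw
  simp only [actC3, Matrix.ofLp_toLpLin, Matrix.toLin'_apply, Matrix.mulVec_mulVec, h,
    Matrix.one_mulVec] at h2
  exact (WithLp.ofLp_injective 2) h2

/-- The induced action of `SU(3)` on `ℂP²`. -/
def actCP2 (g : SU3) (x : CP2) : CP2 := Projectivization.map (actC3 g) (actC3_injective g) x

/-- The base point `[1 : 0 : 0]`. -/
def basePoint : CP2 :=
  Projectivization.mk ℂ (EuclideanSpace.single 0 1 : C3) (by simp)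

/-- The inverse `ℂ² → ℂP²` of the affine chart on which the `i`-th homogeneous coordinate does
not vanish. -/
def affineChart (i : Fin 3) (w : Fin 2 → ℂ) : CP2 :=
  Projectivization.mk ℂ (WithLp.toLp 2 (i.insertNth (α := fun _ => ℂ) 1 w) : C3) (by
    intro h
    have h2 := congrArg (fun v : C3 => v i) h
    simp at h2)

/-- Smoothness (in the real sense) of a complex function on `ℂP²`, in the three affine charts. -/
def IsSmooth (f : CP2 → ℂ) : Prop :=
  ∀ i : Fin 3, ContDiff ℝ ∞ fun w : Fin 2 → ℂ => f (affineChart i w)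

/-- The normalized `SU(3)`-invariant integral on `ℂP²`: the Haar integral of the lift
`g ↦ f (g x₀)`. -/
def cp2Integral (f : CP2 → ℂ) : ℂ := ∫ g : SU3, f (actCP2 g basePoint) ∂haarSU3

/-! ### Representations of `SU(3)` and the action of `sl(3, ℂ)` -/

section Rep

variable {V : Type u} [NormedAddCommGroup V] [NormedSpace ℂ V]

/-- A matrix in `SU(3)` as an element of that group (and `1` for any other matrix). -/
def toSU3 (M : Matrix (Fin 3) (Fin 3) ℂ) : SU3 :=
  open Classical in if h : M ∈ Matrix.specialUnitaryGroup (Fin 3) ℂ then ⟨M, h⟩ else 1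

/-- The operator `-i d/dt ρ(exp(itX))|_{t = 0}` by which a traceless Hermitian matrix `X` acts
(for such `X` the matrices `exp(itX)` are in `SU(3)`). -/
def hermAct (ρ : SU3 →* (V →L[ℂ] V)) (X : Matrix (Fin 3) (Fin 3) ℂ) : V →L[ℂ] V :=
  (-Complex.I) • deriv (fun t : ℝ => ρ (toSU3 (NormedSpace.exp (((t : ℂ) * Complex.I) • X)))) 0

/-- The complexified derived representation on traceless matrices: if `X = A + iB` with `A`, `B`
Hermitian, then `X` acts as `A` plus `i` times `B`. -/
def lieAct (ρ : SU3 →* (V →L[ℂ] V)) (X : Matrix (Fin 3) (Fin 3) ℂ) : V →L[ℂ] V :=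
  hermAct ρ ((1 / 2 : ℂ) • (X + X.conjTranspose)) +
    Complex.I • hermAct ρ ((-Complex.I / 2) • (X - X.conjTranspose))

/-- `T₊ = F₁ + iF₂ = E₁₂`. -/
def Tplus (ρ : SU3 →* (V →L[ℂ] V)) : V →L[ℂ] V := lieAct ρ !![0, 1, 0; 0, 0, 0; 0, 0, 0]
/-- `T₋ = F₁ - iF₂ = E₂₁`. -/
def Tminus (ρ : SU3 →* (V →L[ℂ] V)) : V →L[ℂ] V := lieAct ρ !![0, 0, 0; 1, 0, 0; 0, 0, 0]
/-- `U₊ = F₆ + iF₇ = E₂₃`. -/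
def Uplus (ρ : SU3 →* (V →L[ℂ] V)) : V →L[ℂ] V := lieAct ρ !![0, 0, 0; 0, 0, 1; 0, 0, 0]
/-- `U₋ = F₆ - iF₇ = E₃₂`. -/
def Uminus (ρ : SU3 →* (V →L[ℂ] V)) : V →L[ℂ] V := lieAct ρ !![0, 0, 0; 0, 0, 0; 0, 1, 0]
/-- `T₃ = diag(1/2, -1/2, 0)`. -/
def T3 (ρ : SU3 →* (V →L[ℂ] V)) : V →L[ℂ] V :=
  lieAct ρ !![1 / 2, 0, 0; 0, -1 / 2, 0; 0, 0, 0]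
/-- `U₃ = diag(0, 1/2, -1/2)`. -/
def U3 (ρ : SU3 →* (V →L[ℂ] V)) : V →L[ℂ] V :=
  lieAct ρ !![0, 0, 0; 0, 1 / 2, 0; 0, 0, -1 / 2]

/-- The weight space of a weight labelled `(ν₁, ν₂, ν₃)`: the joint eigenspace of `T₃` and `U₃` for
the eigenvalues `(ν₁ - ν₂)/2` and `(ν₂ - ν₃)/2`. -/
def weightSpace (ρ : SU3 →* (V →L[ℂ] V)) (ν₁ ν₂ ν₃ : ℤ) : Submodule ℂ V :=
  Module.End.eigenspace (T3 ρ : V →ₗ[ℂ] V) (((ν₁ : ℂ) - ν₂) / 2) ⊓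
    Module.End.eigenspace (U3 ρ : V →ₗ[ℂ] V) (((ν₂ : ℂ) - ν₃) / 2)

/-- Irreducibility. -/
def IsIrreducibleRep (ρ : SU3 →* (V →L[ℂ] V)) : Prop :=
  Nontrivial V ∧ ∀ W : Submodule ℂ V, (∀ g, ∀ v ∈ W, ρ g v ∈ W) → W = ⊥ ∨ W = ⊤

/-- The action of `SU(3)` on operators by conjugation, `A ↦ A^g = ρ(g) A ρ(g)⁻¹`. -/
def conjRep (ρ : SU3 →* (V →L[ℂ] V)) : SU3 →* ((V →L[ℂ] V) →L[ℂ] (V →L[ℂ] V)) where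
  toFun g := ContinuousLinearMap.mulLeftRight ℂ (V →L[ℂ] V) (ρ g) (ρ g⁻¹)
  map_one' := by ext A v; simp
  map_mul' g h := by ext A v; simp [mul_assoc]

end Rep

/-! ### Gelfand-Tsetlin patterns and bases -/

/-- A Gelfand-Tsetlin pattern `(r₊, r₋, ν₃)` for the class `Q(p, q)`. It stands for the label
`((ν₁, ν₂, ν₃), J)` with `ν₁ = p + 2q - (r₊ + r₋)`, `ν₂ = (r₊ + r₋) - ν₃`, `J = (r₊ - r₋)/2`. -/
@[ext] structure GTPattern (p q : ℕ) where
  rp : ℕ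
  rm : ℕ
  nu3 : ℕ
  rm_le : rm ≤ q
  le_rp : q ≤ rp
  rp_le : rp ≤ p + q
  rm_le_nu3 : rm ≤ nu3
  nu3_le_rp : nu3 ≤ rp

namespace GTPattern

variable {p q : ℕ} (r : GTPattern p q)

def ν₁ : ℤ := p + 2 * q - (r.rp + r.rm)
def ν₂ : ℤ := r.rp + r.rm - r.nu3
def ν₃ : ℤ := r.nu3
/-- The eigenvalue of `T₃`. -/
def t : ℝ := ((r.ν₁ : ℝ) - r.ν₂) / 2
/-- The eigenvalue of `U₃`. -/
def u : ℝ := ((r.ν₂ : ℝ) - r.ν₃) / 2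
/-- The total spin of the `SU(2)` of `U₃`, `U₊`, `U₋`. -/
def J : ℝ := ((r.rp : ℝ) - r.rm) / 2

/-- The pattern `(p + q, q, 0)`, `J = q/2` of the highest weight. -/
def highest (p q : ℕ) : GTPattern p q := ⟨q, 0, 0, by simp, by simp, by simp, by simp, by simp⟩

/-- The pattern `(0, q, p + q)`, `J = p/2` of the lowest weight. -/
def lowest (p q : ℕ) : GTPattern p q :=
  ⟨p + q, q, p + q, by simp, by simp, by simp, by simp, by simp⟩

/-- The pattern `(n, n, n)`, `J = 0` of `Q(n, n)`. -/
def center (n : ℕ) : GTPattern n n := ⟨n, n, n, by simp, by simp, by simp, by simp, by simp⟩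

/-- The dual pattern in `Q(q, p)`: `ν̌ᵢ = p + q - νᵢ`, with the same `J`. -/
def dual : GTPattern q p where
  rp := p + q - r.rm
  rm := p + q - r.rp
  nu3 := p + q - r.nu3
  rm_le := by have := r.le_rp; omega
  le_rp := by have := r.rm_le; omega
  rp_le := by omega
  rm_le_nu3 := by have := r.nu3_le_rp; omega
  nu3_le_rp := by have := r.rm_le_nu3; omega

/-- Extend a family indexed by patterns to all triples `(r₊, r₋, ν₃)`, by `0` outside of the
patterns. -/
def extend {V : Type u} [Zero V] (e : GTPattern p q → V) (rp rm nu3 : ℕ) : V :=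
  open Classical in
  if h : (rm ≤ q ∧ q ≤ rp) ∧ rp ≤ p + q ∧ rm ≤ nu3 ∧ nu3 ≤ rp then
    e ⟨rp, rm, nu3, h.1.1, h.1.2, h.2.1, h.2.2.1, h.2.2.2⟩ else 0

/-- The coefficient of `e(ν₁, ν₂ - 1, ν₃ + 1; J)` in `U₋ e(ν; J)`. -/
def coeffU : ℝ := √((r.J + r.u) * (r.J - r.u + 1))

/-- The coefficient of `e(ν₁ - 1, ν₂ + 1, ν₃; J - 1/2)` in `T₋ e(ν; J)` (it is `0` for `J = 0`). -/
def coeffT₁ : ℝ :=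
  √((r.J - r.u) * (p + q + r.J - r.u - r.ν₃ + 1) * (q + r.J - r.u - r.ν₃) * (r.u - r.J + r.ν₃ + 1) /
    (2 * r.J * (2 * r.J + 1)))

/-- The coefficient of `e(ν₁ - 1, ν₂ + 1, ν₃; J + 1/2)` in `T₋ e(ν; J)`. -/
def coeffT₂ : ℝ :=
  √((r.J + r.u + 1) * (p + q - r.J - r.u - r.ν₃) * (r.J + r.u + 1 + r.ν₃ - q) *
    (r.J + r.u + 2 + r.ν₃) / (2 * (r.J + 1) * (2 * r.J + 1)))

end GTPattern

section GT

variable {V : Type u} [NormedAddCommGroup V] [NormedSpace ℂ V]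

/-- The linear relations of a Gelfand-Tsetlin basis of a subrepresentation of class `Q(p, q)`: the
vectors have the weights of their labels, the one of the highest weight is annihilated by
the raising operators, and the lowering operators act by the Gelfand-Tsetlin formulas (where
`ν₃ ↦ ν₃ + 1` at fixed `r₊`, `r₋` for `U₋`, and `r₋ ↦ r₋ + 1` or `r₊ ↦ r₊ + 1` at fixed `ν₃` for
`T₋`). -/
structure IsGTFamily (ρ : SU3 →* (V →L[ℂ] V)) (p q : ℕ) (e : GTPattern p q → V) : Prop where
  t3 : ∀ r, T3 ρ (e r) = (r.t : ℂ) • e r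
  u3 : ∀ r, U3 ρ (e r) = (r.u : ℂ) • e r
  tplus : Tplus ρ (e (GTPattern.highest p q)) = 0
  uplus : Uplus ρ (e (GTPattern.highest p q)) = 0
  uminus : ∀ r, Uminus ρ (e r) =
    (r.coeffU : ℂ) • GTPattern.extend e r.rp r.rm (r.nu3 + 1)
  tminus : ∀ r, Tminus ρ (e r) =
    (r.coeffT₁ : ℂ) • GTPattern.extend e r.rp (r.rm + 1) r.nu3 +
      (r.coeffT₂ : ℂ) • GTPattern.extend e (r.rp + 1) r.rm r.nu3

end GT

section Hilbert

variable {H : Type u} [NormedAddCommGroup H] [InnerProductSpace ℂ H]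

/-- Continuous unitary representations. -/
structure IsUnitaryRep (ρ : SU3 →* (H →L[ℂ] H)) : Prop where
  continuous : Continuous ρ
  inner_map : ∀ g v w, ⟪ρ g v, ρ g w⟫_ℂ = ⟪v, w⟫_ℂ

/-- `ρ` is an irreducible unitary representation of class `Q(p, q)`, that is, with a highest weight
vector of weight `p ω₁ + q ω₂`. -/
structure IsOfClass (ρ : SU3 →* (H →L[ℂ] H)) (p q : ℕ) : Prop where
  unitary : IsUnitaryRep ρ
  irreducible : IsIrreducibleRep ρ
  highest : ∃ v : H, v ≠ 0 ∧ Tplus ρ v = 0 ∧ Uplus ρ v = 0 ∧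
    T3 ρ v = ((p : ℂ) / 2) • v ∧ U3 ρ v = ((q : ℂ) / 2) • v

/-- `e` is a Gelfand-Tsetlin basis of the representation `ρ` of class `Q(p, q)`. -/
structure IsGTBasis (ρ : SU3 →* (H →L[ℂ] H)) (p q : ℕ) (e : GTPattern p q → H) : Prop where
  orthonormal : Orthonormal ℂ e
  span_eq_top : Submodule.span ℂ (Set.range e) = ⊤
  family : IsGTFamily ρ p q e

/-- The Wigner `D`-functions of a representation in a Gelfand-Tsetlin basis. -/
def wignerD {p q : ℕ} (ρ : SU3 →* (H →L[ℂ] H)) (e : GTPattern p q → H) (r s : GTPattern p q)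
    (g : SU3) : ℂ :=
  ⟪e r, ρ g (e s)⟫_ℂ

/-- The harmonic `Xⁿ_{ν,J}` on `ℂP²`, the function with
`Xⁿ_{ν,J}(g x₀) = (n + 1)^{3/2} conj (D^{(n,n)}_{νJ,(n,n,n)0}(g))`, where `D` is computed in a
Gelfand-Tsetlin basis `e` of a representation `ρ` of class `Q(n, n)`. As `SU(3)` is transitive on
`ℂP²`, there is some `g` with `g x₀ = x`; the value does not depend on its choice. -/
def cp2Harmonic {n : ℕ} (ρ : SU3 →* (H →L[ℂ] H)) (e : GTPattern n n → H) (r : GTPattern n n) :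
    CP2 → ℂ := fun x =>
  (((n + 1 : ℝ) ^ (3 / 2 : ℝ) : ℝ) : ℂ) *
    conj (wignerD ρ e r (GTPattern.center n) (Classical.epsilon fun g => actCP2 g basePoint = x))

/-- The trace of an operator. -/
def opTrace (A : H →L[ℂ] H) : ℂ := LinearMap.trace ℂ H (A : H →ₗ[ℂ] H)

/-- The induced Gelfand-Tsetlin basis of the dual space,
`ě(ν̌, J) = (-1)^{2(t + u)} e*(ν, J)`, where `2(t + u) = ν₁ - ν₃` and `e*` is the dual of `e` via the
Hermitian inner product. -/
def dualBasis {p q : ℕ} (e : GTPattern p q → H) (s : GTPattern q p) : H →L[ℂ] ℂ :=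
  ((-1 : ℂ) ^ (s.dual.ν₁ - s.dual.ν₃)) • innerSL ℂ (e s.dual)

/-- An element `v ⊗ φ` of `H ⊗ H*`, as an operator on `H`. -/
def tensorOp (v : H) (φ : H →L[ℂ] ℂ) : H →L[ℂ] H := φ.smulRight v

section Complete

variable [CompleteSpace H]

/-- The trace inner product `tr (A† B)` of operators. -/
def traceInner (A B : H →L[ℂ] H) : ℂ := opTrace (ContinuousLinearMap.adjoint A * B)

/-- The Clebsch-Gordan coefficient `⟨E | e(ν₁, J₁) ⊗ ě(ν₂, J₂)⟩`, for an operator `E` of a coupled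
basis of `H ⊗ H*`. -/
def clebschGordan {p q : ℕ} (e : GTPattern p q → H) (r₁ : GTPattern p q) (r₂ : GTPattern q p)
    (E : H →L[ℂ] H) : ℂ :=
  traceInner E (tensorOp (e r₁) (dualBasis e r₂))

/-- `E` is a coupled Gelfand-Tsetlin basis of the operators on a representation of class `Q(p, q)`
with `p = 0` or `q = 0`, whose operator space is the direct sum of one representation of each
class `Q(n, n)`, `0 ≤ n ≤ p + q`: the union over these `n` of Gelfand-Tsetlin bases
`(E n r)_r` of these representations, orthonormal for the trace inner product. As for the phases, all
the Clebsch-Gordan coefficients are real, and the vector of the trivial representation is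
`(-1)^{p+q} / √dim H` times the identity. -/
structure IsCoupledBasis {p q : ℕ} (ρ : SU3 →* (H →L[ℂ] H)) (e : GTPattern p q → H)
    (E : (n : ℕ) → GTPattern n n → (H →L[ℂ] H)) : Prop where
  family : ∀ n ≤ p + q, IsGTFamily (conjRep ρ) n n (E n)
  norm_one : ∀ n ≤ p + q, ∀ r, traceInner (E n r) (E n r) = 1
  orthogonal : ∀ n ≤ p + q, ∀ r s, r ≠ s → traceInner (E n r) (E n s) = 0
  orthogonal_of_ne : ∀ n ≤ p + q, ∀ m ≤ p + q, n ≠ m → ∀ r s, traceInner (E n r) (E m s) = 0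
  span_eq_top : Submodule.span ℂ {A | ∃ n ≤ p + q, ∃ r, A = E n r} = ⊤
  real : ∀ n ≤ p + q, ∀ r r₁ r₂, (clebschGordan e r₁ r₂ (E n r)).im = 0
  trivial : E 0 (GTPattern.center 0) =
    ((-1 : ℂ) ^ (p + q) / (√(Module.finrank ℂ H : ℝ) : ℝ)) • (1 : H →L[ℂ] H)

/-! ### Symbol correspondences -/

/-- `W` is a symbol correspondence for a pure-quark system of class `Q(p, 0)` or `Q(0, p)`. -/
structure IsSymbolCorrespondence (ρ : SU3 →* (H →L[ℂ] H)) (p : ℕ)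
    (W : (H →L[ℂ] H) →ₗ[ℂ] (CP2 → ℂ)) : Prop where
  smooth : ∀ A, IsSmooth (W A)
  injective : Function.Injective W
  equivariant : ∀ g A x, W (conjRep ρ g A) x = W A (actCP2 g⁻¹ x)
  real : ∀ A x, W (ContinuousLinearMap.adjoint A) x = conj (W A x)
  normalized : ∀ A, cp2Integral (W A) = 2 / (((p : ℂ) + 1) * (p + 2)) * opTrace A

/-- Hermitian operators whose eigenvalues are all nonnegative. -/
def IsPositiveOp (A : H →L[ℂ] H) : Prop :=
  ContinuousLinearMap.adjoint A = A ∧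
    ∀ a : ℝ, Module.End.HasEigenvalue (A : H →ₗ[ℂ] H) (a : ℂ) → 0 ≤ a

/-- Hermitian operators whose eigenvalues are all positive. -/
def IsPositiveDefiniteOp (A : H →L[ℂ] H) : Prop :=
  ContinuousLinearMap.adjoint A = A ∧
    ∀ a : ℝ, Module.End.HasEigenvalue (A : H →ₗ[ℂ] H) (a : ℂ) → 0 < a

/-- `W` maps positive operators to positive (real, nonnegative) functions and positive-definite
operators to strictly positive functions. -/
def IsMappingPositive (W : (H →L[ℂ] H) →ₗ[ℂ] (CP2 → ℂ)) : Prop :=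
  (∀ A, IsPositiveOp A → ∀ x, ∃ y : ℝ, 0 ≤ y ∧ W A x = y) ∧
    ∀ A, IsPositiveDefiniteOp A → ∀ x, ∃ y : ℝ, 0 < y ∧ W A x = y

end Complete

/-- `K` is the operator kernel of `W`: `W_A(g x₀) = tr (A K^g)`. -/
def IsOperatorKernel (ρ : SU3 →* (H →L[ℂ] H)) (W : (H →L[ℂ] H) →ₗ[ℂ] (CP2 → ℂ))
    (K : H →L[ℂ] H) : Prop :=
  ∀ A g, W A (actCP2 g basePoint) = opTrace (A * conjRep ρ g K)

/-- `c` is the sequence of characteristic numbers of the symbol correspondence `W` with operator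
kernel `K`, for a system of class `Q(p, 0)` or `Q(0, p)` with coupled basis `E` and with the
harmonics `X` on `ℂP²`. -/
structure IsCharacteristicNumbers (p : ℕ) (E : (n : ℕ) → GTPattern n n → (H →L[ℂ] H))
    (X : (n : ℕ) → GTPattern n n → CP2 → ℂ) (W : (H →L[ℂ] H) →ₗ[ℂ] (CP2 → ℂ))
    (K : H →L[ℂ] H) (c : ℕ → ℝ) : Prop where
  zero : c 0 = (-1) ^ p
  ne_zero : ∀ n ≤ p, c n ≠ 0
  map : ∀ n ≤ p, ∀ r, W ((√(((p : ℝ) + 1) * (p + 2) / 2) : ℂ) • E n r) = (c n : ℂ) • X n r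
  kernel : K = (2 / (((p : ℂ) + 1) * (p + 2))) • (1 : H →L[ℂ] H) +
    ∑ n ∈ Finset.Icc 1 p,
      ((c n * √(2 * ((n : ℝ) + 1) ^ 3 / (((p : ℝ) + 1) * (p + 2))) : ℝ) : ℂ) •
        E n (GTPattern.center n)

/-- The orthogonal projector `Π_ν` onto the weight space labelled `(ν₁, ν₂, ν₃)`. -/
def weightProjector [FiniteDimensional ℂ H] (ρ : SU3 →* (H →L[ℂ] H)) (ν₁ ν₂ ν₃ : ℤ) :
    H →L[ℂ] H :=
  (weightSpace ρ ν₁ ν₂ ν₃).starProjection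

/-! ### The maps `Φ_p` and `σ` -/

/-- `Φ_p(z) = ∑_{j+k+l=p} √(p!/(j! k! l!)) z₁ʲ z₂ᵏ z₃ˡ b_{j,k,l}`, the point with coordinates
`√(p!/(j! k! l!)) z₁ʲ z₂ᵏ z₃ˡ` in the basis `b`. -/
def veronese (p : ℕ) (b : ℕ → ℕ → ℕ → H) (z : C3) : H :=
  ∑ m ∈ Finset.Nat.antidiagonalTuple 3 p,
    ((√(Nat.multinomial Finset.univ m : ℝ) : ℂ) * (z 0 ^ m 0 * z 1 ^ m 1 * z 2 ^ m 2)) •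
      b (m 0) (m 1) (m 2)

/-- The vector `e_{j,k,l}` of a Gelfand-Tsetlin basis of `Q(p, 0)`, `j + k + l = p`: the one of weight
`ν = (j, k, l)`. -/
def quarkVector {p : ℕ} (e : GTPattern p 0 → H) (_j k l : ℕ) : H :=
  GTPattern.extend e (k + l) 0 l

/-- The vector `ě_{j,k,l}` of a Gelfand-Tsetlin basis of `Q(0, p)`, `j + k + l = p`: the one of weight
`ν = (j + k, j + l, k + l)`, that is, `j (1,1,0) + k (1,0,1) + l (0,1,1)`. -/
def antiquarkVector {p : ℕ} (e : GTPattern 0 p → H) (_j k l : ℕ) : H :=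
  GTPattern.extend e p l (k + l)

end Hilbert

/-- The map `σ(z₁, z₂, z₃) = (-z̄₃, z̄₂, -z̄₁)`. -/
def sigma (z : C3) : C3 := !₂[-conj (z 2), conj (z 1), -conj (z 0)]

end QuarkSymbol

end

open QuarkSymbol

namespace QuarkSymbol

/-! ### Continuous one-parameter groups -/

section OneParameter

variable {V : Type*} [NormedAddCommGroup V] [NormedSpace ℂ V]

/-! Both halves are instances of one construction. Suppose `Ψ : ℂ³ → H` is smooth and equivariant,
satisfies `Ψ (c z) = d Ψ z` with `|d| = |c|^p`, and takes a unit vector `Ψ e₁` at the base vector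
that is annihilated by `U₃`, `U₊`, `U₋`. Then `[z] ↦ ⟨Ψ z, A Ψ z⟩ / ‖z‖^{2p}` is well defined, and
at `g x₀` it equals `tr (A K^g)`, where `K` is the rank-one projector on `Ψ e₁`. Equivariance,
reality and positivity can be read off. The normalization follows because the Haar average of `K^g`
commutes with an irreducible representation, so it is `(tr K / dim H) · 1`. Injectivity is
polarization: if `⟨Ψ z, A Ψ z⟩` vanishes identically, then so does `⟨Ψ w, A Ψ z⟩`, and the range of
`Ψ` spans `H` by irreducibility. All this is in `IsCoherentMap`.

For the characteristic numbers, `⟨Ψ e₁, [U, A] Ψ e₁⟩ = 0` for `U` among `U₃`, `U₊`, `U₋`. Hence `⟨Ψ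
e₁, E n r Ψ e₁⟩` vanishes unless `r` is the central pattern (`IsGTFamily.inner_eq_zero`). Expanding
the conjugated `E n r` in Wigner functions then leaves one term, a multiple of the harmonic. The
multiple is the expectation value of `E n (center n)` at `Ψ e₁`; since `e(ν) ⊗ ě(ν̌)` is a sign
times a rank-one projector, it is a Clebsch-Gordan coefficient up to sign. A coupled basis
prescribes the action of the lowering operators only; that of the raising operators is recovered by
taking adjoints for the trace inner product (`IsCoupledBasis.lift_map`).

It remains to see that `Φ_p` and `Φ_p ∘ σ` are such maps. In a Gelfand-Tsetlin basis the Lie algebra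
acts as on normalized monomials (`IsSymPowerBasis`), so along a one-parameter subgroup both sides of
the equivariance relation solve the same linear differential equation. Four one-parameter subgroups
generate `SU(3)` (`subgroup_eq_top`, by plane rotations), and this suffices. For `Q(0, p)` the roles
of the `T` and `U` operators are exchanged, and `σ` makes the same exchange on `ℂ³`. -/

theorem differentiable_of_continuous_oneParameter [CompleteSpace V] {γ : ℝ → (V →L[ℂ] V)}
    (hc : Continuous γ) (h0 : γ 0 = 1) (hadd : ∀ s t, γ (s + t) = γ s * γ t) :
    Differentiable ℝ γ := by
  have hint : ∀ a b, IntervalIntegrable γ MeasureTheory.volume a b :=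
    fun a b => hc.intervalIntegrable a b
  have hF : ∀ t, HasDerivAt (fun t => ∫ x in (0 : ℝ)..t, γ x) (γ t) t := fun t =>
    intervalIntegral.integral_hasDerivAt_right (hint 0 t)
      (hc.stronglyMeasurableAtFilter _ _) hc.continuousAt
  have hs := (hF 0).tendsto_slope_zero
  simp only [zero_add, intervalIntegral.integral_same, sub_zero, h0] at hs
  -- The means of `γ` over `[0, h]` tend to `γ 0 = 1` and the units are open, so some mean is
  -- invertible. The product of `γ t` with that mean is a difference of primitives of `γ`, so
  -- dividing by the mean shows that `γ` is differentiable.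
  have hu : ∀ᶠ h in nhdsWithin (0 : ℝ) {0}ᶜ, IsUnit (h⁻¹ • ∫ x in (0 : ℝ)..h, γ x) :=
    hs.eventually (Units.isOpen.mem_nhds isUnit_one)
  obtain ⟨h, hu⟩ := hu.exists
  obtain ⟨u, hu⟩ := hu
  have key : ∀ t, γ t =
      (h⁻¹ • ((∫ x in (0 : ℝ)..(t + h), γ x) - ∫ x in (0 : ℝ)..t, γ x)) * (↑u⁻¹ : V →L[ℂ] V) := by
    intro t
    rw [Units.eq_mul_inv_iff_mul_eq, hu, intervalIntegral.integral_interval_sub_left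
      (hint _ _) (hint _ _), mul_smul_comm]
    congr 1
    have h1 : γ t * ∫ x in (0 : ℝ)..h, γ x = ∫ x in (0 : ℝ)..h, γ t * γ x :=
      (((ContinuousLinearMap.mul ℂ (V →L[ℂ] V) (γ t)).intervalIntegral_comp_comm
        (hint 0 h))).symm
    rw [h1]
    simp_rw [← hadd]
    rw [intervalIntegral.integral_comp_add_left (fun x => γ x) t]
    simp
  have hd : Differentiable ℝ fun t => ∫ x in (0 : ℝ)..t, γ x := fun t => (hF t).differentiableAt
  have h2 : Differentiable ℝ fun t =>
      h⁻¹ • ((∫ x in (0 : ℝ)..(t + h), γ x) - ∫ x in (0 : ℝ)..t, γ x) :=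
    ((hd.comp (differentiable_id.add_const h)).sub hd).const_smul h⁻¹
  have h3 := ((ContinuousLinearMap.mul ℂ (V →L[ℂ] V)).flip
    (↑u⁻¹ : V →L[ℂ] V)).restrictScalars ℝ |>.differentiable.comp h2
  rw [show γ = _ from funext key]
  exact h3

theorem hasDerivAt_oneParameter {γ : ℝ → (V →L[ℂ] V)} (hadd : ∀ s t, γ (s + t) = γ s * γ t)
    {A : V →L[ℂ] V} (hA : HasDerivAt γ A 0) (t : ℝ) : HasDerivAt γ (γ t * A) t := by
  have h1 : HasDerivAt (fun s => γ (s - t)) A t := by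
    have := HasDerivAt.comp_sub_const (f := γ) (f' := A) t t (by simpa using hA)
    simpa using this
  have h2 := (((ContinuousLinearMap.mul ℂ (V →L[ℂ] V)) (γ t)).restrictScalars ℝ
    ).hasFDerivAt.comp_hasDerivAt t h1
  have h3 : (fun s => γ t * γ (s - t)) = γ := by
    ext1 s
    rw [← hadd, add_sub_cancel]
  have h4 : HasDerivAt (fun s => γ t * γ (s - t)) (γ t * A) t := h2
  rwa [h3] at h4

/-- Uniqueness for `y' = A y`: in the derivative of `γ (-s) (y s)` the two product-rule terms `-γ
(-s) A (y s)` and `γ (-s) A (y s)` cancel. -/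
theorem eq_oneParameter_apply {γ : ℝ → (V →L[ℂ] V)} (h0 : γ 0 = 1)
    (hadd : ∀ s t, γ (s + t) = γ s * γ t) {A : V →L[ℂ] V} (hA : HasDerivAt γ A 0)
    {y : ℝ → V} (hy : ∀ t, HasDerivAt y (A (y t)) t) (t : ℝ) : y t = γ t (y 0) := by
  have hd : ∀ s, HasDerivAt (fun s => γ (-s) (y s)) 0 s := by
    intro s
    have h1 : HasDerivAt (fun s => γ (-s)) (-(γ (-s) * A)) s := by
      exact ((hasDerivAt_oneParameter hadd hA (-s)).scomp s (hasDerivAt_neg s)).congr_deriv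
        (by simp)
    have h2 := (ContinuousLinearMap.apply ℂ V).flip.bilinearRestrictScalars ℝ
      |>.hasDerivAt_of_bilinear (fun _ => h1) (fun _ => hy s)
    exact h2.congr_deriv (by simp)
  have hconst : ∀ s, γ (-s) (y s) = y 0 := by
    intro s
    have := is_const_of_deriv_eq_zero (fun x => (hd x).differentiableAt) (fun x => (hd x).deriv) s 0
    simpa [h0] using this
  rw [← hconst t, ← mul_apply_eq_comp, ← hadd, add_neg_cancel, h0]
  simp

end OneParameter

/-! ### One-parameter subgroups of `SU(3)` -/

section ExpCurve

open Matrix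

/-- The one-parameter family `t ↦ exp(itX)` in `SU(3)`. -/
noncomputable def expCurve (X : Matrix (Fin 3) (Fin 3) ℂ) (t : ℝ) : SU3 :=
  toSU3 (NormedSpace.exp (((t : ℂ) * Complex.I) • X))

/-- After unitary diagonalization the determinant is the exponential of `c` times the sum of the
eigenvalues, which is the trace. -/
theorem det_exp_smul_of_isHermitian {X : Matrix (Fin 3) (Fin 3) ℂ} (hX : X.IsHermitian)
    (htr : X.trace = 0) (c : ℂ) : (NormedSpace.exp (c • X)).det = 1 := by
  have h := hX.spectral_theorem
  rw [Unitary.conjStarAlgAut_apply] at h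
  set U := hX.eigenvectorUnitary
  have hU : IsUnit (U : Matrix (Fin 3) (Fin 3) ℂ) := ⟨Unitary.toUnits U, rfl⟩
  have hinv : (star U : Matrix (Fin 3) (Fin 3) ℂ) = (U : Matrix (Fin 3) (Fin 3) ℂ)⁻¹ :=
    (Matrix.inv_eq_left_inv (Unitary.coe_star_mul_self U)).symm
  rw [h, hinv, ← Matrix.smul_mul, ← Matrix.mul_smul, Matrix.exp_conj _ _ hU, Matrix.det_conj hU,
    ← Matrix.diagonal_smul, Matrix.exp_diagonal, Matrix.det_diagonal]
  rw [hX.trace_eq_sum_eigenvalues] at htr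
  have : ∀ i, NormedSpace.exp (c • (RCLike.ofReal ∘ hX.eigenvalues : Fin 3 → ℂ)) i =
      Complex.exp (c * hX.eigenvalues i) := by
    intro i
    rw [Pi.coe_exp, ← Complex.exp_eq_exp_ℂ]
    simp
  simp_rw [this]
  rw [← Complex.exp_sum, ← Finset.mul_sum]
  have h2 : ∑ i, ((hX.eigenvalues i : ℝ) : ℂ) = 0 := htr
  rw [h2]
  simp

variable {X : Matrix (Fin 3) (Fin 3) ℂ}

/-- Membership in the group must be checked, because `toSU3` takes the value `1` outside of it. -/
theorem coe_expCurve (hX : X.IsHermitian) (htr : X.trace = 0) (t : ℝ) :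
    (expCurve X t : Matrix (Fin 3) (Fin 3) ℂ) = NormedSpace.exp (((t : ℂ) * Complex.I) • X) := by
  have hmem : NormedSpace.exp (((t : ℂ) * Complex.I) • X) ∈
      Matrix.specialUnitaryGroup (Fin 3) ℂ := by
    rw [mem_specialUnitaryGroup_iff, mem_unitaryGroup_iff]
    refine ⟨?_, det_exp_smul_of_isHermitian hX htr _⟩
    rw [star_eq_conjTranspose, ← exp_conjTranspose, conjTranspose_smul, hX.eq,
      ← exp_add_of_commute _ _ (((Commute.refl X).smul_left _).smul_right _)]
    simp
  rw [expCurve, toSU3, dif_pos hmem]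

theorem expCurve_zero (X : Matrix (Fin 3) (Fin 3) ℂ) : expCurve X 0 = 1 := by
  have h1 : (1 : Matrix (Fin 3) (Fin 3) ℂ) ∈ specialUnitaryGroup (Fin 3) ℂ := one_mem _
  have h2 : NormedSpace.exp ((((0 : ℝ) : ℂ) * Complex.I) • X) = 1 := by simp
  rw [expCurve, h2, toSU3, dif_pos h1]
  rfl

theorem expCurve_add (hX : X.IsHermitian) (htr : X.trace = 0) (s t : ℝ) :
    expCurve X (s + t) = expCurve X s * expCurve X t := by
  apply Subtype.ext
  rw [Submonoid.coe_mul, coe_expCurve hX htr, coe_expCurve hX htr, coe_expCurve hX htr,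
    ← exp_add_of_commute _ _ (((Commute.refl X).smul_left _).smul_right _)]
  congr 1
  push_cast
  rw [add_mul, add_smul]

open scoped Matrix.Norms.Operator in
theorem hasDerivAt_coe_expCurve (hX : X.IsHermitian) (htr : X.trace = 0) (t : ℝ) :
    HasDerivAt (fun t => (expCurve X t : Matrix (Fin 3) (Fin 3) ℂ))
      ((Complex.I • X) * (expCurve X t : Matrix (Fin 3) (Fin 3) ℂ)) t := by
  have h := hasDerivAt_exp_smul_const' (𝕂 := ℝ) (Complex.I • X) t
  have h2 : ∀ s : ℝ, (expCurve X s : Matrix (Fin 3) (Fin 3) ℂ) =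
      NormedSpace.exp (s • (Complex.I • X)) := by
    intro s
    rw [coe_expCurve hX htr, mul_smul, Complex.coe_smul]
  simp_rw [h2]
  exact h

open scoped Matrix.Norms.Operator in
theorem continuous_expCurve (hX : X.IsHermitian) (htr : X.trace = 0) :
    Continuous (expCurve X) := by
  refine continuous_induced_rng.2 ?_
  exact continuous_iff_continuousAt.2 fun t => (hasDerivAt_coe_expCurve hX htr t).continuousAt

variable {V : Type*} [NormedAddCommGroup V] [NormedSpace ℂ V]

theorem rep_expCurve_add (ρ : SU3 →* (V →L[ℂ] V)) (hX : X.IsHermitian) (htr : X.trace = 0)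
    (s t : ℝ) : ρ (expCurve X (s + t)) = ρ (expCurve X s) * ρ (expCurve X t) := by
  rw [expCurve_add hX htr, map_mul]

theorem hermAct_eq (ρ : SU3 →* (V →L[ℂ] V)) (X : Matrix (Fin 3) (Fin 3) ℂ) :
    hermAct ρ X = (-Complex.I) • deriv (fun t : ℝ => ρ (expCurve X t)) 0 := rfl

/-- Continuity of `ρ` already forces differentiability along one-parameter subgroups, so the `deriv`
in `hermAct` is a true derivative and not the default value `0`. -/
theorem hasDerivAt_rep_expCurve [CompleteSpace V] {ρ : SU3 →* (V →L[ℂ] V)} (hρ : Continuous ρ)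
    (hX : X.IsHermitian) (htr : X.trace = 0) :
    HasDerivAt (fun t : ℝ => ρ (expCurve X t)) (Complex.I • hermAct ρ X) 0 := by
  have hd := differentiable_of_continuous_oneParameter
    (hρ.comp (continuous_expCurve hX htr)) (by simp [expCurve_zero])
    (rep_expCurve_add ρ hX htr)
  have h := (hd 0).hasDerivAt
  refine h.congr_deriv ?_
  rw [hermAct_eq, smul_smul]
  simp
  rfl

theorem eq_rep_expCurve_apply [CompleteSpace V] {ρ : SU3 →* (V →L[ℂ] V)} (hρ : Continuous ρ)
    (hX : X.IsHermitian) (htr : X.trace = 0) {y : ℝ → V}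
    (hy : ∀ t, HasDerivAt y (Complex.I • hermAct ρ X (y t)) t) (t : ℝ) :
    y t = ρ (expCurve X t) (y 0) :=
  eq_oneParameter_apply (γ := fun t => ρ (expCurve X t)) (by simp [expCurve_zero])
    (rep_expCurve_add ρ hX htr) (hasDerivAt_rep_expCurve hρ hX htr)
    (by simpa using hy) t

theorem hasDerivAt_rep_expCurve_apply [CompleteSpace V] {ρ : SU3 →* (V →L[ℂ] V)}
    (hρ : Continuous ρ) (hX : X.IsHermitian) (htr : X.trace = 0) (v : V) (t : ℝ) :
    HasDerivAt (fun t => ρ (expCurve X t) v)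
      (Complex.I • hermAct ρ X (ρ (expCurve X t) v)) t := by
  have hadd := rep_expCurve_add ρ hX htr
  have hd := hasDerivAt_rep_expCurve hρ hX htr
  have h1 : HasDerivAt (fun s => ρ (expCurve X (s - t))) (Complex.I • hermAct ρ X) t := by
    have := HasDerivAt.comp_sub_const (f := fun s => ρ (expCurve X s)) t t (by simpa using hd)
    simpa using this
  have h2 := (((ContinuousLinearMap.apply ℂ V) (ρ (expCurve X t) v)).restrictScalars ℝ
    ).hasFDerivAt.comp_hasDerivAt t h1
  have h3 : (fun s => ρ (expCurve X (s - t)) (ρ (expCurve X t) v)) =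
      fun s => ρ (expCurve X s) v := by
    ext1 s
    rw [← mul_apply_eq_comp, ← hadd, sub_add_cancel]
  rw [← h3]
  exact h2.congr_deriv (by simp)

end ExpCurve

end QuarkSymbol

namespace QuarkSymbol

open Matrix

/-! ### The standard traceless Hermitian matrices -/

/-- The diagonal generator `T₃`. -/
noncomputable def genT3 : Matrix (Fin 3) (Fin 3) ℂ := !![1 / 2, 0, 0; 0, -1 / 2, 0; 0, 0, 0]
/-- The diagonal generator `U₃`. -/
noncomputable def genU3 : Matrix (Fin 3) (Fin 3) ℂ := !![0, 0, 0; 0, 1 / 2, 0; 0, 0, -1 / 2]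
/-- `(E₁₂ + E₂₁) / 2`. -/
noncomputable def genT1 : Matrix (Fin 3) (Fin 3) ℂ := !![0, 1 / 2, 0; 1 / 2, 0, 0; 0, 0, 0]
/-- `(E₁₂ - E₂₁) / 2i`. -/
noncomputable def genT2 : Matrix (Fin 3) (Fin 3) ℂ :=
  !![0, -Complex.I / 2, 0; Complex.I / 2, 0, 0; 0, 0, 0]
/-- `(E₂₃ + E₃₂) / 2`. -/
noncomputable def genU1 : Matrix (Fin 3) (Fin 3) ℂ := !![0, 0, 0; 0, 0, 1 / 2; 0, 1 / 2, 0]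
/-- `(E₂₃ - E₃₂) / 2i`. -/
noncomputable def genU2 : Matrix (Fin 3) (Fin 3) ℂ :=
  !![0, 0, 0; 0, 0, -Complex.I / 2; 0, Complex.I / 2, 0]

theorem genT3_isHermitian : genT3.IsHermitian := by
  ext i j; fin_cases i <;> fin_cases j <;> simp [genT3]
theorem genU3_isHermitian : genU3.IsHermitian := by
  ext i j; fin_cases i <;> fin_cases j <;> simp [genU3]
theorem genT1_isHermitian : genT1.IsHermitian := by
  ext i j; fin_cases i <;> fin_cases j <;> simp [genT1]
theorem genT2_isHermitian : genT2.IsHermitian := by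
  ext i j; fin_cases i <;> fin_cases j <;> simp [genT2, neg_div]
theorem genU1_isHermitian : genU1.IsHermitian := by
  ext i j; fin_cases i <;> fin_cases j <;> simp [genU1]
theorem genU2_isHermitian : genU2.IsHermitian := by
  ext i j; fin_cases i <;> fin_cases j <;> simp [genU2, neg_div]
theorem genT3_trace : genT3.trace = 0 := by simp [genT3, trace_fin_three, neg_div]
theorem genU3_trace : genU3.trace = 0 := by simp [genU3, trace_fin_three, neg_div]
theorem genT1_trace : genT1.trace = 0 := by simp [genT1, trace_fin_three]
theorem genT2_trace : genT2.trace = 0 := by simp [genT2, trace_fin_three]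
theorem genU1_trace : genU1.trace = 0 := by simp [genU1, trace_fin_three]
theorem genU2_trace : genU2.trace = 0 := by simp [genU2, trace_fin_three]

section Lie

variable {V : Type*} [NormedAddCommGroup V] [NormedSpace ℂ V] (ρ : SU3 →* (V →L[ℂ] V))

/-- Time reversal in the one-parameter family. With `hermAct_zero` this is all the linearity in the
matrix that the formulas for `T±`, `U±`, `T₃`, `U₃` below require. -/
theorem hermAct_neg (X : Matrix (Fin 3) (Fin 3) ℂ) : hermAct ρ (-X) = -hermAct ρ X := by
  have h : (fun t : ℝ => ρ (expCurve (-X) t)) = fun t : ℝ => (fun s => ρ (expCurve X s)) (-t) := by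
    ext1 t
    simp [expCurve]
  have h2 : deriv (fun t : ℝ => (fun s => ρ (expCurve X s)) (-t)) 0 =
      -deriv (fun s => ρ (expCurve X s)) (-0) :=
    deriv_comp_neg (𝕜 := ℝ) (F := V →L[ℂ] V) (fun s => ρ (expCurve X s)) 0
  rw [hermAct_eq, hermAct_eq, h, h2, neg_zero, smul_neg]

theorem hermAct_zero : hermAct ρ 0 = 0 := by
  simp [hermAct]

theorem lieAct_eq {X A B : Matrix (Fin 3) (Fin 3) ℂ} (hA : (1 / 2 : ℂ) • (X + Xᴴ) = A)
    (hB : (-Complex.I / 2) • (X - Xᴴ) = B) :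
    lieAct ρ X = hermAct ρ A + Complex.I • hermAct ρ B := by
  rw [lieAct, hA, hB]

theorem Tplus_eq : Tplus ρ = hermAct ρ genT1 + Complex.I • hermAct ρ genT2 := by
  apply lieAct_eq <;> ext i j <;> fin_cases i <;> fin_cases j <;> simp [genT1, genT2, neg_div]

theorem Tminus_eq : Tminus ρ = hermAct ρ genT1 - Complex.I • hermAct ρ genT2 := by
  rw [sub_eq_add_neg, ← smul_neg, ← hermAct_neg]
  apply lieAct_eq <;> ext i j <;> fin_cases i <;> fin_cases j <;> simp [genT1, genT2, neg_div]

theorem Uplus_eq : Uplus ρ = hermAct ρ genU1 + Complex.I • hermAct ρ genU2 := by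
  apply lieAct_eq <;> ext i j <;> fin_cases i <;> fin_cases j <;> simp [genU1, genU2, neg_div]

theorem Uminus_eq : Uminus ρ = hermAct ρ genU1 - Complex.I • hermAct ρ genU2 := by
  rw [sub_eq_add_neg, ← smul_neg, ← hermAct_neg]
  apply lieAct_eq <;> ext i j <;> fin_cases i <;> fin_cases j <;> simp [genU1, genU2, neg_div]

theorem T3_eq : T3 ρ = hermAct ρ genT3 := by
  rw [T3, lieAct_eq ρ (A := genT3) (B := 0), hermAct_zero, smul_zero, add_zero] <;> ext i j <;>
    fin_cases i <;> fin_cases j <;> simp [genT3] <;> norm_num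

theorem U3_eq : U3 ρ = hermAct ρ genU3 := by
  rw [U3, lieAct_eq ρ (A := genU3) (B := 0), hermAct_zero, smul_zero, add_zero] <;> ext i j <;>
    fin_cases i <;> fin_cases j <;> simp [genU3] <;> norm_num

/-- Expresses the generator of a real rotation by ladder operators, for which the Gelfand-Tsetlin
formulas and the adjoints are available. -/
theorem I_smul_hermAct_genT2 :
    Complex.I • hermAct ρ genT2 = (1 / 2 : ℂ) • (Tplus ρ - Tminus ρ) := by
  rw [Tplus_eq, Tminus_eq]
  module

theorem I_smul_hermAct_genU2 :
    Complex.I • hermAct ρ genU2 = (1 / 2 : ℂ) • (Uplus ρ - Uminus ρ) := by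
  rw [Uplus_eq, Uminus_eq]
  module

end Lie

/-! ### Explicit one-parameter subgroups and generation of `SU(3)` -/

open scoped Matrix.Norms.Operator in
-- Identifies an exponential from its differential equation: `exp(-itX) R(t)` has derivative zero
-- and value `1` at `t = 0`.
theorem coe_expCurve_eq_of_hasDerivAt {X : Matrix (Fin 3) (Fin 3) ℂ} (hX : X.IsHermitian)
    (htr : X.trace = 0) {R : ℝ → Matrix (Fin 3) (Fin 3) ℂ} (h0 : R 0 = 1)
    (hR : ∀ t i j, HasDerivAt (fun t => R t i j) (((Complex.I • X) * R t) i j) t) (t : ℝ) :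
    (expCurve X t : Matrix (Fin 3) (Fin 3) ℂ) = R t := by
  have hR' : ∀ t, HasDerivAt R ((Complex.I • X) * R t) t := fun t =>
    hasDerivAt_pi.2 fun i => hasDerivAt_pi.2 fun j => hR t i j
  have hM : ∀ t, HasDerivAt (fun t => (expCurve X (-t) : Matrix (Fin 3) (Fin 3) ℂ))
      (-((expCurve X (-t) : Matrix (Fin 3) (Fin 3) ℂ) * (Complex.I • X))) t := by
    intro t
    have h := (hasDerivAt_coe_expCurve hX htr (-t)).scomp t (hasDerivAt_neg t)
    refine h.congr_deriv ?_
    have hc : Commute (Complex.I • X) (expCurve X (-t) : Matrix (Fin 3) (Fin 3) ℂ) := by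
      rw [coe_expCurve hX htr]
      exact (((Commute.refl X).smul_left _).smul_right _).exp_right
    rw [hc.eq, neg_one_smul]
  have hd : ∀ t, HasDerivAt (fun t => (expCurve X (-t) : Matrix (Fin 3) (Fin 3) ℂ) * R t) 0 t := by
    intro t
    refine ((hM t).mul (hR' t)).congr_deriv ?_
    rw [neg_mul, mul_assoc, neg_add_cancel]
  have hconst := is_const_of_deriv_eq_zero (fun x => (hd x).differentiableAt)
    (fun x => (hd x).deriv) t 0
  simp only [neg_zero, expCurve_zero, h0, OneMemClass.coe_one, mul_one] at hconst
  calc (expCurve X t : Matrix (Fin 3) (Fin 3) ℂ)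
      = (expCurve X t : Matrix (Fin 3) (Fin 3) ℂ) *
        ((expCurve X (-t) : Matrix (Fin 3) (Fin 3) ℂ) * R t) := by rw [hconst, mul_one]
    _ = R t := by
      rw [← mul_assoc, ← Submonoid.coe_mul, ← expCurve_add hX htr, add_neg_cancel, expCurve_zero,
        OneMemClass.coe_one, one_mul]

theorem hasDerivAt_ofReal_cos_half (t : ℝ) :
    HasDerivAt (fun t : ℝ => ((Real.cos (t / 2) : ℝ) : ℂ)) (-(Real.sin (t / 2) : ℝ) / 2 : ℂ) t := by
  have h := ((Real.hasDerivAt_cos (t / 2)).comp t ((hasDerivAt_id t).div_const 2)).ofReal_comp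
  refine h.congr_deriv ?_
  push_cast
  ring

theorem hasDerivAt_ofReal_sin_half (t : ℝ) :
    HasDerivAt (fun t : ℝ => ((Real.sin (t / 2) : ℝ) : ℂ)) ((Real.cos (t / 2) : ℝ) / 2 : ℂ) t := by
  have h := ((Real.hasDerivAt_sin (t / 2)).comp t ((hasDerivAt_id t).div_const 2)).ofReal_comp
  refine h.congr_deriv ?_
  push_cast
  ring

theorem coe_expCurve_genT2 (t : ℝ) : (expCurve genT2 t : Matrix (Fin 3) (Fin 3) ℂ) =
    !![((Real.cos (t / 2) : ℝ) : ℂ), ((Real.sin (t / 2) : ℝ) : ℂ), 0;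
      -((Real.sin (t / 2) : ℝ) : ℂ), ((Real.cos (t / 2) : ℝ) : ℂ), 0; 0, 0, 1] := by
  refine coe_expCurve_eq_of_hasDerivAt genT2_isHermitian genT2_trace (R := fun t =>
    !![((Real.cos (t / 2) : ℝ) : ℂ), ((Real.sin (t / 2) : ℝ) : ℂ), 0;
      -((Real.sin (t / 2) : ℝ) : ℂ), ((Real.cos (t / 2) : ℝ) : ℂ), 0; 0, 0, 1]) ?_ ?_ t
  · ext i j; fin_cases i <;> fin_cases j <;> simp
  · intro t i j
    have hI : Complex.I * (-Complex.I / 2) = 1 / 2 := by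
      rw [mul_div_assoc', mul_neg, Complex.I_mul_I, neg_neg]
    have hI' : Complex.I * (Complex.I / 2) = -1 / 2 := by
      rw [mul_div_assoc', Complex.I_mul_I]
    have hc := hasDerivAt_ofReal_cos_half t
    have hs := hasDerivAt_ofReal_sin_half t
    fin_cases i <;> fin_cases j <;>
      simp only [genT2, Matrix.mul_apply, Fin.sum_univ_three, Matrix.smul_apply, smul_eq_mul,
        Fin.zero_eta, Fin.mk_one, Fin.reduceFinMk, of_apply, cons_val', cons_val_zero, cons_val_one,
        cons_val, cons_val_fin_one, hI, hI', mul_zero, zero_mul, add_zero, zero_add] <;>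
      first
      | exact hasDerivAt_const _ _
      | exact hc.congr_deriv (by ring)
      | exact hs.congr_deriv (by ring)
      | exact hs.fun_neg.congr_deriv (by ring)

theorem coe_expCurve_genU2 (t : ℝ) : (expCurve genU2 t : Matrix (Fin 3) (Fin 3) ℂ) =
    !![1, 0, 0; 0, ((Real.cos (t / 2) : ℝ) : ℂ), ((Real.sin (t / 2) : ℝ) : ℂ);
      0, -((Real.sin (t / 2) : ℝ) : ℂ), ((Real.cos (t / 2) : ℝ) : ℂ)] := by
  refine coe_expCurve_eq_of_hasDerivAt genU2_isHermitian genU2_trace (R := fun t =>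
    !![1, 0, 0; 0, ((Real.cos (t / 2) : ℝ) : ℂ), ((Real.sin (t / 2) : ℝ) : ℂ);
      0, -((Real.sin (t / 2) : ℝ) : ℂ), ((Real.cos (t / 2) : ℝ) : ℂ)]) ?_ ?_ t
  · ext i j; fin_cases i <;> fin_cases j <;> simp
  · intro t i j
    have hI : Complex.I * (-Complex.I / 2) = 1 / 2 := by
      rw [mul_div_assoc', mul_neg, Complex.I_mul_I, neg_neg]
    have hI' : Complex.I * (Complex.I / 2) = -1 / 2 := by
      rw [mul_div_assoc', Complex.I_mul_I]
    have hc := hasDerivAt_ofReal_cos_half t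
    have hs := hasDerivAt_ofReal_sin_half t
    fin_cases i <;> fin_cases j <;>
      simp only [genU2, Matrix.mul_apply, Fin.sum_univ_three, Matrix.smul_apply, smul_eq_mul,
        Fin.zero_eta, Fin.mk_one, Fin.reduceFinMk, of_apply, cons_val', cons_val_zero, cons_val_one,
        cons_val, cons_val_fin_one, hI, hI', mul_zero, zero_mul, add_zero, zero_add] <;>
      first
      | exact hasDerivAt_const _ _
      | exact hc.congr_deriv (by ring)
      | exact hs.congr_deriv (by ring)
      | exact hs.fun_neg.congr_deriv (by ring)

theorem coe_expCurve_diagonal {d : Fin 3 → ℂ} (hX : (diagonal d).IsHermitian)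
    (htr : (diagonal d).trace = 0) (t : ℝ) :
    (expCurve (diagonal d) t : Matrix (Fin 3) (Fin 3) ℂ) =
      diagonal fun i => Complex.exp (t * Complex.I * d i) := by
  rw [coe_expCurve hX htr, ← diagonal_smul, exp_diagonal]
  congr 1
  ext i
  rw [Pi.coe_exp, ← Complex.exp_eq_exp_ℂ]
  simp

theorem genT3_eq_diagonal : genT3 = diagonal ![1 / 2, -1 / 2, 0] := by
  ext i j; fin_cases i <;> fin_cases j <;> simp [genT3]

theorem genU3_eq_diagonal : genU3 = diagonal ![0, 1 / 2, -1 / 2] := by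
  ext i j; fin_cases i <;> fin_cases j <;> simp [genU3]

/-- The diagonal element `diag (e^{ia}, e^{ib}, e^{-i(a+b)})`. -/
noncomputable def torus (a b : ℝ) : SU3 := expCurve genT3 (2 * a) * expCurve genU3 (2 * (a + b))

theorem coe_torus (a b : ℝ) : (torus a b : Matrix (Fin 3) (Fin 3) ℂ) =
    diagonal ![Complex.exp (a * Complex.I), Complex.exp (b * Complex.I),
      Complex.exp (-(a + b) * Complex.I)] := by
  have h1 := genT3_isHermitian
  have h2 := genU3_isHermitian
  have h3 := genT3_trace
  have h4 := genU3_trace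
  rw [genT3_eq_diagonal] at h1 h3
  rw [genU3_eq_diagonal] at h2 h4
  rw [torus, Submonoid.coe_mul, genT3_eq_diagonal, genU3_eq_diagonal, coe_expCurve_diagonal h1 h3,
    coe_expCurve_diagonal h2 h4, diagonal_mul_diagonal]
  congr 1
  ext i
  rw [← Complex.exp_add]
  fin_cases i <;> simp <;> congr 1 <;> ring

theorem exists_rotation (x y : ℝ) :
    ∃ t : ℝ, -Real.sin (t / 2) * x + Real.cos (t / 2) * y = 0 := by
  -- The factor `2` compensates the half angle in the spin-one-half rotation matrices.
  refine ⟨2 * Complex.arg ⟨x, y⟩, ?_⟩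
  have h := Complex.norm_mul_cos_add_sin_mul_I ⟨x, y⟩
  have h1 := congrArg Complex.re h
  have h2 := congrArg Complex.im h
  simp [← Complex.ofReal_cos, ← Complex.ofReal_sin, -Complex.norm_mul_cos_arg,
    -Complex.norm_mul_sin_arg] at h1 h2
  rw [mul_div_cancel_left₀ _ two_ne_zero]
  linear_combination Real.sin (Complex.arg ⟨x, y⟩) * h1 - Real.cos (Complex.arg ⟨x, y⟩) * h2

end QuarkSymbol

namespace QuarkSymbol

open Matrix

theorem cexp_neg_arg_mul (z : ℂ) : Complex.exp (-((z.arg : ℂ) * Complex.I)) * z = (‖z‖ : ℝ) := by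
  conv_lhs => rw [← Complex.norm_mul_exp_arg_mul_I z]
  rw [mul_left_comm, ← Complex.exp_add]
  simp

section Generation

variable {P : Subgroup SU3} (hT3 : ∀ t, expCurve genT3 t ∈ P) (hU3 : ∀ t, expCurve genU3 t ∈ P)
  (hT2 : ∀ t, expCurve genT2 t ∈ P) (hU2 : ∀ t, expCurve genU2 t ∈ P)

include hT3 hU3 hU2 in
-- The torus makes the last two coordinates real and nonnegative, and a rotation in their plane
-- kills the last one. The two vanishing entries say that `g` preserves the line of the first basis
-- vector, so a first column that is already reduced stays reduced.
theorem exists_mem_mulVec_two_eq_zero (v : Fin 3 → ℂ) : ∃ g ∈ P,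
    ((g : Matrix (Fin 3) (Fin 3) ℂ) *ᵥ v) 2 = 0 ∧ (g : Matrix (Fin 3) (Fin 3) ℂ) 1 0 = 0 ∧
      (g : Matrix (Fin 3) (Fin 3) ℂ) 2 0 = 0 := by
  obtain ⟨t, ht⟩ := exists_rotation ‖v 1‖ ‖v 2‖
  have ht' := congrArg (fun x : ℝ => (x : ℂ)) ht
  push_cast at ht'
  -- `torus a b` multiplies the last two coordinates by `e^{ib}` and `e^{-i(a+b)}`. Cancelling the
  -- phases of `v 1` and `v 2` requires `b = -arg (v 1)` and `a + b = arg (v 2)`.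
  refine ⟨expCurve genU2 t * torus ((v 2).arg + (v 1).arg) (-(v 1).arg),
    P.mul_mem (hU2 t) (P.mul_mem (hT3 _) (hU3 _)), ?_, ?_, ?_⟩
  · rw [Submonoid.coe_mul, coe_expCurve_genU2, coe_torus, ← mulVec_mulVec]
    have h1 := cexp_neg_arg_mul (v 1)
    have h2 := cexp_neg_arg_mul (v 2)
    simp [mulVec, dotProduct, Fin.sum_univ_three, diagonal_apply, h1, h2]
    linear_combination ht'
  · rw [Submonoid.coe_mul, coe_expCurve_genU2, coe_torus]
    simp [mul_diagonal]
  · rw [Submonoid.coe_mul, coe_expCurve_genU2, coe_torus]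
    simp [mul_diagonal]

include hT3 hU3 hT2 in
theorem exists_mem_mulVec_one_eq_zero {v : Fin 3 → ℂ} (hv : v 2 = 0) : ∃ g ∈ P,
    ((g : Matrix (Fin 3) (Fin 3) ℂ) *ᵥ v) 1 = 0 ∧
      ((g : Matrix (Fin 3) (Fin 3) ℂ) *ᵥ v) 2 = 0 := by
  obtain ⟨t, ht⟩ := exists_rotation ‖v 0‖ ‖v 1‖
  have ht' := congrArg (fun x : ℝ => (x : ℂ)) ht
  push_cast at ht'
  refine ⟨expCurve genT2 t * torus (-(v 0).arg) (-(v 1).arg),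
    P.mul_mem (hT2 t) (P.mul_mem (hT3 _) (hU3 _)), ?_, ?_⟩
  · rw [Submonoid.coe_mul, coe_expCurve_genT2, coe_torus, ← mulVec_mulVec]
    have h1 := cexp_neg_arg_mul (v 0)
    have h2 := cexp_neg_arg_mul (v 1)
    simp [mulVec, dotProduct, Fin.sum_univ_three, diagonal_apply, h1, h2]
    linear_combination ht'
  · rw [Submonoid.coe_mul, coe_expCurve_genT2, coe_torus, ← mulVec_mulVec]
    simp [mulVec, dotProduct, Fin.sum_univ_three, diagonal_apply, hv]

include hT3 hU3 hT2 hU2 in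
theorem exists_mem_mulVec_eq_single (v : Fin 3 → ℂ) : ∃ g ∈ P,
    ((g : Matrix (Fin 3) (Fin 3) ℂ) *ᵥ v) 1 = 0 ∧
      ((g : Matrix (Fin 3) (Fin 3) ℂ) *ᵥ v) 2 = 0 := by
  obtain ⟨g, hg, h2, -⟩ := exists_mem_mulVec_two_eq_zero hT3 hU3 hU2 v
  obtain ⟨k, hk, h⟩ := exists_mem_mulVec_one_eq_zero hT3 hU3 hT2 h2
  refine ⟨k * g, P.mul_mem hk hg, ?_⟩
  rwa [Submonoid.coe_mul, ← mulVec_mulVec]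

/-- An upper triangular unitary matrix is diagonal: orthogonality to the first column clears the
first row, then orthogonality to the second column clears the second row. The first two diagonal
entries have modulus one, and the determinant fixes the third. -/
theorem eq_torus_of_upper {m : SU3} (h10 : (m : Matrix (Fin 3) (Fin 3) ℂ) 1 0 = 0)
    (h20 : (m : Matrix (Fin 3) (Fin 3) ℂ) 2 0 = 0) (h21 : (m : Matrix (Fin 3) (Fin 3) ℂ) 2 1 = 0) :
    ∃ a b, m = torus a b := by
  set M : Matrix (Fin 3) (Fin 3) ℂ := (m : Matrix (Fin 3) (Fin 3) ℂ) with hM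
  have hmem := mem_specialUnitaryGroup_iff.1 m.2
  have hu : star M * M = 1 := mem_unitaryGroup_iff'.1 hmem.1
  have e : ∀ i j, conj (M 0 i) * M 0 j + conj (M 1 i) * M 1 j + conj (M 2 i) * M 2 j =
      (1 : Matrix (Fin 3) (Fin 3) ℂ) i j := by
    intro i j
    rw [← hu, Matrix.mul_apply, Fin.sum_univ_three]
    rfl
  have e00 := e 0 0
  have e01 := e 0 1
  have e02 := e 0 2
  have e11 := e 1 1
  have e12 := e 1 2
  simp [h10, h20] at e00 e01 e02
  have h00 : M 0 0 ≠ 0 := by rintro h; simp [h] at e00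
  have h01 : M 0 1 = 0 := e01.resolve_left h00
  have h02 : M 0 2 = 0 := e02.resolve_left h00
  simp [h01, h02, h21] at e11 e12
  have h11 : M 1 1 ≠ 0 := by rintro h; simp [h] at e11
  have h12 : M 1 2 = 0 := e12.resolve_left h11
  have hdet : M 0 0 * M 1 1 * M 2 2 = 1 := by
    have := hmem.2
    rw [← hM, det_fin_three] at this
    simpa [h10, h20, h21, h01, h02, h12] using this
  have hnorm : ∀ z : ℂ, conj z * z = 1 → z = Complex.exp (z.arg * Complex.I) := by
    intro z hz
    rw [Complex.conj_mul'] at hz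
    have : ‖z‖ = 1 := by
      have h3 : ‖z‖ ^ 2 = 1 := by exact_mod_cast hz
      exact (pow_eq_one_iff_of_nonneg (norm_nonneg z) two_ne_zero).1 h3
    conv_lhs => rw [← Complex.norm_mul_exp_arg_mul_I z, this]
    simp
  have e00' := hnorm _ e00
  have e11' := hnorm _ e11
  refine ⟨(M 0 0).arg, (M 1 1).arg, Subtype.ext ?_⟩
  rw [coe_torus, ← hM]
  have h22 : M 2 2 = Complex.exp (-((M 0 0).arg + (M 1 1).arg) * Complex.I) := by
    rw [neg_mul, Complex.exp_neg, add_mul, Complex.exp_add, ← e00', ← e11']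
    exact eq_inv_of_mul_eq_one_right hdet
  rw [← e00', ← e11', ← h22]
  ext i j
  fin_cases i <;> fin_cases j <;> simp [h10, h20, h21, h01, h02, h12]

include hT3 hU3 hT2 hU2 in
/-- `SU(3)` is generated by the exponentials of `T₃`, `U₃` and of the rotations in the first two and
the last two coordinates. -/
theorem subgroup_eq_top : P = ⊤ := by
  rw [eq_top_iff]
  intro h _
  -- Givens reduction: multiplication by elements of `P` clears the first column of `h` below the
  -- diagonal, then the last entry of the second column. The triangular matrix that remains is in
  -- the torus, which lies in `P`.
  obtain ⟨g, hg, h1, h2⟩ := exists_mem_mulVec_eq_single hT3 hU3 hT2 hU2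
    fun i => (h : Matrix (Fin 3) (Fin 3) ℂ) i 0
  obtain ⟨k, hk, h3, h4, h5⟩ := exists_mem_mulVec_two_eq_zero hT3 hU3 hU2
    fun i => ((g * h : SU3) : Matrix (Fin 3) (Fin 3) ℂ) i 1
  have h1' : ((g * h : SU3) : Matrix (Fin 3) (Fin 3) ℂ) 1 0 = 0 := h1
  have h2' : ((g * h : SU3) : Matrix (Fin 3) (Fin 3) ℂ) 2 0 = 0 := h2
  obtain ⟨a, b, hab⟩ := eq_torus_of_upper (m := k * (g * h))
    (by rw [Submonoid.coe_mul, Matrix.mul_apply, Fin.sum_univ_three, h1', h2', h4]; simp)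
    (by rw [Submonoid.coe_mul, Matrix.mul_apply, Fin.sum_univ_three, h1', h2', h5]; simp) h3
  have hmem : k * (g * h) ∈ P := by
    rw [hab]
    exact P.mul_mem (hT3 _) (hU3 _)
  exact (P.mul_mem_cancel_left hg).1 ((P.mul_mem_cancel_left hk).1 hmem)

end Generation

/-! ### Action on `ℂ³` and on the projective plane -/

theorem actC3_mul (g h : SU3) (z : C3) : actC3 (g * h) z = actC3 g (actC3 h z) := by
  simp [actC3, Matrix.toLpLin_apply, Matrix.mulVec_mulVec]

theorem actC3_one (z : C3) : actC3 1 z = z := by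
  simp [actC3]

theorem actC3_ofLp (g : SU3) (z : C3) (i : Fin 3) :
    actC3 g z i = ((g : Matrix (Fin 3) (Fin 3) ℂ) *ᵥ z.ofLp) i := by
  simp [actC3, Matrix.toLpLin_apply]

/-- The first vector of the standard basis of `ℂ³`. -/
noncomputable def baseVec : C3 := EuclideanSpace.single 0 1

/-- Inverts the reduction of a vector to a multiple of the first basis vector; transitivity on `ℂP²`
follows. -/
theorem exists_eq_smul_actC3 (z : C3) : ∃ (g : SU3) (c : ℂ), z = c • actC3 g baseVec := by
  obtain ⟨g, -, h1, h2⟩ := exists_mem_mulVec_eq_single (P := ⊤) (fun _ => Subgroup.mem_top _)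
    (fun _ => Subgroup.mem_top _) (fun _ => Subgroup.mem_top _) (fun _ => Subgroup.mem_top _) z.ofLp
  rw [← actC3_ofLp] at h1 h2
  refine ⟨g⁻¹, actC3 g z 0, ?_⟩
  have h : actC3 g z = (actC3 g z 0) • baseVec := by
    ext i
    fin_cases i <;> simp [baseVec, h1, h2]
  rw [← map_smul, ← h, ← actC3_mul, inv_mul_cancel, actC3_one]

theorem norm_actC3 (g : SU3) (z : C3) : ‖actC3 g z‖ = ‖z‖ := by
  have hu : star (g : Matrix (Fin 3) (Fin 3) ℂ) * g = 1 :=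
    mem_unitaryGroup_iff'.1 (mem_specialUnitaryGroup_iff.1 g.2).1
  have h : ⟪actC3 g z, actC3 g z⟫_ℂ = ⟪z, z⟫_ℂ := by
    rw [EuclideanSpace.inner_eq_star_dotProduct, EuclideanSpace.inner_eq_star_dotProduct]
    have h1 : (actC3 g z).ofLp = (g : Matrix (Fin 3) (Fin 3) ℂ) *ᵥ z.ofLp := by
      ext i; exact actC3_ofLp g z i
    rw [h1, star_mulVec, dotProduct_comm, ← dotProduct_mulVec, mulVec_mulVec,
      ← star_eq_conjTranspose, hu, one_mulVec, dotProduct_comm]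
  rw [inner_self_eq_norm_sq_to_K, inner_self_eq_norm_sq_to_K] at h
  have h2 : ‖actC3 g z‖ ^ 2 = ‖z‖ ^ 2 := by exact_mod_cast h
  exact (sq_eq_sq₀ (norm_nonneg _) (norm_nonneg _)).1 h2

theorem baseVec_ne_zero : baseVec ≠ 0 := by simp [baseVec]

theorem basePoint_eq : basePoint = Projectivization.mk ℂ baseVec baseVec_ne_zero := rfl

theorem actCP2_mk (g : SU3) (z : C3) (hz : z ≠ 0) : actCP2 g (Projectivization.mk ℂ z hz) =
    Projectivization.mk ℂ (actC3 g z) (by simpa using (actC3_injective g).ne hz) := by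
  simp [actCP2, Projectivization.map_mk]

theorem exists_actCP2_basePoint (x : CP2) : ∃ g, actCP2 g basePoint = x := by
  induction x using Projectivization.ind with
  | h z hz =>
    obtain ⟨g, c, h⟩ := exists_eq_smul_actC3 z
    refine ⟨g, ?_⟩
    have hc : c ≠ 0 := by rintro rfl; simp [h] at hz
    rw [basePoint_eq, actCP2_mk, Projectivization.mk_eq_mk_iff']
    exact ⟨c⁻¹, by rw [h, smul_smul, inv_mul_cancel₀ hc, one_smul]⟩

theorem actCP2_mul (g h : SU3) (x : CP2) : actCP2 (g * h) x = actCP2 g (actCP2 h x) := by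
  induction x using Projectivization.ind with
  | h z hz => simp only [actCP2_mk, actC3_mul]

theorem hasDerivAt_actC3_expCurve {X : Matrix (Fin 3) (Fin 3) ℂ} (hX : X.IsHermitian)
    (htr : X.trace = 0) (z : C3) (t : ℝ) (i : Fin 3) :
    HasDerivAt (fun t => actC3 (expCurve X t) z i)
      (((Complex.I • X) *ᵥ (actC3 (expCurve X t) z).ofLp) i) t := by
  have h := hasDerivAt_coe_expCurve hX htr t
  have h' : ∀ i j, HasDerivAt (fun t => (expCurve X t : Matrix (Fin 3) (Fin 3) ℂ) i j)
      (((Complex.I • X) * (expCurve X t : Matrix (Fin 3) (Fin 3) ℂ)) i j) t := fun i j =>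
    hasDerivAt_pi.1 (hasDerivAt_pi.1 h i) j
  have h3 : HasDerivAt (fun t => ∑ j, (expCurve X t : Matrix (Fin 3) (Fin 3) ℂ) i j * z j)
      (∑ j, ((Complex.I • X) * (expCurve X t : Matrix (Fin 3) (Fin 3) ℂ)) i j * z j) t :=
    HasDerivAt.fun_sum fun j _ => (h' i j).mul_const (z j)
  have h4 : (actC3 (expCurve X t) z).ofLp = (expCurve X t : Matrix (Fin 3) (Fin 3) ℂ) *ᵥ z.ofLp := by
    ext i; exact actC3_ofLp _ z i
  rw [h4, mulVec_mulVec]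
  simp_rw [actC3_ofLp]
  exact h3

end QuarkSymbol

namespace QuarkSymbol

set_option linter.unusedSectionVars false

/-! ### Equivariance can be checked on one-parameter subgroups -/

/-- The elements at which `F` is equivariant form a subgroup, and it contains generators. Nothing is
assumed of `F`, so this serves both the linear intertwiners and the nonlinear maps `Φ_p`. -/
theorem equivariant_of_expCurve {S S' : Type*} {a : SU3 → S → S} {b : SU3 → S' → S'}
    (ha1 : ∀ x, a 1 x = x) (ha : ∀ g h x, a (g * h) x = a g (a h x))
    (hb1 : ∀ y, b 1 y = y) (hb : ∀ g h y, b (g * h) y = b g (b h y)) {F : S → S'}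
    (hT3 : ∀ t x, F (a (expCurve genT3 t) x) = b (expCurve genT3 t) (F x))
    (hU3 : ∀ t x, F (a (expCurve genU3 t) x) = b (expCurve genU3 t) (F x))
    (hT2 : ∀ t x, F (a (expCurve genT2 t) x) = b (expCurve genT2 t) (F x))
    (hU2 : ∀ t x, F (a (expCurve genU2 t) x) = b (expCurve genU2 t) (F x)) (g : SU3) (x : S) :
    F (a g x) = b g (F x) := by
  let P : Subgroup SU3 :=
    { carrier := {g | ∀ x, F (a g x) = b g (F x)}
      mul_mem' := fun {g h} hg hh x => by rw [ha, hg, hh, hb]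
      one_mem' := fun x => by rw [ha1, hb1]
      inv_mem' := fun {g} hg x => by
        have h := congrArg (b g⁻¹) (hg (a g⁻¹ x))
        rw [← ha, ← hb, mul_inv_cancel, inv_mul_cancel, ha1, hb1] at h
        exact h.symm }
  have hP : P = ⊤ := subgroup_eq_top hT3 hU3 hT2 hU2
  have hg : g ∈ P := hP ▸ Subgroup.mem_top g
  exact hg x

/-! ### Adjoints in unitary representations -/

section Unitary

variable {H : Type*} [NormedAddCommGroup H] [InnerProductSpace ℂ H] [CompleteSpace H]
  {ρ : SU3 →* (H →L[ℂ] H)}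

/-- Differentiate the constant function `⟨ρ(exp itX) v, ρ(exp itX) w⟩` at `t = 0`. -/
theorem IsUnitaryRep.inner_hermAct (hρ : IsUnitaryRep ρ) {X : Matrix (Fin 3) (Fin 3) ℂ}
    (hX : X.IsHermitian) (htr : X.trace = 0) (v w : H) :
    ⟪hermAct ρ X v, w⟫_ℂ = ⟪v, hermAct ρ X w⟫_ℂ := by
  have h := (hasDerivAt_rep_expCurve_apply hρ.continuous hX htr v 0).inner ℂ
    (hasDerivAt_rep_expCurve_apply hρ.continuous hX htr w 0)
  simp only [hρ.inner_map] at h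
  have h2 := h.unique (hasDerivAt_const (0 : ℝ) _)
  simp only [expCurve_zero, map_one, one_apply_eq_self, inner_smul_left,
    inner_smul_right, Complex.conj_I] at h2
  have h3 : Complex.I * (⟪hermAct ρ X v, w⟫_ℂ - ⟪v, hermAct ρ X w⟫_ℂ) = 0 := by
    linear_combination -h2
  exact sub_eq_zero.1 ((mul_eq_zero.1 h3).resolve_left Complex.I_ne_zero)

theorem IsUnitaryRep.inner_Tplus (hρ : IsUnitaryRep ρ) (v w : H) :
    ⟪Tplus ρ v, w⟫_ℂ = ⟪v, Tminus ρ w⟫_ℂ := by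
  rw [Tplus_eq, Tminus_eq, add_apply, smul_apply, sub_apply, smul_apply, inner_add_left,
    inner_smul_left, inner_sub_right, inner_smul_right, Complex.conj_I,
    hρ.inner_hermAct genT1_isHermitian genT1_trace, hρ.inner_hermAct genT2_isHermitian genT2_trace]
  ring

theorem IsUnitaryRep.inner_Uplus (hρ : IsUnitaryRep ρ) (v w : H) :
    ⟪Uplus ρ v, w⟫_ℂ = ⟪v, Uminus ρ w⟫_ℂ := by
  rw [Uplus_eq, Uminus_eq, add_apply, smul_apply, sub_apply, smul_apply, inner_add_left,
    inner_smul_left, inner_sub_right, inner_smul_right, Complex.conj_I,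
    hρ.inner_hermAct genU1_isHermitian genU1_trace, hρ.inner_hermAct genU2_isHermitian genU2_trace]
  ring

theorem IsUnitaryRep.inner_Tminus (hρ : IsUnitaryRep ρ) (v w : H) :
    ⟪Tminus ρ v, w⟫_ℂ = ⟪v, Tplus ρ w⟫_ℂ := by
  rw [← inner_conj_symm, ← hρ.inner_Tplus, inner_conj_symm]

theorem IsUnitaryRep.inner_Uminus (hρ : IsUnitaryRep ρ) (v w : H) :
    ⟪Uminus ρ v, w⟫_ℂ = ⟪v, Uplus ρ w⟫_ℂ := by
  rw [← inner_conj_symm, ← hρ.inner_Uplus, inner_conj_symm]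

theorem IsUnitaryRep.adjoint_Tplus (hρ : IsUnitaryRep ρ) :
    ContinuousLinearMap.adjoint (Tplus ρ) = Tminus ρ :=
  ((ContinuousLinearMap.eq_adjoint_iff _ _).2 hρ.inner_Tminus).symm

theorem IsUnitaryRep.adjoint_Uplus (hρ : IsUnitaryRep ρ) :
    ContinuousLinearMap.adjoint (Uplus ρ) = Uminus ρ :=
  ((ContinuousLinearMap.eq_adjoint_iff _ _).2 hρ.inner_Uminus).symm

theorem IsUnitaryRep.inner_map_left (hρ : IsUnitaryRep ρ) (g : SU3) (v w : H) :
    ⟪ρ g v, w⟫_ℂ = ⟪v, ρ g⁻¹ w⟫_ℂ := by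
  rw [← hρ.inner_map g v (ρ g⁻¹ w), ← mul_apply_eq_comp (ρ g), ← map_mul, mul_inv_cancel, map_one]
  rfl

theorem IsUnitaryRep.norm_map (hρ : IsUnitaryRep ρ) (g : SU3) (v : H) : ‖ρ g v‖ = ‖v‖ := by
  rw [@norm_eq_sqrt_re_inner ℂ, @norm_eq_sqrt_re_inner ℂ, hρ.inner_map]

end Unitary

/-! ### The conjugation representation -/

section Conj

variable {V : Type*} [NormedAddCommGroup V] [NormedSpace ℂ V] {ρ : SU3 →* (V →L[ℂ] V)}

theorem conjRep_apply (ρ : SU3 →* (V →L[ℂ] V)) (g : SU3) (A : V →L[ℂ] V) :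
    conjRep ρ g A = ρ g * A * ρ g⁻¹ := rfl

theorem continuous_conjRep (hρ : Continuous ρ) : Continuous (conjRep ρ) := by
  have h : Continuous fun g => ContinuousLinearMap.mulLeftRight ℂ (V →L[ℂ] V) (ρ g) (ρ g⁻¹) :=
    ((ContinuousLinearMap.mulLeftRight ℂ (V →L[ℂ] V)).continuous.comp hρ).clm_apply
      (hρ.comp continuous_inv)
  exact h

variable [CompleteSpace V]

theorem expCurve_inv {X : Matrix (Fin 3) (Fin 3) ℂ} (hX : X.IsHermitian) (htr : X.trace = 0)
    (t : ℝ) : (expCurve X t)⁻¹ = expCurve X (-t) := by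
  rw [inv_eq_iff_mul_eq_one, ← expCurve_add hX htr, add_neg_cancel, expCurve_zero]

/-- Leibniz rule for `ρ(exp itX) A ρ(exp(-itX))`: the derived action on operators is the commutator.
-/
theorem hermAct_conjRep (hρ : Continuous ρ) {X : Matrix (Fin 3) (Fin 3) ℂ}
    (hX : X.IsHermitian) (htr : X.trace = 0) (A : V →L[ℂ] V) :
    hermAct (conjRep ρ) X A = hermAct ρ X * A - A * hermAct ρ X := by
  have h1 := hasDerivAt_rep_expCurve_apply (continuous_conjRep hρ) hX htr A 0
  have h2 := hasDerivAt_rep_expCurve hρ hX htr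
  have h3 : HasDerivAt (fun t : ℝ => ρ (expCurve X (-t))) (-(Complex.I • hermAct ρ X)) 0 := by
    have h2' : HasDerivAt (fun t : ℝ => ρ (expCurve X t)) (Complex.I • hermAct ρ X) (-0) := by
      simpa using h2
    exact (h2'.scomp (0 : ℝ) (hasDerivAt_neg 0)).congr_deriv (by simp)
  have h4 := ((ContinuousLinearMap.mul ℂ (V →L[ℂ] V)).flip A).restrictScalars ℝ
    |>.hasFDerivAt.comp_hasDerivAt (0 : ℝ) h2
  have h5 := (ContinuousLinearMap.mul ℂ (V →L[ℂ] V)).bilinearRestrictScalars ℝ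
    |>.hasDerivAt_of_bilinear (fun _ => h4) (fun _ => h3)
  have h6 : HasDerivAt (fun t => conjRep ρ (expCurve X t) A)
      (Complex.I • (hermAct ρ X * A - A * hermAct ρ X)) 0 := by
    simp only [conjRep_apply, expCurve_inv hX htr]
    refine h5.congr_deriv ?_
    simp [expCurve_zero, smul_sub]
    abel
  have h7 := h1.unique h6
  simp only [expCurve_zero, map_one, one_apply_eq_self] at h7
  exact smul_right_injective _ Complex.I_ne_zero h7

theorem Tplus_conjRep (hρ : Continuous ρ) (A : V →L[ℂ] V) :
    Tplus (conjRep ρ) A = Tplus ρ * A - A * Tplus ρ := by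
  simp only [Tplus_eq, add_apply, smul_apply,
    hermAct_conjRep hρ genT1_isHermitian genT1_trace,
    hermAct_conjRep hρ genT2_isHermitian genT2_trace, add_mul, mul_add, smul_mul_assoc,
    mul_smul_comm]
  module

theorem Tminus_conjRep (hρ : Continuous ρ) (A : V →L[ℂ] V) :
    Tminus (conjRep ρ) A = Tminus ρ * A - A * Tminus ρ := by
  simp only [Tminus_eq, sub_apply, smul_apply,
    hermAct_conjRep hρ genT1_isHermitian genT1_trace,
    hermAct_conjRep hρ genT2_isHermitian genT2_trace, sub_mul, mul_sub, smul_mul_assoc,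
    mul_smul_comm]
  module

theorem Uplus_conjRep (hρ : Continuous ρ) (A : V →L[ℂ] V) :
    Uplus (conjRep ρ) A = Uplus ρ * A - A * Uplus ρ := by
  simp only [Uplus_eq, add_apply, smul_apply,
    hermAct_conjRep hρ genU1_isHermitian genU1_trace,
    hermAct_conjRep hρ genU2_isHermitian genU2_trace, add_mul, mul_add, smul_mul_assoc,
    mul_smul_comm]
  module

theorem Uminus_conjRep (hρ : Continuous ρ) (A : V →L[ℂ] V) :
    Uminus (conjRep ρ) A = Uminus ρ * A - A * Uminus ρ := by
  simp only [Uminus_eq, sub_apply, smul_apply,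
    hermAct_conjRep hρ genU1_isHermitian genU1_trace,
    hermAct_conjRep hρ genU2_isHermitian genU2_trace, sub_mul, mul_sub, smul_mul_assoc,
    mul_smul_comm]
  module

theorem U3_conjRep (hρ : Continuous ρ) (A : V →L[ℂ] V) :
    U3 (conjRep ρ) A = U3 ρ * A - A * U3 ρ := by
  simp only [U3_eq, hermAct_conjRep hρ genU3_isHermitian genU3_trace]

end Conj

/-! ### The trace inner product -/

section TraceInner

variable {H : Type*} [NormedAddCommGroup H] [InnerProductSpace ℂ H]

theorem opTrace_mul_comm (A B : H →L[ℂ] H) : opTrace (A * B) = opTrace (B * A) :=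
  LinearMap.trace_mul_comm ℂ (A : H →ₗ[ℂ] H) (B : H →ₗ[ℂ] H)

theorem opTrace_add (A B : H →L[ℂ] H) : opTrace (A + B) = opTrace A + opTrace B := by
  simp [opTrace]

theorem opTrace_sub (A B : H →L[ℂ] H) : opTrace (A - B) = opTrace A - opTrace B := by
  simp [opTrace]

theorem opTrace_smul (c : ℂ) (A : H →L[ℂ] H) : opTrace (c • A) = c * opTrace A := by
  simp [opTrace]

variable [CompleteSpace H]

/-- The trace inner product with a fixed operator, as a linear form. -/
noncomputable def traceInnerₗ (A : H →L[ℂ] H) : (H →L[ℂ] H) →ₗ[ℂ] ℂ where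
  toFun B := traceInner A B
  map_add' B C := by simp [traceInner, mul_add, opTrace_add]
  map_smul' c B := by simp [traceInner, opTrace_smul]

theorem traceInnerₗ_apply (A B : H →L[ℂ] H) : traceInnerₗ A B = traceInner A B := rfl

variable [FiniteDimensional ℂ H]

theorem opTrace_eq_sum {ι : Type*} [Fintype ι] (b : OrthonormalBasis ι ℂ H) (A : H →L[ℂ] H) :
    opTrace A = ∑ i, ⟪b i, A (b i)⟫_ℂ :=
  LinearMap.trace_eq_sum_inner (A : H →ₗ[ℂ] H) b

theorem opTrace_adjoint (A : H →L[ℂ] H) :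
    opTrace (ContinuousLinearMap.adjoint A) = conj (opTrace A) := by
  rw [opTrace_eq_sum (stdOrthonormalBasis ℂ H), opTrace_eq_sum (stdOrthonormalBasis ℂ H), map_sum]
  refine Finset.sum_congr rfl fun i _ => ?_
  rw [ContinuousLinearMap.adjoint_inner_right, inner_conj_symm]

theorem traceInner_conj_symm (A B : H →L[ℂ] H) : conj (traceInner A B) = traceInner B A := by
  rw [traceInner, ← opTrace_adjoint, traceInner]
  congr 1
  change star (star A * B) = star B * A
  simp

theorem eq_zero_of_traceInner_self {A : H →L[ℂ] H} (h : traceInner A A = 0) : A = 0 := by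
  rw [traceInner, opTrace_eq_sum (stdOrthonormalBasis ℂ H)] at h
  have h2 : ∑ i, ‖A (stdOrthonormalBasis ℂ H i)‖ ^ 2 = 0 := by
    have h3 : ∀ i, ⟪stdOrthonormalBasis ℂ H i,
        (ContinuousLinearMap.adjoint A * A) (stdOrthonormalBasis ℂ H i)⟫_ℂ =
        ((‖A (stdOrthonormalBasis ℂ H i)‖ ^ 2 : ℝ) : ℂ) := by
      intro i
      rw [mul_apply_eq_comp, ContinuousLinearMap.adjoint_inner_right, inner_self_eq_norm_sq_to_K]
      norm_cast
    simp_rw [h3] at h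
    exact_mod_cast h
  rw [Finset.sum_eq_zero_iff_of_nonneg fun i _ => sq_nonneg _] at h2
  have h4 : (A : H →ₗ[ℂ] H) = 0 :=
    (stdOrthonormalBasis ℂ H).toBasis.ext fun i => by simpa using h2 i (Finset.mem_univ i)
  ext v
  exact congrArg (fun B : H →ₗ[ℂ] H => B v) h4

/-- The trace form is definite, so an operator is determined by its pairings with a spanning set. -/
theorem eq_of_traceInner_eq {S : Set (H →L[ℂ] H)} (hS : Submodule.span ℂ S = ⊤)
    {B C : H →L[ℂ] H} (h : ∀ A ∈ S, traceInner A B = traceInner A C) : B = C := by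
  have h2 : ∀ A, traceInner (B - C) A = 0 := by
    intro A
    have hA : A ∈ Submodule.span ℂ S := hS ▸ Submodule.mem_top
    have hle : Submodule.span ℂ S ≤ LinearMap.ker (traceInnerₗ (B - C)) := by
      refine Submodule.span_le.2 fun A hA => ?_
      rw [SetLike.mem_coe, LinearMap.mem_ker, traceInnerₗ_apply, ← traceInner_conj_symm,
        ← traceInnerₗ_apply, map_sub, traceInnerₗ_apply, traceInnerₗ_apply, h A hA, sub_self,
        map_zero]
    exact hle hA
  exact sub_eq_zero.1 (eq_zero_of_traceInner_self (h2 _))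

variable {ρ : SU3 →* (H →L[ℂ] H)}

/-- By cyclicity of the trace, the commutators with `T₋` and with its adjoint `T₊` are adjoint to
each other on operators. -/
theorem IsUnitaryRep.traceInner_Tminus (hρ : IsUnitaryRep ρ) (A B : H →L[ℂ] H) :
    traceInner (Tminus (conjRep ρ) A) B = traceInner A (Tplus (conjRep ρ) B) := by
  rw [Tminus_conjRep hρ.continuous, Tplus_conjRep hρ.continuous, ← hρ.adjoint_Tplus, traceInner,
    traceInner]
  change opTrace (star (star (Tplus ρ) * A - A * star (Tplus ρ)) * B) =
    opTrace (star A * (Tplus ρ * B - B * Tplus ρ))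
  rw [star_sub, star_mul, star_mul, star_star, sub_mul, mul_sub, opTrace_sub, opTrace_sub,
    mul_assoc, mul_assoc, opTrace_mul_comm (Tplus ρ), mul_assoc]

theorem IsUnitaryRep.traceInner_Uminus (hρ : IsUnitaryRep ρ) (A B : H →L[ℂ] H) :
    traceInner (Uminus (conjRep ρ) A) B = traceInner A (Uplus (conjRep ρ) B) := by
  rw [Uminus_conjRep hρ.continuous, Uplus_conjRep hρ.continuous, ← hρ.adjoint_Uplus, traceInner,
    traceInner]
  change opTrace (star (star (Uplus ρ) * A - A * star (Uplus ρ)) * B) =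
    opTrace (star A * (Uplus ρ * B - B * Uplus ρ))
  rw [star_sub, star_mul, star_mul, star_star, sub_mul, mul_sub, opTrace_sub, opTrace_sub,
    mul_assoc, mul_assoc, opTrace_mul_comm (Uplus ρ), mul_assoc]

end TraceInner

end QuarkSymbol

namespace QuarkSymbol

set_option linter.unusedSectionVars false

/-! ### Gelfand-Tsetlin bases determine the representation -/

instance {p q : ℕ} : Finite (GTPattern p q) :=
  Finite.of_injective
    (fun r : GTPattern p q => ((⟨r.rp, by have := r.rp_le; omega⟩ : Fin (p + q + 1)),
      (⟨r.rm, by have := r.rm_le; omega⟩ : Fin (p + q + 1)),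
      (⟨r.nu3, by have := r.nu3_le_rp; have := r.rp_le; omega⟩ : Fin (p + q + 1))))
    (by
      intro r s h
      simp only [Prod.mk.injEq, Fin.mk.injEq] at h
      exact GTPattern.ext h.1 h.2.1 h.2.2)

noncomputable instance {p q : ℕ} : Fintype (GTPattern p q) := Fintype.ofFinite _

section GTBasis

variable {V : Type*} [NormedAddCommGroup V] [InnerProductSpace ℂ V] [FiniteDimensional ℂ V]
  {τ : SU3 →* (V →L[ℂ] V)} {p q : ℕ} {f : GTPattern p q → V}

/-- A Gelfand-Tsetlin basis as an orthonormal basis. -/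
noncomputable def IsGTBasis.toOrthonormalBasis (hf : IsGTBasis τ p q f) :
    OrthonormalBasis (GTPattern p q) ℂ V :=
  OrthonormalBasis.mk hf.orthonormal hf.span_eq_top.ge

theorem IsGTBasis.toOrthonormalBasis_apply (hf : IsGTBasis τ p q f) (r : GTPattern p q) :
    hf.toOrthonormalBasis r = f r := by
  simp [IsGTBasis.toOrthonormalBasis]

variable {W : Type*} [NormedAddCommGroup W] [NormedSpace ℂ W] {σ : SU3 →* (W →L[ℂ] W)}
  {E : GTPattern p q → W}

/-- The linear map that sends a Gelfand-Tsetlin basis to a given family. -/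
noncomputable def IsGTBasis.lift (hf : IsGTBasis τ p q f) (E : GTPattern p q → W) : V →ₗ[ℂ] W :=
  hf.toOrthonormalBasis.toBasis.constr ℂ E

theorem IsGTBasis.lift_apply (hf : IsGTBasis τ p q f) (E : GTPattern p q → W)
    (r : GTPattern p q) : hf.lift E (f r) = E r := by
  have h := hf.toOrthonormalBasis.toBasis.constr_basis ℂ E r
  rwa [OrthonormalBasis.coe_toBasis, hf.toOrthonormalBasis_apply] at h

theorem IsGTBasis.hom_ext (hf : IsGTBasis τ p q f) {W : Type*} [AddCommGroup W] [Module ℂ W]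
    {A B : V →ₗ[ℂ] W} (h : ∀ r, A (f r) = B (f r)) : A = B :=
  hf.toOrthonormalBasis.toBasis.ext fun r => by
    simpa [hf.toOrthonormalBasis_apply] using h r

theorem IsGTBasis.sum_inner_smul (hf : IsGTBasis τ p q f) (v : V) :
    ∑ r, ⟪f r, v⟫_ℂ • f r = v := by
  have h := hf.toOrthonormalBasis.sum_repr' v
  simpa only [hf.toOrthonormalBasis_apply] using h

theorem IsGTBasis.lift_eq_sum (hf : IsGTBasis τ p q f) (E : GTPattern p q → W) (v : V) :
    hf.lift E v = ∑ r, ⟪f r, v⟫_ℂ • E r := by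
  conv_lhs => rw [← hf.sum_inner_smul v]
  simp [hf.lift_apply]

/-- The convention that vectors with labels out of range are zero is respected by linear maps, so
the lowering formulas transfer verbatim. -/
theorem IsGTBasis.lift_extend (hf : IsGTBasis τ p q f) (E : GTPattern p q → W) (a b c : ℕ) :
    hf.lift E (GTPattern.extend f a b c) = GTPattern.extend E a b c := by
  unfold GTPattern.extend
  split_ifs
  · exact hf.lift_apply E _
  · exact map_zero _

theorem IsGTBasis.lift_T3 (hf : IsGTBasis τ p q f) (hE : IsGTFamily σ p q E) (v : V) :
    hf.lift E (T3 τ v) = T3 σ (hf.lift E v) := by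
  have h : hf.lift E ∘ₗ (T3 τ : V →ₗ[ℂ] V) = (T3 σ : W →ₗ[ℂ] W) ∘ₗ hf.lift E :=
    hf.hom_ext fun r => by simp [hf.family.t3, hE.t3, hf.lift_apply]
  exact congrArg (fun A : V →ₗ[ℂ] W => A v) h

theorem IsGTBasis.lift_U3 (hf : IsGTBasis τ p q f) (hE : IsGTFamily σ p q E) (v : V) :
    hf.lift E (U3 τ v) = U3 σ (hf.lift E v) := by
  have h : hf.lift E ∘ₗ (U3 τ : V →ₗ[ℂ] V) = (U3 σ : W →ₗ[ℂ] W) ∘ₗ hf.lift E :=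
    hf.hom_ext fun r => by simp [hf.family.u3, hE.u3, hf.lift_apply]
  exact congrArg (fun A : V →ₗ[ℂ] W => A v) h

theorem IsGTBasis.lift_Tminus (hf : IsGTBasis τ p q f) (hE : IsGTFamily σ p q E) (v : V) :
    hf.lift E (Tminus τ v) = Tminus σ (hf.lift E v) := by
  have h : hf.lift E ∘ₗ (Tminus τ : V →ₗ[ℂ] V) = (Tminus σ : W →ₗ[ℂ] W) ∘ₗ hf.lift E :=
    hf.hom_ext fun r => by simp [hf.family.tminus, hE.tminus, hf.lift_apply, hf.lift_extend]
  exact congrArg (fun A : V →ₗ[ℂ] W => A v) h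

theorem IsGTBasis.lift_Uminus (hf : IsGTBasis τ p q f) (hE : IsGTFamily σ p q E) (v : V) :
    hf.lift E (Uminus τ v) = Uminus σ (hf.lift E v) := by
  have h : hf.lift E ∘ₗ (Uminus τ : V →ₗ[ℂ] V) = (Uminus σ : W →ₗ[ℂ] W) ∘ₗ hf.lift E :=
    hf.hom_ext fun r => by simp [hf.family.uminus, hE.uminus, hf.lift_apply, hf.lift_extend]
  exact congrArg (fun A : V →ₗ[ℂ] W => A v) h

/-- A linear map that intertwines `T₃`, `U₃`, `T±`, `U±` intertwines the representations. -/
theorem intertwines_of_generators [CompleteSpace V] [CompleteSpace W] (hτ : Continuous τ)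
    (hσ : Continuous σ) (L : V →ₗ[ℂ] W) (hT3 : ∀ v, L (T3 τ v) = T3 σ (L v))
    (hU3 : ∀ v, L (U3 τ v) = U3 σ (L v)) (hTm : ∀ v, L (Tminus τ v) = Tminus σ (L v))
    (hUm : ∀ v, L (Uminus τ v) = Uminus σ (L v)) (hTp : ∀ v, L (Tplus τ v) = Tplus σ (L v))
    (hUp : ∀ v, L (Uplus τ v) = Uplus σ (L v)) (g : SU3) (v : V) : L (τ g v) = σ g (L v) := by
  have key : ∀ {X : Matrix (Fin 3) (Fin 3) ℂ} (_ : X.IsHermitian) (_ : X.trace = 0)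
      (_ : ∀ v, L (Complex.I • hermAct τ X v) = Complex.I • hermAct σ X (L v)) (t : ℝ) (v : V),
      L (τ (expCurve X t) v) = σ (expCurve X t) (L v) := by
    intro X hX htr h t v
    -- `L` carries an orbit in the source to a solution of the linear equation that defines the
    -- orbits in the target.
    have hy : ∀ t, HasDerivAt (fun t => L (τ (expCurve X t) v))
        (Complex.I • hermAct σ X (L (τ (expCurve X t) v))) t := by
      intro t
      have h1 := (LinearMap.toContinuousLinearMap L).restrictScalars ℝ
        |>.hasFDerivAt.comp_hasDerivAt t (hasDerivAt_rep_expCurve_apply hτ hX htr v t)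
      rw [← h]
      exact h1
    have h2 := eq_rep_expCurve_apply hσ hX htr hy t
    simpa [expCurve_zero] using h2
  have h3 : ∀ {A : V →L[ℂ] V} {B : W →L[ℂ] W}, (∀ v, L (A v) = B (L v)) →
      ∀ v, L (Complex.I • A v) = Complex.I • B (L v) := fun h v => by rw [map_smul, h]
  refine equivariant_of_expCurve (a := fun g v => τ g v) (b := fun g v => σ g v) (F := L)
    (by simp) (by simp) (by simp) (by simp)
    (key genT3_isHermitian genT3_trace (h3 ?_)) (key genU3_isHermitian genU3_trace (h3 ?_))
    (key genT2_isHermitian genT2_trace ?_) (key genU2_isHermitian genU2_trace ?_) g v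
  · simpa only [T3_eq] using hT3
  · simpa only [U3_eq] using hU3
  · intro v
    rw [← smul_apply, ← smul_apply, I_smul_hermAct_genT2, I_smul_hermAct_genT2]
    simp [hTm, hTp]
  · intro v
    rw [← smul_apply, ← smul_apply, I_smul_hermAct_genU2, I_smul_hermAct_genU2]
    simp [hUm, hUp]

end GTBasis

/-! ### Coupled bases and Wigner functions -/

section Coupled

variable {V : ℕ → Type*} [∀ n, NormedAddCommGroup (V n)] [∀ n, InnerProductSpace ℂ (V n)]
  [∀ n, FiniteDimensional ℂ (V n)]
  {τ : (n : ℕ) → SU3 →* (V n →L[ℂ] V n)}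
  {f : (n : ℕ) → GTPattern n n → V n}
  {H : Type*} [NormedAddCommGroup H] [InnerProductSpace ℂ H] [CompleteSpace H]
  [FiniteDimensional ℂ H] {p q : ℕ}
  {ρ : SU3 →* (H →L[ℂ] H)} {e : GTPattern p q → H}
  {E : (n : ℕ) → GTPattern n n → (H →L[ℂ] H)}

theorem IsCoupledBasis.traceInner_lift_of_ne (hE : IsCoupledBasis ρ e E)
    (hf : ∀ n, IsGTBasis (τ n) n n (f n)) {m n : ℕ} (hm : m ≤ p + q) (hn : n ≤ p + q) (hmn : m ≠ n)
    (v : V m) (w : V n) : traceInner ((hf m).lift (E m) v) ((hf n).lift (E n) w) = 0 := by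
  have h1 : ∀ r, traceInner ((hf n).lift (E n) w) (E m r) = 0 := by
    intro r
    rw [← traceInner_conj_symm]
    have : traceInnerₗ (E m r) ∘ₗ (hf n).lift (E n) = 0 := (hf n).hom_ext fun s => by
      simp [(hf n).lift_apply, traceInnerₗ_apply, hE.orthogonal_of_ne m hm n hn hmn]
    have h2 := congrArg (fun A : V n →ₗ[ℂ] ℂ => A w) this
    simp only [LinearMap.comp_apply, traceInnerₗ_apply, LinearMap.zero_apply] at h2
    rw [h2, map_zero]
  rw [← traceInner_conj_symm]
  have : traceInnerₗ ((hf n).lift (E n) w) ∘ₗ (hf m).lift (E m) = 0 := (hf m).hom_ext fun s => by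
    simp [(hf m).lift_apply, traceInnerₗ_apply, h1]
  have h2 := congrArg (fun A : V m →ₗ[ℂ] ℂ => A v) this
  simp only [LinearMap.comp_apply, traceInnerₗ_apply, LinearMap.zero_apply] at h2
  rw [h2, map_zero]

/-- Both families are orthonormal, so the lift of a model space into the operators is isometric. -/
theorem IsCoupledBasis.traceInner_lift (hE : IsCoupledBasis ρ e E)
    (hf : ∀ n, IsGTBasis (τ n) n n (f n)) {n : ℕ} (hn : n ≤ p + q)
    (v w : V n) : traceInner ((hf n).lift (E n) v) ((hf n).lift (E n) w) = ⟪v, w⟫_ℂ := by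
  classical
  have h0 : ∀ r s, traceInner (E n r) (E n s) = ⟪f n r, f n s⟫_ℂ := by
    intro r s
    rw [orthonormal_iff_ite.1 (hf n).orthonormal]
    split_ifs with h
    · rw [h, hE.norm_one n hn]
    · rw [hE.orthogonal n hn r s h]
  have h1 : ∀ r w, traceInner (E n r) ((hf n).lift (E n) w) = ⟪f n r, w⟫_ℂ := by
    intro r w
    have : traceInnerₗ (E n r) ∘ₗ (hf n).lift (E n) = (innerSL ℂ (f n r) : V n →ₗ[ℂ] ℂ) :=
      (hf n).hom_ext fun s => by
        simp [(hf n).lift_apply, traceInnerₗ_apply, h0]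
    exact congrArg (fun A : V n →ₗ[ℂ] ℂ => A w) this
  have h2 : traceInnerₗ ((hf n).lift (E n) w) ∘ₗ (hf n).lift (E n) =
      (innerSL ℂ w : V n →ₗ[ℂ] ℂ) := (hf n).hom_ext fun s => by
    simp only [LinearMap.comp_apply, (hf n).lift_apply, traceInnerₗ_apply]
    rw [← traceInner_conj_symm, h1, inner_conj_symm]
    rfl
  have h3 : traceInner ((hf n).lift (E n) w) ((hf n).lift (E n) v) = ⟪w, v⟫_ℂ :=
    congrArg (fun A : V n →ₗ[ℂ] ℂ => A v) h2
  rw [← traceInner_conj_symm, h3, inner_conj_symm]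

/-- An operator on `𝓑(H)` and one on the model spaces that have intertwined adjoints are
intertwined. -/
theorem IsCoupledBasis.lift_comm_of_adjoint (hE : IsCoupledBasis ρ e E)
    (hf : ∀ n, IsGTBasis (τ n) n n (f n)) {D D' : (H →L[ℂ] H) → (H →L[ℂ] H)}
    {d d' : (n : ℕ) → V n → V n} (hD : ∀ A B, traceInner (D A) B = traceInner A (D' B))
    (hd : ∀ n v w, ⟪d n v, w⟫_ℂ = ⟪v, d' n w⟫_ℂ)
    (hL : ∀ n ≤ p + q, ∀ v, (hf n).lift (E n) (d n v) = D ((hf n).lift (E n) v))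
    {n : ℕ} (hn : n ≤ p + q) (v : V n) :
    (hf n).lift (E n) (d' n v) = D' ((hf n).lift (E n) v) := by
  -- It suffices to pair with each `E m r`, moving `D'` to the other side as `D`. For `m = n`,
  -- isometry reduces the claim to adjointness in the model space; for `m ≠ n`, both sides vanish by
  -- orthogonality.
  refine eq_of_traceInner_eq hE.span_eq_top ?_
  rintro A ⟨m, hm, r, rfl⟩
  rw [← hD, ← (hf m).lift_apply (E m) r, ← hL m hm]
  by_cases hmn : m = n
  · subst hmn
    rw [hE.traceInner_lift hf hm, hE.traceInner_lift hf hm, hd]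
  · rw [hE.traceInner_lift_of_ne hf hm hn hmn, hE.traceInner_lift_of_ne hf hm hn hmn]

/-- A Gelfand-Tsetlin family prescribes `T₃`, `U₃`, `T₋`, `U₋` on all its vectors, but `T₊`, `U₊`
only on the highest one. The lift commutes with the raising operators because they are the adjoints
of the lowering ones on both sides. -/
theorem IsCoupledBasis.lift_map (hE : IsCoupledBasis ρ e E) (hρ : IsUnitaryRep ρ)
    (hτ : ∀ n, IsUnitaryRep (τ n)) (hf : ∀ n, IsGTBasis (τ n) n n (f n)) {n : ℕ} (hn : n ≤ p + q)
    (g : SU3) (v : V n) :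
    (hf n).lift (E n) (τ n g v) = conjRep ρ g ((hf n).lift (E n) v) := by
  have : ∀ n, CompleteSpace (V n) := fun n => FiniteDimensional.complete ℂ (V n)
  exact intertwines_of_generators (hτ n).continuous (continuous_conjRep hρ.continuous) _
    ((hf n).lift_T3 (hE.family n hn)) ((hf n).lift_U3 (hE.family n hn))
    ((hf n).lift_Tminus (hE.family n hn)) ((hf n).lift_Uminus (hE.family n hn))
    (hE.lift_comm_of_adjoint hf (d := fun n v => Tminus (τ n) v) (d' := fun n v => Tplus (τ n) v)
      hρ.traceInner_Tminus (fun n => (hτ n).inner_Tminus)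
      (fun n hn => (hf n).lift_Tminus (hE.family n hn)) hn)
    (hE.lift_comm_of_adjoint hf (d := fun n v => Uminus (τ n) v) (d' := fun n v => Uplus (τ n) v)
      hρ.traceInner_Uminus (fun n => (hτ n).inner_Uminus)
      (fun n hn => (hf n).lift_Uminus (hE.family n hn)) hn) g v

/-- The matrix of the conjugation representation in a coupled basis is given by the Wigner
`D`-functions. -/
theorem IsCoupledBasis.conjRep_apply_eq_sum (hE : IsCoupledBasis ρ e E) (hρ : IsUnitaryRep ρ)
    (hτ : ∀ n, IsUnitaryRep (τ n)) (hf : ∀ n, IsGTBasis (τ n) n n (f n)) {n : ℕ} (hn : n ≤ p + q)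
    (g : SU3) (r : GTPattern n n) :
    conjRep ρ g (E n r) = ∑ s, wignerD (τ n) (f n) s r g • E n s := by
  rw [← (hf n).lift_apply (E n) r, ← hE.lift_map hρ hτ hf hn, (hf n).lift_eq_sum]
  rfl

end Coupled

end QuarkSymbol

namespace QuarkSymbol

set_option linter.unusedSectionVars false

/-! ### Rank-one operators and expectation values -/

section KetBra

variable {H : Type*} [NormedAddCommGroup H] [InnerProductSpace ℂ H]

/-- The operator `v ⊗ v*`. -/
noncomputable def ketBra (v : H) : H →L[ℂ] H := tensorOp v (innerSL ℂ v)

theorem ketBra_apply (v w : H) : ketBra v w = ⟪v, w⟫_ℂ • v := rfl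

variable [FiniteDimensional ℂ H]

theorem opTrace_tensorOp (v : H) (φ : H →L[ℂ] ℂ) : opTrace (tensorOp v φ) = φ v := by
  rw [opTrace_eq_sum (stdOrthonormalBasis ℂ H)]
  conv_rhs => rw [← (stdOrthonormalBasis ℂ H).sum_repr' v, map_sum]
  refine Finset.sum_congr rfl fun i _ => ?_
  rw [tensorOp, ContinuousLinearMap.smulRight_apply, inner_smul_right, map_smul, smul_eq_mul,
    mul_comm]

theorem mul_tensorOp (A : H →L[ℂ] H) (v : H) (φ : H →L[ℂ] ℂ) :
    A * tensorOp v φ = tensorOp (A v) φ := by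
  ext w
  simp [tensorOp]

theorem opTrace_mul_ketBra (A : H →L[ℂ] H) (v : H) : opTrace (A * ketBra v) = ⟪v, A v⟫_ℂ := by
  rw [ketBra, mul_tensorOp, opTrace_tensorOp]
  rfl

variable [CompleteSpace H] {ρ : SU3 →* (H →L[ℂ] H)}

theorem IsUnitaryRep.conjRep_ketBra (hρ : IsUnitaryRep ρ) (g : SU3) (v : H) :
    conjRep ρ g (ketBra v) = ketBra (ρ g v) := by
  ext w
  simp [conjRep_apply, ketBra_apply, hρ.inner_map_left]

/-- The expectation values in a vector of weight zero for `U₃`, `U±` only see the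
central vector of a Gelfand-Tsetlin family of class `Q(n, n)`. -/
theorem IsGTFamily.inner_eq_zero (hρ : IsUnitaryRep ρ) {n : ℕ} {E : GTPattern n n → (H →L[ℂ] H)}
    (hE : IsGTFamily (conjRep ρ) n n E) {v : H} (hUp : Uplus ρ v = 0) (hUm : Uminus ρ v = 0)
    (hU3 : U3 ρ v = 0) {r : GTPattern n n} (hr : r ≠ GTPattern.center n) :
    ⟪v, E r v⟫_ℂ = 0 := by
  obtain ⟨a, b, c, h1, h2, h3, h4, h5⟩ := r
  rcases Nat.lt_or_ge b c with hbc | hbc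
  · let s : GTPattern n n := ⟨a, b, c - 1, h1, h2, h3, by omega, by omega⟩
    have h := hE.uminus s
    have hs : GTPattern.extend E s.rp s.rm (s.nu3 + 1) = E ⟨a, b, c, h1, h2, h3, h4, h5⟩ := by
      have hc : c - 1 + 1 = c := by omega
      simp only [s, hc]
      rw [GTPattern.extend, dif_pos ⟨⟨h1, h2⟩, h3, h4, h5⟩]
    rw [hs, Uminus_conjRep hρ.continuous] at h
    have h' := congrArg (fun A : H →L[ℂ] H => ⟪v, A v⟫_ℂ) h
    simp only [sub_apply, mul_apply_eq_comp, hUm, map_zero, sub_zero, smul_apply,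
      inner_smul_right, ← hρ.inner_Uplus, hUp, inner_zero_left] at h'
    refine (mul_eq_zero.1 h'.symm).resolve_left ?_
    have hpos : 0 < s.coeffU := by
      rw [GTPattern.coeffU]
      apply Real.sqrt_pos.2
      have e1 : s.J + s.u = (a : ℝ) - c + 1 := by
        simp only [GTPattern.J, GTPattern.u, GTPattern.ν₂, GTPattern.ν₃, s]
        have : 1 ≤ c := by omega
        push_cast [Nat.cast_sub this]
        ring
      have e2 : s.J - s.u + 1 = (c : ℝ) - b := by
        simp only [GTPattern.J, GTPattern.u, GTPattern.ν₂, GTPattern.ν₃, s]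
        have : 1 ≤ c := by omega
        push_cast [Nat.cast_sub this]
        ring
      rw [e1, e2]
      have h5' : (c : ℝ) ≤ a := by exact_mod_cast h5
      have hbc' : (b : ℝ) < c := by exact_mod_cast hbc
      exact mul_pos (by linarith) (by linarith)
    exact_mod_cast hpos.ne'
  -- The top of a `U`-multiplet has `u = J`. The expectation value of `[U₃, E r] = u E r` vanishes,
  -- which leaves only `J = 0`, that is `r₊ = r₋`. Both then equal `n`, since `r₋ ≤ n ≤ r₊`, and the
  -- pattern is the central one.
  · have hcb : c = b := le_antisymm hbc h4
    subst hcb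
    have h := hE.u3 ⟨a, c, c, h1, h2, h3, h4, h5⟩
    rw [U3_conjRep hρ.continuous] at h
    have h' := congrArg (fun A : H →L[ℂ] H => ⟪v, A v⟫_ℂ) h
    simp only [sub_apply, mul_apply_eq_comp, hU3, map_zero, sub_zero, smul_apply,
      inner_smul_right] at h'
    rw [U3_eq, ← hρ.inner_hermAct genU3_isHermitian genU3_trace, ← U3_eq, hU3,
      inner_zero_left] at h'
    refine (mul_eq_zero.1 h'.symm).resolve_left ?_
    intro hu
    have hu' : (GTPattern.u (⟨a, c, c, h1, h2, h3, h4, h5⟩ : GTPattern n n)) = 0 := by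
      exact_mod_cast hu
    simp only [GTPattern.u, GTPattern.ν₂, GTPattern.ν₃] at hu'
    push_cast at hu'
    have hac : (a : ℝ) = c := by linarith
    have hac' : a = c := by exact_mod_cast hac
    apply hr
    ext <;> simp only [GTPattern.center] <;> omega

end KetBra

/-! ### Positivity -/

section Positive

variable {H : Type*} [NormedAddCommGroup H] [InnerProductSpace ℂ H] [CompleteSpace H]
  [FiniteDimensional ℂ H] {A : H →L[ℂ] H}

theorem exists_eigenvalue_expansion (hA : ContinuousLinearMap.adjoint A = A) :
    ∃ (b : OrthonormalBasis (Fin (Module.finrank ℂ H)) ℂ H) (a : Fin (Module.finrank ℂ H) → ℝ),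
      (∀ i, Module.End.HasEigenvalue (A : H →ₗ[ℂ] H) (a i : ℂ)) ∧
        ∀ v, ⟪v, A v⟫_ℂ = ((∑ i, a i * ‖⟪b i, v⟫_ℂ‖ ^ 2 : ℝ) : ℂ) := by
  have hs : (A : H →ₗ[ℂ] H).IsSymmetric := ContinuousLinearMap.isSelfAdjoint_iff_isSymmetric.1 hA
  refine ⟨hs.eigenvectorBasis rfl, hs.eigenvalues rfl, hs.hasEigenvalue_eigenvalues rfl, ?_⟩
  intro v
  rw [← (hs.eigenvectorBasis rfl).sum_inner_mul_inner v (A v)]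
  push_cast
  refine Finset.sum_congr rfl fun i _ => ?_
  have h1 : ⟪hs.eigenvectorBasis rfl i, A v⟫_ℂ =
      (hs.eigenvalues rfl i : ℂ) * ⟪hs.eigenvectorBasis rfl i, v⟫_ℂ := by
    have h2 := hs (hs.eigenvectorBasis rfl i) v
    rw [hs.apply_eigenvectorBasis rfl i, inner_smul_left] at h2
    simpa using h2.symm
  rw [h1, ← inner_conj_symm v, mul_left_comm, Complex.conj_mul']

theorem IsPositiveOp.inner_nonneg (hA : IsPositiveOp A) (v : H) :
    ∃ y : ℝ, 0 ≤ y ∧ ⟪v, A v⟫_ℂ = y := by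
  obtain ⟨b, a, ha, h⟩ := exists_eigenvalue_expansion hA.1
  exact ⟨_, Finset.sum_nonneg fun i _ => mul_nonneg (hA.2 _ (ha i)) (sq_nonneg _), h v⟩

theorem IsPositiveDefiniteOp.inner_pos (hA : IsPositiveDefiniteOp A) {v : H} (hv : v ≠ 0) :
    ∃ y : ℝ, 0 < y ∧ ⟪v, A v⟫_ℂ = y := by
  obtain ⟨b, a, ha, h⟩ := exists_eigenvalue_expansion hA.1
  refine ⟨_, ?_, h v⟩
  have hex : ∃ i, ⟪b i, v⟫_ℂ ≠ 0 := by
    by_contra! h0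
    exact hv (by rw [← b.sum_repr' v]; simp [h0])
  obtain ⟨i, hi⟩ := hex
  exact Finset.sum_pos' (fun j _ => mul_nonneg (hA.2 _ (ha j)).le (sq_nonneg _))
    ⟨i, Finset.mem_univ i, mul_pos (hA.2 _ (ha i)) (pow_pos (norm_pos_iff.2 hi) 2)⟩

end Positive

/-! ### Averaging over `SU(3)` -/

section Average

instance : MeasureTheory.Measure.IsMulLeftInvariant haarSU3 := by
  unfold haarSU3; infer_instance

instance : MeasureTheory.IsProbabilityMeasure haarSU3 where
  measure_univ := by
    have h := MeasureTheory.Measure.haarMeasure_self (K₀ := (⊤ : TopologicalSpace.PositiveCompacts SU3))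
    simpa [haarSU3] using h

variable {H : Type*} [NormedAddCommGroup H] [InnerProductSpace ℂ H] [CompleteSpace H]
  [FiniteDimensional ℂ H] {ρ : SU3 →* (H →L[ℂ] H)}

/-- Schur's lemma: an eigenspace of `M` is invariant and nonzero, hence everything. -/
theorem IsIrreducibleRep.eq_smul_one (hirr : IsIrreducibleRep ρ) {M : H →L[ℂ] H}
    (hM : ∀ g, ρ g * M = M * ρ g) : ∃ c : ℂ, M = c • (1 : H →L[ℂ] H) := by
  have := hirr.1
  obtain ⟨c, hc⟩ := Module.End.exists_eigenvalue (M : H →ₗ[ℂ] H)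
  refine ⟨c, ?_⟩
  have h := (hirr.2 (Module.End.eigenspace (M : H →ₗ[ℂ] H) c) ?_).resolve_left hc
  · ext v
    have hv : v ∈ Module.End.eigenspace (M : H →ₗ[ℂ] H) c := h ▸ Submodule.mem_top
    simpa using Module.End.mem_eigenspace_iff.1 hv
  · intro g v hv
    rw [Module.End.mem_eigenspace_iff] at hv ⊢
    have h1 := congrArg (fun A : H →L[ℂ] H => A v) (hM g)
    simp only [mul_apply_eq_comp] at h1
    simp only [ContinuousLinearMap.coe_coe] at hv ⊢
    rw [← h1, hv, map_smul]

/-- The Haar average of `K^g` is invariant under conjugation, hence a scalar by Schur's lemma. The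
scalar is found by comparing traces. -/
theorem integral_opTrace_conjRep (hρ : IsUnitaryRep ρ) (hirr : IsIrreducibleRep ρ)
    (A K : H →L[ℂ] H) : ∫ g, opTrace (A * conjRep ρ g K) ∂haarSU3 =
      opTrace K / Module.finrank ℂ H * opTrace A := by
  have hcont : Continuous fun g => conjRep ρ g K :=
    (continuous_conjRep hρ.continuous).clm_apply continuous_const
  have hint : MeasureTheory.Integrable (fun g => conjRep ρ g K) haarSU3 :=
    hcont.integrable_of_hasCompactSupport (HasCompactSupport.of_compactSpace _)
  set M := ∫ g, conjRep ρ g K ∂haarSU3 with hMdef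
  have htr : ∀ B : H →L[ℂ] H, ∫ g, opTrace (B * conjRep ρ g K) ∂haarSU3 = opTrace (B * M) := by
    intro B
    let L : (H →L[ℂ] H) →ₗ[ℂ] ℂ :=
      { toFun := fun C => opTrace (B * C)
        map_add' := fun C D => by rw [mul_add, opTrace_add]
        map_smul' := fun c C => by rw [mul_smul_comm, opTrace_smul]; rfl }
    exact (LinearMap.toContinuousLinearMap L).integral_comp_comm hint
  have hinv : ∀ h, conjRep ρ h M = M := by
    intro h
    rw [hMdef, ← ContinuousLinearMap.integral_comp_comm _ hint]
    have : ∀ g, conjRep ρ h (conjRep ρ g K) = conjRep ρ (h * g) K := fun g => by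
      rw [map_mul]; rfl
    simp_rw [this]
    exact MeasureTheory.integral_mul_left_eq_self (fun g => conjRep ρ g K) h
  obtain ⟨c, hc⟩ := hirr.eq_smul_one (M := M) (by
    intro g
    conv_rhs => rw [← hinv g]
    rw [conjRep_apply, mul_assoc (ρ g * M), ← map_mul, inv_mul_cancel, map_one, mul_one])
  have h1 : opTrace (1 : H →L[ℂ] H) = Module.finrank ℂ H := LinearMap.trace_one ℂ H
  have h2 : opTrace M = opTrace K := by
    have h3 := htr 1
    simp only [one_mul] at h3
    rw [← h3]
    have h4 : ∀ g, opTrace (conjRep ρ g K) = opTrace K := by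
      intro g
      rw [conjRep_apply, opTrace_mul_comm, ← mul_assoc, ← map_mul, inv_mul_cancel, map_one, one_mul]
    simp [h4]
  have := hirr.1
  have hd : (Module.finrank ℂ H : ℂ) ≠ 0 := by
    exact_mod_cast (Module.finrank_pos (R := ℂ) (M := H)).ne'
  rw [htr, ← h2, hc, mul_smul_comm, mul_one, opTrace_smul, opTrace_smul, h1,
    mul_div_cancel_right₀ _ hd]

end Average

end QuarkSymbol

namespace QuarkSymbol

set_option linter.unusedSectionVars false

/-! ### Coherent maps and their symbol correspondences -/

variable {H : Type*} [NormedAddCommGroup H] [InnerProductSpace ℂ H]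

/-- Equivariant maps `ℂ³ → H`, homogeneous of degree `p` up to phases, whose value at the base vector
is a unit vector of weight zero for `U₃`, `U±`, and whose values separate operators. -/
structure IsCoherentMap (ρ : SU3 →* (H →L[ℂ] H)) (p : ℕ) (Ψ : C3 → H) : Prop where
  map_act : ∀ g z, Ψ (actC3 g z) = ρ g (Ψ z)
  map_smul : ∀ (c : ℂ) z, ∃ d : ℂ, ‖d‖ = ‖c‖ ^ p ∧ Ψ (c • z) = d • Ψ z
  contDiff : ContDiff ℝ ∞ Ψ
  separates : ∀ A : H →L[ℂ] H, (∀ z, ⟪Ψ z, A (Ψ z)⟫_ℂ = 0) → A = 0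
  norm_base : ‖Ψ baseVec‖ = 1
  uplus : Uplus ρ (Ψ baseVec) = 0
  uminus : Uminus ρ (Ψ baseVec) = 0
  u3 : U3 ρ (Ψ baseVec) = 0

/-- The function `[z] ↦ ⟨Ψ z, A Ψ z⟩ / ‖z‖^{2p}` on the projective plane. -/
noncomputable def coherentSymbol (p : ℕ) (Ψ : C3 → H) : (H →L[ℂ] H) →ₗ[ℂ] (CP2 → ℂ) where
  toFun A x := ⟪Ψ x.rep, A (Ψ x.rep)⟫_ℂ / ((‖x.rep‖ ^ 2) ^ p : ℝ)
  map_add' A B := by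
    ext x
    simp [add_div]
  map_smul' c A := by
    ext x
    simp [mul_div_assoc]

namespace IsCoherentMap

variable {ρ : SU3 →* (H →L[ℂ] H)} {p : ℕ} {Ψ : C3 → H}

/-- Rescaling `z` by `a` multiplies numerator and denominator by `|a|^{2p}`, so the chosen
representative of the line does not matter. Only the modulus of the factor `d` enters, which leaves
room for the antilinear `σ`. -/
theorem coherentSymbol_mk (hΨ : IsCoherentMap ρ p Ψ) (A : H →L[ℂ] H) (z : C3) (hz : z ≠ 0) :
    coherentSymbol p Ψ A (Projectivization.mk ℂ z hz) =
      ⟪Ψ z, A (Ψ z)⟫_ℂ / ((‖z‖ ^ 2) ^ p : ℝ) := by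
  obtain ⟨a, ha⟩ := Projectivization.exists_smul_eq_mk_rep ℂ z hz
  change ⟪Ψ (Projectivization.mk ℂ z hz).rep, A (Ψ (Projectivization.mk ℂ z hz).rep)⟫_ℂ /
    ((‖(Projectivization.mk ℂ z hz).rep‖ ^ 2) ^ p : ℝ) = _
  obtain ⟨d, hd, h⟩ := hΨ.map_smul (a : ℂ) z
  have ha' : (a : ℂ) • z = (Projectivization.mk ℂ z hz).rep := ha
  rw [← ha', h, A.map_smul, inner_smul_left, inner_smul_right, norm_smul, ← mul_assoc,
    Complex.conj_mul', hd, mul_pow, mul_pow]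
  have hne : ((((‖(a : ℂ)‖ ^ 2) ^ p : ℝ)) : ℂ) ≠ 0 := by
    have : ‖(a : ℂ)‖ ≠ 0 := norm_ne_zero_iff.2 a.ne_zero
    exact_mod_cast pow_ne_zero _ (pow_ne_zero _ this)
  rw [Complex.ofReal_mul, ← mul_div_mul_left _ (((‖z‖ ^ 2) ^ p : ℝ) : ℂ) hne]
  congr 1
  push_cast
  ring

theorem coherentSymbol_act (hΨ : IsCoherentMap ρ p Ψ) (A : H →L[ℂ] H) (g : SU3) :
    coherentSymbol p Ψ A (actCP2 g basePoint) =
      ⟪ρ g (Ψ baseVec), A (ρ g (Ψ baseVec))⟫_ℂ := by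
  rw [basePoint_eq, actCP2_mk, hΨ.coherentSymbol_mk, hΨ.map_act, norm_actC3]
  simp [baseVec]

theorem coherentSymbol_proj (hΨ : IsCoherentMap ρ p Ψ) (A : H →L[ℂ] H)
    (n : Metric.sphere (0 : C3) 1) :
    coherentSymbol p Ψ A (proj n) = ⟪Ψ n, A (Ψ n)⟫_ℂ := by
  rw [proj, hΨ.coherentSymbol_mk, norm_eq_of_mem_sphere]
  simp

theorem ne_zero (hΨ : IsCoherentMap ρ p Ψ) : Ψ baseVec ≠ 0 := by
  intro h
  have := hΨ.norm_base
  simp [h] at this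

/-- In an affine chart the representative can be taken with one coordinate equal to `1`. It then
depends smoothly on the chart coordinates and never vanishes. -/
theorem isSmooth_coherentSymbol (hΨ : IsCoherentMap ρ p Ψ) (A : H →L[ℂ] H) :
    IsSmooth (coherentSymbol p Ψ A) := by
  intro i
  have hv : ContDiff ℝ ∞ fun w : Fin 2 → ℂ =>
      (WithLp.toLp 2 (i.insertNth (α := fun _ => ℂ) 1 w) : C3) := by
    refine (PiLp.contDiff_toLp (𝕜 := ℝ)).comp (contDiff_pi.2 fun j => ?_)
    refine Fin.succAboveCases i ?_ (fun k => ?_) j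
    · simpa using contDiff_const
    · simpa using contDiff_apply ℝ ℂ k
  have hne : ∀ w : Fin 2 → ℂ, (WithLp.toLp 2 (i.insertNth (α := fun _ => ℂ) 1 w) : C3) ≠ 0 := by
    intro w h
    have h2 := congrArg (fun v : C3 => v i) h
    simp at h2
  simp only [affineChart, hΨ.coherentSymbol_mk]
  have h1 := hΨ.contDiff.comp hv
  have h2 := (A.restrictScalars ℝ).contDiff.comp h1
  simp only [div_eq_mul_inv]
  refine (h1.inner ℂ h2).mul
    (ContDiff.inv (Complex.ofRealCLM.contDiff.comp ((hv.norm_sq ℂ).pow p)) ?_)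
  intro w
  have : ‖(WithLp.toLp 2 (i.insertNth (α := fun _ => ℂ) 1 w) : C3)‖ ≠ 0 :=
    norm_ne_zero_iff.2 (hne w)
  have h3 := pow_ne_zero p (pow_ne_zero 2 this)
  simpa using h3

variable [CompleteSpace H] [FiniteDimensional ℂ H]

theorem isOperatorKernel (hΨ : IsCoherentMap ρ p Ψ) (hρ : IsUnitaryRep ρ) :
    IsOperatorKernel ρ (coherentSymbol p Ψ) (ketBra (Ψ baseVec)) := by
  intro A g
  rw [hΨ.coherentSymbol_act, hρ.conjRep_ketBra, opTrace_mul_ketBra]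

theorem isMappingPositive (hΨ : IsCoherentMap ρ p Ψ) (hρ : IsUnitaryRep ρ) :
    IsMappingPositive (coherentSymbol p Ψ) := by
  constructor
  · intro A hA x
    obtain ⟨g, rfl⟩ := exists_actCP2_basePoint x
    rw [hΨ.coherentSymbol_act]
    exact hA.inner_nonneg _
  · intro A hA x
    obtain ⟨g, rfl⟩ := exists_actCP2_basePoint x
    rw [hΨ.coherentSymbol_act]
    refine hA.inner_pos (norm_ne_zero_iff.1 ?_)
    rw [hρ.norm_map]
    exact norm_ne_zero_iff.2 hΨ.ne_zero

theorem isSymbolCorrespondence (hΨ : IsCoherentMap ρ p Ψ) (hp : 1 ≤ p) (hρ : IsUnitaryRep ρ)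
    (hirr : IsIrreducibleRep ρ) (hdim : (Module.finrank ℂ H : ℂ) = ((p : ℂ) + 1) * (p + 2) / 2) :
    IsSymbolCorrespondence ρ p (coherentSymbol p Ψ) where
  smooth := hΨ.isSmooth_coherentSymbol
  injective := by
    rw [injective_iff_map_eq_zero]
    intro A hA
    refine hΨ.separates A fun z => ?_
    by_cases hz : z = 0
    -- The origin is not a point of the projective plane. There `Ψ` vanishes by homogeneity, for
    -- which `p ≥ 1` is needed.
    · obtain ⟨d, hd, h⟩ := hΨ.map_smul 0 z
      rw [norm_zero, zero_pow (by omega), norm_eq_zero] at hd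
      rw [zero_smul, hd, zero_smul] at h
      rw [hz, h, inner_zero_left]
    · have h := congrFun hA (Projectivization.mk ℂ z hz)
      rw [hΨ.coherentSymbol_mk, Pi.zero_apply, div_eq_zero_iff] at h
      refine h.resolve_right ?_
      have := pow_ne_zero p (pow_ne_zero 2 (norm_ne_zero_iff.2 hz))
      exact_mod_cast this
  equivariant := by
    intro g A x
    obtain ⟨h, rfl⟩ := exists_actCP2_basePoint x
    rw [← actCP2_mul, hΨ.coherentSymbol_act, hΨ.coherentSymbol_act, conjRep_apply, map_mul]
    simp only [mul_apply_eq_comp]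
    rw [← inv_inv g, ← hρ.inner_map_left, inv_inv]
  real := by
    intro A x
    obtain ⟨g, rfl⟩ := exists_actCP2_basePoint x
    rw [hΨ.coherentSymbol_act, hΨ.coherentSymbol_act, ContinuousLinearMap.adjoint_inner_right,
      inner_conj_symm]
  normalized := by
    intro A
    have h1 : opTrace (ketBra (Ψ baseVec)) = 1 := by
      rw [ketBra, opTrace_tensorOp, innerSL_apply_apply, inner_self_eq_norm_sq_to_K, hΨ.norm_base]
      simp
    simp only [cp2Integral]
    rw [funext fun g => hΨ.isOperatorKernel hρ A g, integral_opTrace_conjRep hρ hirr, h1, hdim]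
    congr 1
    field_simp

/-! ### Characteristic numbers of a coherent symbol -/

section Characteristic

variable {V : ℕ → Type*} [∀ n, NormedAddCommGroup (V n)] [∀ n, InnerProductSpace ℂ (V n)]
  [∀ n, FiniteDimensional ℂ (V n)] {τ : (n : ℕ) → SU3 →* (V n →L[ℂ] V n)}
  {f : (n : ℕ) → GTPattern n n → V n} {a b : ℕ} {e : GTPattern a b → H}
  {E : (n : ℕ) → GTPattern n n → (H →L[ℂ] H)}

/-- The symbol at `g x₀` is the expectation value at the base of `E n r` conjugated by `g⁻¹`. Of its
expansion in the `E n s` only the central term survives, and unitarity turns its coefficient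
`D(g⁻¹)` into the conjugate of the transposed entry of `D(g)`. -/
theorem coherentSymbol_coupled (hΨ : IsCoherentMap ρ (a + b) Ψ) (hρ : IsUnitaryRep ρ)
    (hE : IsCoupledBasis ρ e E) (hτ : ∀ n, IsUnitaryRep (τ n))
    (hf : ∀ n, IsGTBasis (τ n) n n (f n)) {n : ℕ} (hn : n ≤ a + b) (r : GTPattern n n) (g : SU3) :
    coherentSymbol (a + b) Ψ (E n r) (actCP2 g basePoint) =
      ⟪Ψ baseVec, E n (GTPattern.center n) (Ψ baseVec)⟫_ℂ *
        conj (wignerD (τ n) (f n) r (GTPattern.center n) g) := by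
  have h1 : coherentSymbol (a + b) Ψ (E n r) (actCP2 g basePoint) =
      ⟪Ψ baseVec, conjRep ρ g⁻¹ (E n r) (Ψ baseVec)⟫_ℂ := by
    rw [hΨ.coherentSymbol_act, conjRep_apply, inv_inv, hρ.inner_map_left]
    rfl
  rw [h1, hE.conjRep_apply_eq_sum hρ hτ hf hn, sum_apply, inner_sum,
    Finset.sum_eq_single (GTPattern.center n)]
  · rw [smul_apply, inner_smul_right, mul_comm]
    congr 1
    rw [wignerD, wignerD, inner_conj_symm, (hτ n).inner_map_left]
  · intro s _ hs
    rw [smul_apply, inner_smul_right,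
      (hE.family n hn).inner_eq_zero hρ hΨ.uplus hΨ.uminus hΨ.u3 hs, mul_zero]
  · simp

theorem isCharacteristicNumbers (hΨ : IsCoherentMap ρ (a + b) Ψ) (hp : 1 ≤ a + b)
    (hρ : IsUnitaryRep ρ) (hirr : IsIrreducibleRep ρ)
    (hdim : (Module.finrank ℂ H : ℂ) = (((a + b : ℕ) : ℂ) + 1) * (((a + b : ℕ) : ℂ) + 2) / 2)
    (hE : IsCoupledBasis ρ e E) (hτ : ∀ n, IsUnitaryRep (τ n))
    (hf : ∀ n, IsGTBasis (τ n) n n (f n)) {c : ℕ → ℝ}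
    (hc : ∀ n ≤ a + b, (c n : ℂ) =
      (√((((a + b : ℕ) : ℝ) + 1) * (((a + b : ℕ) : ℝ) + 2) / (2 * ((n : ℝ) + 1) ^ 3)) : ℝ) *
        ⟪Ψ baseVec, E n (GTPattern.center n) (Ψ baseVec)⟫_ℂ) :
    IsCharacteristicNumbers (a + b) E (fun n => cp2Harmonic (τ n) (f n))
      (coherentSymbol (a + b) Ψ) (ketBra (Ψ baseVec)) c := by
  set P := a + b with hP
  set D : ℝ := ((P : ℝ) + 1) * ((P : ℝ) + 2) with hD
  have hDpos : 0 < D := by positivity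
  have hdim' : (Module.finrank ℂ H : ℝ) = D / 2 := by
    apply Complex.ofReal_injective
    rw [hD]
    push_cast
    exact hdim
  have hinner : ⟪Ψ baseVec, Ψ baseVec⟫_ℂ = 1 := by
    rw [inner_self_eq_norm_sq_to_K, hΨ.norm_base]
    simp
  have hsq : √(D / 2) ≠ 0 := by positivity
  have hc0 : c 0 = (-1) ^ P := by
    have h := hc 0 (Nat.zero_le _)
    rw [hE.trivial, smul_apply, inner_smul_right, one_apply_eq_self, hinner, hdim', mul_one] at h
    have h2 : c 0 = √(D / 2) * ((-1) ^ P / √(D / 2)) := by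
      have : D / (2 * (((0 : ℕ) : ℝ) + 1) ^ 3) = D / 2 := by norm_num
      rw [this] at h
      exact_mod_cast h
    rw [h2, mul_div_cancel₀ _ hsq]
  -- With `D = (p+1)(p+2)`, the expectation value of the central vector is `c n` times
  -- `√(2(n+1)³/D)`. The factor `√(D/2)` in the definition of the characteristic numbers turns this
  -- root into the normalization `(n+1)^{3/2}` of the harmonics.
  have hmul : ∀ n : ℕ, √(D / 2) * √(2 * ((n : ℝ) + 1) ^ 3 / D) =
      ((n + 1 : ℝ) ^ (3 / 2 : ℝ)) := by
    intro n
    rw [← Real.sqrt_mul (by positivity)]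
    have : D / 2 * (2 * ((n : ℝ) + 1) ^ 3 / D) = ((n : ℝ) + 1) ^ 3 := by field_simp
    rw [this, Real.sqrt_eq_rpow, ← Real.rpow_natCast, ← Real.rpow_mul (by positivity)]
    norm_num
  have hone : ∀ n : ℕ, √(D / (2 * ((n : ℝ) + 1) ^ 3)) * √(2 * ((n : ℝ) + 1) ^ 3 / D) = 1 := by
    intro n
    rw [← Real.sqrt_mul (by positivity)]
    have : D / (2 * ((n : ℝ) + 1) ^ 3) * (2 * ((n : ℝ) + 1) ^ 3 / D) = 1 := by field_simp
    rw [this, Real.sqrt_one]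
  have ha : ∀ n ≤ P, ((c n * √(2 * ((n : ℝ) + 1) ^ 3 / D) : ℝ) : ℂ) =
      ⟪Ψ baseVec, E n (GTPattern.center n) (Ψ baseVec)⟫_ℂ := by
    intro n hn
    rw [Complex.ofReal_mul, hc n hn, mul_right_comm, ← Complex.ofReal_mul, hone, Complex.ofReal_one,
      one_mul]
  have hmap : ∀ n ≤ P, ∀ r, coherentSymbol P Ψ ((√(D / 2) : ℂ) • E n r) =
      (c n : ℂ) • cp2Harmonic (τ n) (f n) r := by
    intro n hn r
    ext x
    -- The harmonic is evaluated at a chosen `g` with `g x₀ = x`; evaluating the symbol at the same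
    -- `g` makes independence of the choice unnecessary.
    have hg := Classical.epsilon_spec (exists_actCP2_basePoint x)
    rw [_root_.map_smul, Pi.smul_apply, Pi.smul_apply, cp2Harmonic, smul_eq_mul, smul_eq_mul]
    conv_lhs => rw [← hg]
    rw [hΨ.coherentSymbol_coupled hρ hE hτ hf hn, ← ha n hn, ← hmul n]
    push_cast
    ring
  refine ⟨hc0, ?_, hmap, ?_⟩
  -- If `c n = 0`, the correspondence kills a nonzero multiple of a unit vector, against
  -- injectivity.
  · intro n hn h0
    have h := hmap n hn (GTPattern.center n)
    rw [h0, Complex.ofReal_zero, zero_smul] at h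
    have hinj := (hΨ.isSymbolCorrespondence hp hρ hirr hdim).injective
    have h2 := (smul_eq_zero.1 ((injective_iff_map_eq_zero _).1 hinj _ h)).resolve_left
      (by exact_mod_cast hsq)
    have h3 := hE.norm_one n hn (GTPattern.center n)
    rw [h2, ← traceInnerₗ_apply, map_zero] at h3
    exact zero_ne_one h3
  -- The multiple of the identity in the kernel formula is the `n = 0` term: the two signs `(-1)^P`
  -- cancel and the two roots give `2 / D`. The whole sum is then an expansion in the coupled basis,
  -- checked coefficient by coefficient.
  · have hsum : (2 / (((P : ℂ) + 1) * (P + 2))) • (1 : H →L[ℂ] H) +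
        ∑ n ∈ Finset.Icc 1 P, ((c n * √(2 * ((n : ℝ) + 1) ^ 3 / D) : ℝ) : ℂ) •
          E n (GTPattern.center n) =
        ∑ n ∈ Finset.range (P + 1), ((c n * √(2 * ((n : ℝ) + 1) ^ 3 / D) : ℝ) : ℂ) •
          E n (GTPattern.center n) := by
      rw [Finset.range_eq_Ico, Finset.sum_eq_sum_Ico_succ_bot (by omega)]
      congr 1
      rw [hE.trivial, smul_smul, hdim', hc0]
      congr 1
      have h1 : √(2 * (((0 : ℕ) : ℝ) + 1) ^ 3 / D) = 1 / √(D / 2) := by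
        rw [one_div, ← Real.sqrt_inv]
        congr 1
        field_simp
        norm_num
      have h2 : (2 / (((P : ℂ) + 1) * (P + 2))) = ((2 / D : ℝ) : ℂ) := by
        rw [hD]; push_cast; rfl
      rw [h1, h2]
      have h3 : (-1 : ℝ) ^ P * (1 / √(D / 2)) * ((-1) ^ P / √(D / 2)) = 2 / D := by
        have h4 : √(D / 2) * √(D / 2) = D / 2 := Real.mul_self_sqrt (by positivity)
        have h5 : ((-1 : ℝ) ^ P) * (-1) ^ P = 1 := by rw [← mul_pow]; norm_num
        rw [mul_one_div, div_mul_div_comm, h4, h5]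
        field_simp
      rw [← h3]
      push_cast
      ring
    rw [hsum]
    refine eq_of_traceInner_eq hE.span_eq_top ?_
    rintro A ⟨m, hm, r, rfl⟩
    have hL : traceInner (E m r) (ketBra (Ψ baseVec)) =
        conj ⟪Ψ baseVec, E m r (Ψ baseVec)⟫_ℂ := by
      rw [traceInner, opTrace_mul_ketBra, ContinuousLinearMap.adjoint_inner_right, inner_conj_symm]
    rw [hL, ← traceInnerₗ_apply, map_sum]
    simp only [_root_.map_smul, traceInnerₗ_apply, smul_eq_mul]
    rw [Finset.sum_eq_single m]
    · by_cases hr : r = GTPattern.center m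
      · rw [hr, hE.norm_one m hm, mul_one, ← ha m hm, Complex.conj_ofReal]
      · rw [(hE.family m hm).inner_eq_zero hρ hΨ.uplus hΨ.uminus hΨ.u3 hr,
          hE.orthogonal m hm _ _ hr, map_zero, mul_zero]
    · intro n hn hnm
      rw [hE.orthogonal_of_ne m hm n (by simpa [Nat.lt_succ_iff] using hn) hnm.symm, mul_zero]
    · intro h
      exact absurd (Finset.mem_range.2 (Nat.lt_succ_iff.2 hm)) h

end Characteristic

end IsCoherentMap

end QuarkSymbol

namespace QuarkSymbol

set_option linter.unusedSectionVars false

/-! ### Symmetric powers -/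

/-- Stars and bars: the number of triples is the binomial coefficient of `p + 2` over `2`. -/
theorem two_mul_card_antidiagonalTuple_three (p : ℕ) :
    (Finset.Nat.antidiagonalTuple 3 p).card * 2 = (p + 1) * (p + 2) := by
  rw [← Finset.piAntidiag_univ_fin_eq_antidiagonalTuple, ← Finset.map_sym_eq_piAntidiag,
    Finset.card_map, Finset.sym_univ, Finset.card_univ, Sym.card_sym_eq_choose, Fintype.card_fin]
  have h1 : (3 + p - 1).choose p = (p + 2).choose 2 := by
    rw [show 3 + p - 1 = p + 2 by omega, Nat.choose_symm_add]
  rw [h1, Nat.choose_two_right, Nat.div_mul_cancel]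
  · rw [mul_comm]; rfl
  · simpa using (Nat.even_mul_pred_self (p + 2)).two_dvd

theorem sum_of_mem_antidiagonalTuple_three {p : ℕ} {m : Fin 3 → ℕ}
    (hm : m ∈ Finset.Nat.antidiagonalTuple 3 p) : m 0 + m 1 + m 2 = p := by
  rw [← Finset.Nat.mem_antidiagonalTuple.1 hm, Fin.sum_univ_three]

/-- The trinomial normalization `√((j + k + l)! / (j! k! l!))`. -/
noncomputable def symCoeff (j k l : ℕ) : ℝ := √(Nat.multinomial Finset.univ ![j, k, l] : ℝ)

theorem factorial_mul_multinomial (j k l : ℕ) :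
    j.factorial * k.factorial * l.factorial * Nat.multinomial Finset.univ ![j, k, l] =
      (j + k + l).factorial := by
  have h := Nat.multinomial_spec Finset.univ ![j, k, l]
  simpa [Fin.prod_univ_three, Fin.sum_univ_three] using h

/-- Both sides equal `(j + k + l + 1)! / (j! k! l!)`. -/
theorem succ_mul_multinomial_left (j k l : ℕ) :
    (j + 1) * Nat.multinomial Finset.univ ![j + 1, k, l] =
      (k + 1) * Nat.multinomial Finset.univ ![j, k + 1, l] := by
  have h1 := factorial_mul_multinomial (j + 1) k l
  have h2 := factorial_mul_multinomial j (k + 1) l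
  rw [show j + 1 + k + l = j + (k + 1) + l by omega, ← h2, Nat.factorial_succ,
    Nat.factorial_succ] at h1
  have hpos : 0 < j.factorial * k.factorial * l.factorial := by positivity
  exact Nat.eq_of_mul_eq_mul_left hpos (by linarith)

theorem succ_mul_multinomial_right (j k l : ℕ) :
    (k + 1) * Nat.multinomial Finset.univ ![j, k + 1, l] =
      (l + 1) * Nat.multinomial Finset.univ ![j, k, l + 1] := by
  have h1 := factorial_mul_multinomial j (k + 1) l
  have h2 := factorial_mul_multinomial j k (l + 1)
  rw [show j + (k + 1) + l = j + k + (l + 1) by omega, ← h2, Nat.factorial_succ,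
    Nat.factorial_succ] at h1
  have hpos : 0 < j.factorial * k.factorial * l.factorial := by positivity
  exact Nat.eq_of_mul_eq_mul_left hpos (by linarith)

/-- Makes the ladder coefficients `√((a+1)(b+1))` and the trinomial normalizations combine into
integer factors, those of a derivative of monomials. -/
theorem sqrt_mul_sqrt_of_mul_eq {a b : ℕ} {x y : ℕ} (h : (a + 1) * x = (b + 1) * y) :
    √(((a : ℝ) + 1) * (b + 1)) * √(y : ℝ) = (a + 1) * √(x : ℝ) ∧
      √(((a : ℝ) + 1) * (b + 1)) * √(x : ℝ) = (b + 1) * √(y : ℝ) := by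
  have h' : ((a : ℝ) + 1) * x = (b + 1) * y := by exact_mod_cast h
  constructor
  · rw [← Real.sqrt_mul (by positivity), mul_assoc, ← h', ← mul_assoc, ← sq,
      Real.sqrt_mul (by positivity), Real.sqrt_sq (by positivity)]
  · rw [← Real.sqrt_mul (by positivity), mul_comm ((a : ℝ) + 1), mul_assoc, h', ← mul_assoc, ← sq,
      Real.sqrt_mul (by positivity), Real.sqrt_sq (by positivity)]

variable {H : Type*} [NormedAddCommGroup H] [InnerProductSpace ℂ H]

/-- An orthonormal basis `b j k l`, `j + k + l = p`, with the operators that act on it as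
the Lie algebra acts on the normalized monomials of degree `p`: `Am`, `Ap`, `A3` as `E₂₁`, `E₁₂`,
`(E₁₁ - E₂₂)/2` and `Bm`, `Bp`, `B3` as `E₃₂`, `E₂₃`, `(E₂₂ - E₃₃)/2`. -/
structure IsSymPowerBasis (p : ℕ) (b : ℕ → ℕ → ℕ → H) (Am Ap A3 Bm Bp B3 : H →L[ℂ] H) :
    Prop where
  inner : ∀ j k l j' k' l', j + k + l = p → j' + k' + l' = p →
    ⟪b j k l, b j' k' l'⟫_ℂ = if j = j' ∧ k = k' ∧ l = l' then 1 else 0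
  span_eq_top : Submodule.span ℂ {v | ∃ j k l, j + k + l = p ∧ v = b j k l} = ⊤
  Am_succ : ∀ j k l, j + 1 + k + l = p →
    Am (b (j + 1) k l) = (√(((j : ℝ) + 1) * (k + 1)) : ℂ) • b j (k + 1) l
  Am_zero : ∀ k l, k + l = p → Am (b 0 k l) = 0
  Bm_succ : ∀ j k l, j + (k + 1) + l = p →
    Bm (b j (k + 1) l) = (√(((k : ℝ) + 1) * (l + 1)) : ℂ) • b j k (l + 1)
  Bm_zero : ∀ j l, j + l = p → Bm (b j 0 l) = 0
  A3_apply : ∀ j k l, j + k + l = p → A3 (b j k l) = (((j : ℂ) - k) / 2) • b j k l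
  B3_apply : ∀ j k l, j + k + l = p → B3 (b j k l) = (((k : ℂ) - l) / 2) • b j k l
  inner_Ap : ∀ v w, ⟪Ap v, w⟫_ℂ = ⟪v, Am w⟫_ℂ
  inner_Bp : ∀ v w, ⟪Bp v, w⟫_ℂ = ⟪v, Bm w⟫_ℂ
  inner_A3 : ∀ v w, ⟪A3 v, w⟫_ℂ = ⟪v, A3 w⟫_ℂ
  inner_B3 : ∀ v w, ⟪B3 v, w⟫_ℂ = ⟪v, B3 w⟫_ℂ

theorem veronese_eq_sum (p : ℕ) (b : ℕ → ℕ → ℕ → H) (z : C3) : veronese p b z =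
    ∑ m ∈ Finset.Nat.antidiagonalTuple 3 p,
      ((symCoeff (m 0) (m 1) (m 2) : ℂ) * (z 0 ^ m 0 * z 1 ^ m 1 * z 2 ^ m 2)) •
        b (m 0) (m 1) (m 2) := by
  refine Finset.sum_congr rfl fun m _ => ?_
  have : m = ![m 0, m 1, m 2] := by ext i; fin_cases i <;> rfl
  rw [symCoeff, ← this]

theorem contDiff_veronese (p : ℕ) (b : ℕ → ℕ → ℕ → H) : ContDiff ℝ ∞ (veronese p b) := by
  unfold veronese
  refine ContDiff.sum fun m _ => ContDiff.smul (contDiff_const.mul ?_) contDiff_const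
  have hc : ∀ i : Fin 3, ContDiff ℝ ∞ fun z : C3 => z i := fun i =>
    ((EuclideanSpace.proj (𝕜 := ℂ) i).restrictScalars ℝ).contDiff
  exact (((hc 0).pow _).mul ((hc 1).pow _)).mul ((hc 2).pow _)

theorem veronese_smul (p : ℕ) (b : ℕ → ℕ → ℕ → H) (c : ℂ) (z : C3) :
    veronese p b (c • z) = c ^ p • veronese p b z := by
  rw [veronese, veronese, Finset.smul_sum]
  refine Finset.sum_congr rfl fun m hm => ?_
  rw [smul_smul]
  congr 1
  have h : p = m 0 + m 1 + m 2 := (sum_of_mem_antidiagonalTuple_three hm).symm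
  simp only [PiLp.smul_apply, smul_eq_mul, mul_pow]
  rw [h, pow_add, pow_add]
  ring

theorem hasDerivAt_veronese (p : ℕ) (b : ℕ → ℕ → ℕ → H) {ζ : ℝ → C3} {ζ' : Fin 3 → ℂ} {t : ℝ}
    (hζ : ∀ i, HasDerivAt (fun t => ζ t i) (ζ' i) t) :
    HasDerivAt (fun t => veronese p b (ζ t))
      (∑ m ∈ Finset.Nat.antidiagonalTuple 3 p, ((symCoeff (m 0) (m 1) (m 2) : ℂ) *
        ((m 0 * ζ t 0 ^ (m 0 - 1) * ζ' 0) * ζ t 1 ^ m 1 * ζ t 2 ^ m 2 +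
          ζ t 0 ^ m 0 * (m 1 * ζ t 1 ^ (m 1 - 1) * ζ' 1) * ζ t 2 ^ m 2 +
          ζ t 0 ^ m 0 * ζ t 1 ^ m 1 * (m 2 * ζ t 2 ^ (m 2 - 1) * ζ' 2))) •
        b (m 0) (m 1) (m 2)) t := by
  simp_rw [veronese_eq_sum]
  refine HasDerivAt.fun_sum fun m _ => HasDerivAt.smul_const ?_ _
  refine HasDerivAt.const_mul _ ?_
  have h := (((hζ 0).fun_pow (m 0)).fun_mul ((hζ 1).fun_pow (m 1))).fun_mul ((hζ 2).fun_pow (m 2))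
  refine h.congr_deriv ?_
  ring

/-! ### The map `Φ_p` in a symmetric power basis -/

namespace IsSymPowerBasis

variable {p : ℕ} {b : ℕ → ℕ → ℕ → H} {Am Ap A3 Bm Bp B3 : H →L[ℂ] H}

theorem ext_inner (hb : IsSymPowerBasis p b Am Ap A3 Bm Bp B3) {v w : H}
    (h : ∀ j k l, j + k + l = p → ⟪b j k l, v⟫_ℂ = ⟪b j k l, w⟫_ℂ) : v = w := by
  rw [← sub_eq_zero, ← inner_self_eq_zero (𝕜 := ℂ)]
  have hmem : v - w ∈ Submodule.span ℂ {v | ∃ j k l, j + k + l = p ∧ v = b j k l} :=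
    hb.span_eq_top ▸ Submodule.mem_top
  refine Submodule.span_induction (p := fun x _ => ⟪x, v - w⟫_ℂ = 0) ?_ ?_ ?_ ?_ hmem
  · rintro _ ⟨j, k, l, hs, rfl⟩
    rw [inner_sub_right, h j k l hs, sub_self]
  · exact inner_zero_left _
  · intro x y _ _ hx hy
    rw [inner_add_left, hx, hy, add_zero]
  · intro c x _ hx
    rw [inner_smul_left, hx, mul_zero]

theorem inner_sum_smul (hb : IsSymPowerBasis p b Am Ap A3 Bm Bp B3) (a : ℕ → ℕ → ℕ → ℂ)
    {j k l : ℕ} (hs : j + k + l = p) :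
    ⟪b j k l, ∑ m ∈ Finset.Nat.antidiagonalTuple 3 p,
      a (m 0) (m 1) (m 2) • b (m 0) (m 1) (m 2)⟫_ℂ = a j k l := by
  rw [inner_sum, Finset.sum_eq_single ![j, k, l]]
  · change ⟪b j k l, a j k l • b j k l⟫_ℂ = a j k l
    rw [inner_smul_right, hb.inner j k l j k l hs hs, if_pos ⟨rfl, rfl, rfl⟩, mul_one]
  · intro m hm hne
    rw [inner_smul_right, hb.inner _ _ _ _ _ _ hs (sum_of_mem_antidiagonalTuple_three hm), if_neg, mul_zero]
    rintro ⟨rfl, rfl, rfl⟩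
    apply hne
    ext i; fin_cases i <;> rfl
  · intro h
    exact absurd (Finset.Nat.mem_antidiagonalTuple.2 (by simpa [Fin.sum_univ_three] using hs)) h

theorem inner_veronese (hb : IsSymPowerBasis p b Am Ap A3 Bm Bp B3) {j k l : ℕ}
    (hs : j + k + l = p) (z : C3) :
    ⟪b j k l, veronese p b z⟫_ℂ = (symCoeff j k l : ℂ) * (z 0 ^ j * z 1 ^ k * z 2 ^ l) := by
  rw [veronese_eq_sum]
  exact hb.inner_sum_smul
    (fun j k l => (symCoeff j k l : ℂ) * (z 0 ^ j * z 1 ^ k * z 2 ^ l)) hs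

theorem hasDerivAt (hb : IsSymPowerBasis p b Am Ap A3 Bm Bp B3) {ζ : ℝ → C3}
    {ζ' : Fin 3 → ℂ} {t : ℝ} (hζ : ∀ i, HasDerivAt (fun t => ζ t i) (ζ' i) t) {v : H}
    (hv : ∀ j k l, j + k + l = p → ⟪b j k l, v⟫_ℂ = (symCoeff j k l : ℂ) *
        ((j * ζ t 0 ^ (j - 1) * ζ' 0) * ζ t 1 ^ k * ζ t 2 ^ l +
          ζ t 0 ^ j * (k * ζ t 1 ^ (k - 1) * ζ' 1) * ζ t 2 ^ l +
          ζ t 0 ^ j * ζ t 1 ^ k * (l * ζ t 2 ^ (l - 1) * ζ' 2))) :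
    HasDerivAt (fun t => veronese p b (ζ t)) v t := by
  refine (hasDerivAt_veronese p b hζ).congr_deriv (hb.ext_inner fun j k l hs => ?_)
  rw [hv j k l hs]
  exact hb.inner_sum_smul (fun j k l => (symCoeff j k l : ℂ) *
        ((j * ζ t 0 ^ (j - 1) * ζ' 0) * ζ t 1 ^ k * ζ t 2 ^ l +
          ζ t 0 ^ j * (k * ζ t 1 ^ (k - 1) * ζ' 1) * ζ t 2 ^ l +
          ζ t 0 ^ j * ζ t 1 ^ k * (l * ζ t 2 ^ (l - 1) * ζ' 2))) hs

/-- The raising coefficients are matrix elements of the adjoint of `Am`. -/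
theorem Ap_succ (hb : IsSymPowerBasis p b Am Ap A3 Bm Bp B3) (j k l : ℕ)
    (hs : j + (k + 1) + l = p) :
    Ap (b j (k + 1) l) = (√(((j : ℝ) + 1) * (k + 1)) : ℂ) • b (j + 1) k l := by
  refine hb.ext_inner fun j' k' l' hs' => ?_
  rw [← inner_conj_symm, hb.inner_Ap, inner_conj_symm, inner_smul_right,
    hb.inner j' k' l' (j + 1) k l hs' (by omega)]
  rcases j' with _ | j'
  · rw [hb.Am_zero k' l' (by omega), inner_zero_left, if_neg (by omega), mul_zero]
  · rw [hb.Am_succ j' k' l' hs', inner_smul_left, hb.inner _ _ _ _ _ _ (by omega) hs,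
      Complex.conj_ofReal]
    by_cases h : j' = j ∧ k' = k ∧ l' = l
    · obtain ⟨rfl, rfl, rfl⟩ := h
      simp
    · rw [if_neg (by omega), if_neg (by omega), mul_zero, mul_zero]

theorem Ap_zero (hb : IsSymPowerBasis p b Am Ap A3 Bm Bp B3) (j l : ℕ) (hs : j + l = p) :
    Ap (b j 0 l) = 0 := by
  refine hb.ext_inner fun j' k' l' hs' => ?_
  rw [← inner_conj_symm, hb.inner_Ap, inner_conj_symm, inner_zero_right]
  rcases j' with _ | j'
  · rw [hb.Am_zero k' l' (by omega), inner_zero_left]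
  · rw [hb.Am_succ j' k' l' hs', inner_smul_left, hb.inner _ _ _ _ _ _ (by omega) (by omega),
      if_neg (by omega), mul_zero]

theorem Bp_succ (hb : IsSymPowerBasis p b Am Ap A3 Bm Bp B3) (j k l : ℕ)
    (hs : j + k + (l + 1) = p) :
    Bp (b j k (l + 1)) = (√(((k : ℝ) + 1) * (l + 1)) : ℂ) • b j (k + 1) l := by
  refine hb.ext_inner fun j' k' l' hs' => ?_
  rw [← inner_conj_symm, hb.inner_Bp, inner_conj_symm, inner_smul_right,
    hb.inner j' k' l' j (k + 1) l hs' (by omega)]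
  rcases k' with _ | k'
  · rw [hb.Bm_zero j' l' (by omega), inner_zero_left, if_neg (by omega), mul_zero]
  · rw [hb.Bm_succ j' k' l' hs', inner_smul_left, hb.inner _ _ _ _ _ _ (by omega) hs,
      Complex.conj_ofReal]
    by_cases h : j' = j ∧ k' = k ∧ l' = l
    · obtain ⟨rfl, rfl, rfl⟩ := h
      simp
    · rw [if_neg (by omega), if_neg (by omega), mul_zero, mul_zero]

theorem Bp_zero (hb : IsSymPowerBasis p b Am Ap A3 Bm Bp B3) (j k : ℕ) (hs : j + k = p) :
    Bp (b j k 0) = 0 := by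
  refine hb.ext_inner fun j' k' l' hs' => ?_
  rw [← inner_conj_symm, hb.inner_Bp, inner_conj_symm, inner_zero_right]
  rcases k' with _ | k'
  · rw [hb.Bm_zero j' l' (by omega), inner_zero_left]
  · rw [hb.Bm_succ j' k' l' hs', inner_smul_left, hb.inner _ _ _ _ _ _ (by omega) (by omega),
      if_neg (by omega), mul_zero]

/-- On `Φ_p` the operator `Ap` acts as the vector field `z₁ ∂/∂z₀` (coordinates numbered from `0`),
and the next lemmas are the analogues for `Am`, `Bp`, `Bm`. The truncated exponent `j - 1` is
harmless because of the factor `j`. -/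
theorem inner_Ap_veronese (hb : IsSymPowerBasis p b Am Ap A3 Bm Bp B3) {j k l : ℕ}
    (hs : j + k + l = p) (z : C3) : ⟪b j k l, Ap (veronese p b z)⟫_ℂ =
      (symCoeff j k l : ℂ) * (j * z 0 ^ (j - 1) * z 1 ^ (k + 1) * z 2 ^ l) := by
  rw [← inner_conj_symm, hb.inner_Ap, inner_conj_symm]
  rcases j with _ | j
  · rw [hb.Am_zero k l (by omega), inner_zero_left]
    simp
  · rw [hb.Am_succ j k l hs, inner_smul_left, hb.inner_veronese (by omega), Complex.conj_ofReal]
    have h := (sqrt_mul_sqrt_of_mul_eq (succ_mul_multinomial_left j k l)).1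
    have h' := congrArg (fun x : ℝ => (x : ℂ)) h
    push_cast at h'
    simp only [symCoeff, Nat.add_sub_cancel]
    push_cast
    linear_combination (z 0 ^ j * z 1 ^ (k + 1) * z 2 ^ l) * h'

theorem inner_Am_veronese (hb : IsSymPowerBasis p b Am Ap A3 Bm Bp B3) {j k l : ℕ}
    (hs : j + k + l = p) (z : C3) : ⟪b j k l, Am (veronese p b z)⟫_ℂ =
      (symCoeff j k l : ℂ) * (k * z 0 ^ (j + 1) * z 1 ^ (k - 1) * z 2 ^ l) := by
  rw [← hb.inner_Ap]
  rcases k with _ | k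
  · rw [hb.Ap_zero j l (by omega), inner_zero_left]
    simp
  · rw [hb.Ap_succ j k l hs, inner_smul_left, hb.inner_veronese (by omega), Complex.conj_ofReal]
    have h := (sqrt_mul_sqrt_of_mul_eq (succ_mul_multinomial_left j k l)).2
    have h' := congrArg (fun x : ℝ => (x : ℂ)) h
    push_cast at h'
    simp only [symCoeff, Nat.add_sub_cancel]
    push_cast
    linear_combination (z 0 ^ (j + 1) * z 1 ^ k * z 2 ^ l) * h'

theorem inner_Bp_veronese (hb : IsSymPowerBasis p b Am Ap A3 Bm Bp B3) {j k l : ℕ}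
    (hs : j + k + l = p) (z : C3) : ⟪b j k l, Bp (veronese p b z)⟫_ℂ =
      (symCoeff j k l : ℂ) * (k * z 0 ^ j * z 1 ^ (k - 1) * z 2 ^ (l + 1)) := by
  rw [← inner_conj_symm, hb.inner_Bp, inner_conj_symm]
  rcases k with _ | k
  · rw [hb.Bm_zero j l (by omega), inner_zero_left]
    simp
  · rw [hb.Bm_succ j k l hs, inner_smul_left, hb.inner_veronese (by omega), Complex.conj_ofReal]
    have h := (sqrt_mul_sqrt_of_mul_eq (succ_mul_multinomial_right j k l)).1
    have h' := congrArg (fun x : ℝ => (x : ℂ)) h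
    push_cast at h'
    simp only [symCoeff, Nat.add_sub_cancel]
    push_cast
    linear_combination (z 0 ^ j * z 1 ^ k * z 2 ^ (l + 1)) * h'

theorem inner_Bm_veronese (hb : IsSymPowerBasis p b Am Ap A3 Bm Bp B3) {j k l : ℕ}
    (hs : j + k + l = p) (z : C3) : ⟪b j k l, Bm (veronese p b z)⟫_ℂ =
      (symCoeff j k l : ℂ) * (l * z 0 ^ j * z 1 ^ (k + 1) * z 2 ^ (l - 1)) := by
  rw [← hb.inner_Bp]
  rcases l with _ | l
  · rw [hb.Bp_zero j k (by omega), inner_zero_left]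
    simp
  · rw [hb.Bp_succ j k l hs, inner_smul_left, hb.inner_veronese (by omega), Complex.conj_ofReal]
    have h := (sqrt_mul_sqrt_of_mul_eq (succ_mul_multinomial_right j k l)).2
    have h' := congrArg (fun x : ℝ => (x : ℂ)) h
    push_cast at h'
    simp only [symCoeff, Nat.add_sub_cancel]
    push_cast
    linear_combination (z 0 ^ j * z 1 ^ (k + 1) * z 2 ^ l) * h'

theorem inner_A3_veronese (hb : IsSymPowerBasis p b Am Ap A3 Bm Bp B3) {j k l : ℕ}
    (hs : j + k + l = p) (z : C3) : ⟪b j k l, A3 (veronese p b z)⟫_ℂ =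
      ((j : ℂ) - k) / 2 * ((symCoeff j k l : ℂ) * (z 0 ^ j * z 1 ^ k * z 2 ^ l)) := by
  rw [← hb.inner_A3, hb.A3_apply j k l hs, inner_smul_left, hb.inner_veronese hs, map_div₀,
    map_sub, Complex.conj_natCast, Complex.conj_natCast, Complex.conj_ofNat]

theorem inner_B3_veronese (hb : IsSymPowerBasis p b Am Ap A3 Bm Bp B3) {j k l : ℕ}
    (hs : j + k + l = p) (z : C3) : ⟪b j k l, B3 (veronese p b z)⟫_ℂ =
      ((k : ℂ) - l) / 2 * ((symCoeff j k l : ℂ) * (z 0 ^ j * z 1 ^ k * z 2 ^ l)) := by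
  rw [← hb.inner_B3, hb.B3_apply j k l hs, inner_smul_left, hb.inner_veronese hs, map_div₀,
    map_sub, Complex.conj_natCast, Complex.conj_natCast, Complex.conj_ofNat]

theorem natCast_mul_pow_pred_mul (j : ℕ) (x : ℂ) : (j : ℂ) * x ^ (j - 1) * x = j * x ^ j := by
  rcases j with _ | j
  · simp
  · rw [Nat.add_sub_cancel, pow_succ, mul_assoc]

/-- Chain rule: differentiating `Φ_p` along the rotation flow applies the field `(z₁ ∂/∂z₀ - z₀
∂/∂z₁)/2`, which is how `(Ap - Am)/2` acts. -/
theorem hasDerivAt_A2 (hb : IsSymPowerBasis p b Am Ap A3 Bm Bp B3) {ζ : ℝ → C3} {t : ℝ}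
    (h0 : HasDerivAt (fun t => ζ t 0) (ζ t 1 / 2) t)
    (h1 : HasDerivAt (fun t => ζ t 1) (-ζ t 0 / 2) t)
    (h2 : HasDerivAt (fun t => ζ t 2) 0 t) :
    HasDerivAt (fun t => veronese p b (ζ t))
      ((1 / 2 : ℂ) • (Ap - Am) (veronese p b (ζ t))) t := by
  refine hb.hasDerivAt (ζ' := ![ζ t 1 / 2, -ζ t 0 / 2, 0])
    (fun i => by fin_cases i <;> assumption) fun j k l hs => ?_
  rw [inner_smul_right, sub_apply, inner_sub_right, hb.inner_Ap_veronese hs,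
    hb.inner_Am_veronese hs]
  simp only [Matrix.cons_val_zero, Matrix.cons_val_one, Matrix.cons_val]
  ring

theorem hasDerivAt_B2 (hb : IsSymPowerBasis p b Am Ap A3 Bm Bp B3) {ζ : ℝ → C3} {t : ℝ}
    (h0 : HasDerivAt (fun t => ζ t 0) 0 t)
    (h1 : HasDerivAt (fun t => ζ t 1) (ζ t 2 / 2) t)
    (h2 : HasDerivAt (fun t => ζ t 2) (-ζ t 1 / 2) t) :
    HasDerivAt (fun t => veronese p b (ζ t))
      ((1 / 2 : ℂ) • (Bp - Bm) (veronese p b (ζ t))) t := by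
  refine hb.hasDerivAt (ζ' := ![0, ζ t 2 / 2, -ζ t 1 / 2])
    (fun i => by fin_cases i <;> assumption) fun j k l hs => ?_
  rw [inner_smul_right, sub_apply, inner_sub_right, hb.inner_Bp_veronese hs,
    hb.inner_Bm_veronese hs]
  simp only [Matrix.cons_val_zero, Matrix.cons_val_one, Matrix.cons_val]
  ring

theorem hasDerivAt_A3 (hb : IsSymPowerBasis p b Am Ap A3 Bm Bp B3) {ζ : ℝ → C3} {t : ℝ}
    (h0 : HasDerivAt (fun t => ζ t 0) (Complex.I / 2 * ζ t 0) t)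
    (h1 : HasDerivAt (fun t => ζ t 1) (-Complex.I / 2 * ζ t 1) t)
    (h2 : HasDerivAt (fun t => ζ t 2) 0 t) :
    HasDerivAt (fun t => veronese p b (ζ t)) (Complex.I • A3 (veronese p b (ζ t))) t := by
  refine hb.hasDerivAt (ζ' := ![Complex.I / 2 * ζ t 0, -Complex.I / 2 * ζ t 1, 0])
    (fun i => by fin_cases i <;> assumption) fun j k l hs => ?_
  rw [inner_smul_right, hb.inner_A3_veronese hs]
  simp only [Matrix.cons_val_zero, Matrix.cons_val_one, Matrix.cons_val]
  have e0 := natCast_mul_pow_pred_mul j (ζ t 0)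
  have e1 := natCast_mul_pow_pred_mul k (ζ t 1)
  linear_combination (symCoeff j k l : ℂ) * (Complex.I / 2) *
    (-(ζ t 1 ^ k * ζ t 2 ^ l) * e0 + ζ t 0 ^ j * ζ t 2 ^ l * e1)

theorem hasDerivAt_B3 (hb : IsSymPowerBasis p b Am Ap A3 Bm Bp B3) {ζ : ℝ → C3} {t : ℝ}
    (h0 : HasDerivAt (fun t => ζ t 0) 0 t)
    (h1 : HasDerivAt (fun t => ζ t 1) (Complex.I / 2 * ζ t 1) t)
    (h2 : HasDerivAt (fun t => ζ t 2) (-Complex.I / 2 * ζ t 2) t) :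
    HasDerivAt (fun t => veronese p b (ζ t)) (Complex.I • B3 (veronese p b (ζ t))) t := by
  refine hb.hasDerivAt (ζ' := ![0, Complex.I / 2 * ζ t 1, -Complex.I / 2 * ζ t 2])
    (fun i => by fin_cases i <;> assumption) fun j k l hs => ?_
  rw [inner_smul_right, hb.inner_B3_veronese hs]
  simp only [Matrix.cons_val_zero, Matrix.cons_val_one, Matrix.cons_val]
  have e1 := natCast_mul_pow_pred_mul k (ζ t 1)
  have e2 := natCast_mul_pow_pred_mul l (ζ t 2)
  linear_combination (symCoeff j k l : ℂ) * (Complex.I / 2) *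
    (-(ζ t 0 ^ j * ζ t 2 ^ l) * e1 + ζ t 0 ^ j * ζ t 1 ^ k * e2)

theorem two_mul_finrank (hb : IsSymPowerBasis p b Am Ap A3 Bm Bp B3) :
    Module.finrank ℂ H * 2 = (p + 1) * (p + 2) := by
  have hon : Orthonormal ℂ fun m : Finset.Nat.antidiagonalTuple 3 p =>
      b (m.1 0) (m.1 1) (m.1 2) := by
    rw [orthonormal_iff_ite]
    intro m m'
    rw [hb.inner _ _ _ _ _ _ (sum_of_mem_antidiagonalTuple_three m.2)
      (sum_of_mem_antidiagonalTuple_three m'.2)]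
    congr 1
    rw [Subtype.ext_iff, funext_iff, Fin.forall_fin_succ, Fin.forall_fin_succ, Fin.forall_fin_succ]
    simp
  have hspan : ⊤ ≤ Submodule.span ℂ (Set.range fun m : Finset.Nat.antidiagonalTuple 3 p =>
      b (m.1 0) (m.1 1) (m.1 2)) := by
    rw [← hb.span_eq_top]
    refine Submodule.span_mono ?_
    rintro _ ⟨j, k, l, hs, rfl⟩
    exact ⟨⟨![j, k, l], Finset.Nat.mem_antidiagonalTuple.2
      (by simpa [Fin.sum_univ_three] using hs)⟩, rfl⟩
  rw [Module.finrank_eq_card_basis (Module.Basis.mk hon.linearIndependent hspan),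
    Fintype.card_coe, two_mul_card_antidiagonalTuple_three]

end IsSymPowerBasis

end QuarkSymbol

namespace QuarkSymbol

set_option linter.unusedSectionVars false

/-! ### Polarization -/

/-- A polynomial in `z` and `z̄` that vanishes identically vanishes when `z` and `z̄` are replaced by
independent variables. -/
theorem sum_mul_prod_eq_zero_of_conj {ι : Type*} [Fintype ι] (s : Finset (ι → ℕ))
    (a : (ι → ℕ) → (ι → ℕ) → ℂ)
    (h : ∀ z : ι → ℂ, ∑ m ∈ s, ∑ m' ∈ s,
      a m m' * ((∏ i, conj (z i) ^ m i) * ∏ i, z i ^ m' i) = 0) (w z : ι → ℂ) :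
    ∑ m ∈ s, ∑ m' ∈ s, a m m' * ((∏ i, w i ^ m i) * ∏ i, z i ^ m' i) = 0 := by
  let X : ι → MvPolynomial (ι ⊕ ι) ℂ := fun i => MvPolynomial.X (Sum.inl i)
  let Y : ι → MvPolynomial (ι ⊕ ι) ℂ := fun i => MvPolynomial.C Complex.I * MvPolynomial.X (Sum.inr i)
  let S : MvPolynomial (ι ⊕ ι) ℂ := ∑ m ∈ s, ∑ m' ∈ s,
    MvPolynomial.C (a m m') * ((∏ i, (X i - Y i) ^ m i) * ∏ i, (X i + Y i) ^ m' i)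
  have heval : ∀ x : ι ⊕ ι → ℂ, MvPolynomial.eval x S = ∑ m ∈ s, ∑ m' ∈ s,
      a m m' * ((∏ i, (x (Sum.inl i) - Complex.I * x (Sum.inr i)) ^ m i) *
        ∏ i, (x (Sum.inl i) + Complex.I * x (Sum.inr i)) ^ m' i) := by
    intro x
    simp [S, X, Y, map_sum, map_prod]
  -- Treat the real and imaginary parts of `z` as indeterminates. The resulting polynomial vanishes
  -- at all real points, hence identically, since `ℝ` is infinite.
  have hS : S = 0 := by
    refine MvPolynomial.funext_set (fun _ => Set.range ((↑) : ℝ → ℂ))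
      (fun _ => Set.infinite_range_of_injective Complex.ofReal_injective) fun x hx => ?_
    rw [heval, map_zero, ← h fun i => x (Sum.inl i) + Complex.I * x (Sum.inr i)]
    refine Finset.sum_congr rfl fun m _ => Finset.sum_congr rfl fun m' _ => ?_
    congr 2
    refine Finset.prod_congr rfl fun i _ => ?_
    obtain ⟨u, hu⟩ := hx (Sum.inl i) (Set.mem_univ _)
    obtain ⟨v, hv⟩ := hx (Sum.inr i) (Set.mem_univ _)
    rw [← hu, ← hv, map_add, map_mul, Complex.conj_ofReal, Complex.conj_ofReal, Complex.conj_I,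
      neg_mul, sub_eq_add_neg]
  -- These complex values `x`, `y` are chosen to satisfy `x - iy = w` and `x + iy = z`.
  have hx := heval (Sum.elim (fun i => (w i + z i) / 2) fun i => Complex.I * (w i - z i) / 2)
  rw [hS, map_zero] at hx
  rw [hx]
  refine Finset.sum_congr rfl fun m _ => Finset.sum_congr rfl fun m' _ => ?_
  have e1 : ∀ i, (w i + z i) / 2 - Complex.I * (Complex.I * (w i - z i) / 2) = w i := by
    intro i
    linear_combination (-(w i - z i) / 2) * Complex.I_sq
  have e2 : ∀ i, (w i + z i) / 2 + Complex.I * (Complex.I * (w i - z i) / 2) = z i := by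
    intro i
    linear_combination ((w i - z i) / 2) * Complex.I_sq
  simp only [Sum.elim_inl, Sum.elim_inr, e1, e2]

variable {H : Type*} [NormedAddCommGroup H] [InnerProductSpace ℂ H]

theorem inner_veronese_apply (p : ℕ) (b : ℕ → ℕ → ℕ → H) (A : H →L[ℂ] H) (w z : C3) :
    ⟪veronese p b w, A (veronese p b z)⟫_ℂ = ∑ m ∈ Finset.Nat.antidiagonalTuple 3 p,
      ∑ m' ∈ Finset.Nat.antidiagonalTuple 3 p,
        ((symCoeff (m 0) (m 1) (m 2) : ℂ) * symCoeff (m' 0) (m' 1) (m' 2) *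
          ⟪b (m 0) (m 1) (m 2), A (b (m' 0) (m' 1) (m' 2))⟫_ℂ) *
          ((∏ i, conj (w i) ^ m i) * ∏ i, z i ^ m' i) := by
  rw [veronese_eq_sum, veronese_eq_sum, sum_inner]
  refine Finset.sum_congr rfl fun m _ => ?_
  rw [map_sum, inner_sum]
  refine Finset.sum_congr rfl fun m' _ => ?_
  rw [_root_.map_smul, inner_smul_left, inner_smul_right, Fin.prod_univ_three, Fin.prod_univ_three]
  simp only [map_mul, map_pow, Complex.conj_ofReal]
  ring

theorem inner_veronese_eq_zero {p : ℕ} {b : ℕ → ℕ → ℕ → H} {A : H →L[ℂ] H}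
    (h : ∀ z, ⟪veronese p b z, A (veronese p b z)⟫_ℂ = 0) (w z : C3) :
    ⟪veronese p b w, A (veronese p b z)⟫_ℂ = 0 := by
  have h' : ∀ z : Fin 3 → ℂ, _ := fun z =>
    (inner_veronese_apply p b A (WithLp.toLp 2 z) (WithLp.toLp 2 z)).symm.trans (h _)
  rw [inner_veronese_apply]
  exact sum_mul_prod_eq_zero_of_conj _ _ h' (fun i => conj (w i)) fun i => z i

/-- The span of the range of an equivariant map is invariant, and it is nonzero by the hypothesis at
`z₀`. -/
theorem IsIrreducibleRep.span_range_eq_top {ρ : SU3 →* (H →L[ℂ] H)} (hirr : IsIrreducibleRep ρ)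
    {Ψ : C3 → H} (hact : ∀ g z, Ψ (actC3 g z) = ρ g (Ψ z)) {z₀ : C3} (hz₀ : Ψ z₀ ≠ 0) :
    Submodule.span ℂ (Set.range Ψ) = ⊤ := by
  refine (hirr.2 _ ?_).resolve_left ?_
  · intro g x hx
    refine Submodule.span_induction (p := fun x _ => ρ g x ∈ Submodule.span ℂ (Set.range Ψ))
      ?_ ?_ ?_ ?_ hx
    · rintro _ ⟨z, rfl⟩
      rw [← hact]
      exact Submodule.subset_span ⟨_, rfl⟩
    · rw [map_zero]
      exact Submodule.zero_mem _
    · intro x y _ _ hx hy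
      rw [map_add]
      exact Submodule.add_mem _ hx hy
    · intro c x _ hx
      rw [_root_.map_smul]
      exact Submodule.smul_mem _ _ hx
  · intro h
    have hmem : Ψ z₀ ∈ Submodule.span ℂ (Set.range Ψ) := Submodule.subset_span ⟨z₀, rfl⟩
    rw [h, Submodule.mem_bot] at hmem
    exact hz₀ hmem

/-- Vanishing on the diagonal polarizes to all pairs `w`, `z`, and the values of the map span `H`,
so every matrix element of `A` is zero. The surjection `θ` is the identity for quarks and `σ` for
antiquarks. -/
theorem IsIrreducibleRep.separates_veronese {ρ : SU3 →* (H →L[ℂ] H)} (hirr : IsIrreducibleRep ρ)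
    {p : ℕ} {b : ℕ → ℕ → ℕ → H} {θ : C3 → C3} (hθ : Function.Surjective θ)
    (hact : ∀ g z, veronese p b (θ (actC3 g z)) = ρ g (veronese p b (θ z))) {z₀ : C3}
    (hz₀ : veronese p b (θ z₀) ≠ 0) {A : H →L[ℂ] H}
    (hA : ∀ z, ⟪veronese p b (θ z), A (veronese p b (θ z))⟫_ℂ = 0) : A = 0 := by
  have h1 : ∀ w z, ⟪veronese p b w, A (veronese p b z)⟫_ℂ = 0 :=
    inner_veronese_eq_zero fun z => by
      obtain ⟨z, rfl⟩ := hθ z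
      exact hA z
  have htop := hirr.span_range_eq_top (Ψ := fun z => veronese p b (θ z)) hact hz₀
  have h2 : ∀ z, A (veronese p b z) = 0 := by
    intro z
    rw [← inner_self_eq_zero (𝕜 := ℂ)]
    have hle : Submodule.span ℂ (Set.range fun z => veronese p b (θ z)) ≤
        LinearMap.ker (innerSL ℂ (A (veronese p b z)) : H →ₗ[ℂ] ℂ) := by
      refine Submodule.span_le.2 ?_
      rintro _ ⟨w, rfl⟩
      have h := congrArg conj (h1 (θ w) z)
      rw [inner_conj_symm, map_zero] at h
      exact h
    exact hle (htop ▸ Submodule.mem_top)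
  have hle : Submodule.span ℂ (Set.range fun z => veronese p b (θ z)) ≤
      LinearMap.ker (A : H →ₗ[ℂ] H) := by
    refine Submodule.span_le.2 ?_
    rintro _ ⟨w, rfl⟩
    exact h2 (θ w)
  ext v
  exact hle (htop ▸ Submodule.mem_top (x := v))

/-! ### The coherent maps -/

theorem I_smul_genT2_mulVec (w : Fin 3 → ℂ) :
    (Complex.I • genT2).mulVec w = ![w 1 / 2, -w 0 / 2, 0] := by
  ext i
  fin_cases i <;> simp [genT2, Matrix.mulVec, dotProduct, Fin.sum_univ_three]
  · linear_combination (-w 1 / 2) * Complex.I_sq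
  · linear_combination (w 0 / 2) * Complex.I_sq

theorem I_smul_genU2_mulVec (w : Fin 3 → ℂ) :
    (Complex.I • genU2).mulVec w = ![0, w 2 / 2, -w 1 / 2] := by
  ext i
  fin_cases i <;> simp [genU2, Matrix.mulVec, dotProduct, Fin.sum_univ_three]
  · linear_combination (-w 2 / 2) * Complex.I_sq
  · linear_combination (w 1 / 2) * Complex.I_sq

theorem I_smul_genT3_mulVec (w : Fin 3 → ℂ) :
    (Complex.I • genT3).mulVec w = ![Complex.I / 2 * w 0, -Complex.I / 2 * w 1, 0] := by
  ext i
  fin_cases i <;> simp [genT3, Matrix.mulVec, dotProduct, Fin.sum_univ_three]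
  · exact Or.inl (by ring)
  · exact Or.inl (by ring)

theorem I_smul_genU3_mulVec (w : Fin 3 → ℂ) :
    (Complex.I • genU3).mulVec w = ![0, Complex.I / 2 * w 1, -Complex.I / 2 * w 2] := by
  ext i
  fin_cases i <;> simp [genU3, Matrix.mulVec, dotProduct, Fin.sum_univ_three]
  · exact Or.inl (by ring)
  · exact Or.inl (by ring)

theorem hasDerivAt_actC3_genT2 (z : C3) (t : ℝ) :
    HasDerivAt (fun t => actC3 (expCurve genT2 t) z 0) (actC3 (expCurve genT2 t) z 1 / 2) t ∧
    HasDerivAt (fun t => actC3 (expCurve genT2 t) z 1) (-actC3 (expCurve genT2 t) z 0 / 2) t ∧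
    HasDerivAt (fun t => actC3 (expCurve genT2 t) z 2) 0 t := by
  have h := hasDerivAt_actC3_expCurve genT2_isHermitian genT2_trace z t
  simp only [I_smul_genT2_mulVec] at h
  exact ⟨h 0, h 1, h 2⟩

theorem hasDerivAt_actC3_genU2 (z : C3) (t : ℝ) :
    HasDerivAt (fun t => actC3 (expCurve genU2 t) z 0) 0 t ∧
    HasDerivAt (fun t => actC3 (expCurve genU2 t) z 1) (actC3 (expCurve genU2 t) z 2 / 2) t ∧
    HasDerivAt (fun t => actC3 (expCurve genU2 t) z 2) (-actC3 (expCurve genU2 t) z 1 / 2) t := by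
  have h := hasDerivAt_actC3_expCurve genU2_isHermitian genU2_trace z t
  simp only [I_smul_genU2_mulVec] at h
  exact ⟨h 0, h 1, h 2⟩

theorem hasDerivAt_actC3_genT3 (z : C3) (t : ℝ) :
    HasDerivAt (fun t => actC3 (expCurve genT3 t) z 0)
      (Complex.I / 2 * actC3 (expCurve genT3 t) z 0) t ∧
    HasDerivAt (fun t => actC3 (expCurve genT3 t) z 1)
      (-Complex.I / 2 * actC3 (expCurve genT3 t) z 1) t ∧
    HasDerivAt (fun t => actC3 (expCurve genT3 t) z 2) 0 t := by
  have h := hasDerivAt_actC3_expCurve genT3_isHermitian genT3_trace z t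
  simp only [I_smul_genT3_mulVec] at h
  exact ⟨h 0, h 1, h 2⟩

theorem hasDerivAt_actC3_genU3 (z : C3) (t : ℝ) :
    HasDerivAt (fun t => actC3 (expCurve genU3 t) z 0) 0 t ∧
    HasDerivAt (fun t => actC3 (expCurve genU3 t) z 1)
      (Complex.I / 2 * actC3 (expCurve genU3 t) z 1) t ∧
    HasDerivAt (fun t => actC3 (expCurve genU3 t) z 2)
      (-Complex.I / 2 * actC3 (expCurve genU3 t) z 2) t := by
  have h := hasDerivAt_actC3_expCurve genU3_isHermitian genU3_trace z t
  simp only [I_smul_genU3_mulVec] at h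
  exact ⟨h 0, h 1, h 2⟩

/-- Equivariance of a map with values in a representation follows from the differential equations
along the one-parameter subgroups that generate `SU(3)`. -/
theorem map_actC3_of_hasDerivAt [CompleteSpace H] {ρ : SU3 →* (H →L[ℂ] H)} (hρ : Continuous ρ)
    {Ψ : C3 → H}
    (hT3 : ∀ z t, HasDerivAt (fun t => Ψ (actC3 (expCurve genT3 t) z))
      (Complex.I • T3 ρ (Ψ (actC3 (expCurve genT3 t) z))) t)
    (hU3 : ∀ z t, HasDerivAt (fun t => Ψ (actC3 (expCurve genU3 t) z))
      (Complex.I • U3 ρ (Ψ (actC3 (expCurve genU3 t) z))) t)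
    (hT2 : ∀ z t, HasDerivAt (fun t => Ψ (actC3 (expCurve genT2 t) z))
      ((1 / 2 : ℂ) • (Tplus ρ - Tminus ρ) (Ψ (actC3 (expCurve genT2 t) z))) t)
    (hU2 : ∀ z t, HasDerivAt (fun t => Ψ (actC3 (expCurve genU2 t) z))
      ((1 / 2 : ℂ) • (Uplus ρ - Uminus ρ) (Ψ (actC3 (expCurve genU2 t) z))) t)
    (g : SU3) (z : C3) : Ψ (actC3 g z) = ρ g (Ψ z) := by
  have key : ∀ {X : Matrix (Fin 3) (Fin 3) ℂ} (_ : X.IsHermitian) (_ : X.trace = 0)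
      (_ : ∀ z t, HasDerivAt (fun t => Ψ (actC3 (expCurve X t) z))
        (Complex.I • hermAct ρ X (Ψ (actC3 (expCurve X t) z))) t) (t : ℝ) (z : C3),
      Ψ (actC3 (expCurve X t) z) = ρ (expCurve X t) (Ψ z) := by
    intro X hX htr h t z
    have h2 := eq_rep_expCurve_apply hρ hX htr (h z) t
    simpa only [expCurve_zero, actC3_one] using h2
  refine equivariant_of_expCurve (a := fun g z => actC3 g z) (b := fun g v => ρ g v) (F := Ψ)
    actC3_one actC3_mul (by simp) (by simp)
    (key genT3_isHermitian genT3_trace ?_) (key genU3_isHermitian genU3_trace ?_)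
    (key genT2_isHermitian genT2_trace ?_) (key genU2_isHermitian genU2_trace ?_) g z
  · simpa only [T3_eq] using hT3
  · simpa only [U3_eq] using hU3
  · intro z t
    rw [← smul_apply, I_smul_hermAct_genT2]
    exact hT2 z t
  · intro z t
    rw [← smul_apply, I_smul_hermAct_genU2]
    exact hU2 z t

theorem symCoeff_left (p : ℕ) : symCoeff p 0 0 = 1 := by
  have h := factorial_mul_multinomial p 0 0
  simp only [Nat.factorial_zero, mul_one, add_zero] at h
  rw [symCoeff, Nat.eq_of_mul_eq_mul_left p.factorial_pos (h.trans (mul_one _).symm)]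
  simp

theorem symCoeff_right (p : ℕ) : symCoeff 0 0 p = 1 := by
  have h := factorial_mul_multinomial 0 0 p
  simp only [Nat.factorial_zero, one_mul, zero_add] at h
  rw [symCoeff, Nat.eq_of_mul_eq_mul_left p.factorial_pos (h.trans (mul_one _).symm)]
  simp

theorem sigma_sigma (z : C3) : sigma (sigma z) = z := by
  ext i; fin_cases i <;> simp [sigma]

theorem sigma_smul (c : ℂ) (z : C3) : sigma (c • z) = conj c • sigma z := by
  ext i; fin_cases i <;> simp [sigma]

theorem sigma_baseVec : sigma baseVec = (-1 : ℂ) • EuclideanSpace.single 2 1 := by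
  ext i; fin_cases i <;> simp [sigma, baseVec]

namespace IsSymPowerBasis

variable [CompleteSpace H] {ρ : SU3 →* (H →L[ℂ] H)} {p : ℕ} {b : ℕ → ℕ → ℕ → H}
  {Am Ap A3 Bm Bp B3 : H →L[ℂ] H}

theorem veronese_single_zero (hb : IsSymPowerBasis p b Am Ap A3 Bm Bp B3) :
    veronese p b baseVec = b p 0 0 := by
  refine hb.ext_inner fun j k l hs => ?_
  rw [hb.inner_veronese hs, hb.inner _ _ _ _ _ _ hs (by omega)]
  by_cases h : j = p ∧ k = 0 ∧ l = 0
  · obtain ⟨rfl, rfl, rfl⟩ := h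
    simp [baseVec, symCoeff_left]
  · rw [if_neg h]
    have : k ≠ 0 ∨ l ≠ 0 := by omega
    rcases this with h | h <;> simp [baseVec, h]

theorem veronese_single_two (hb : IsSymPowerBasis p b Am Ap A3 Bm Bp B3) :
    veronese p b (EuclideanSpace.single 2 1) = b 0 0 p := by
  refine hb.ext_inner fun j k l hs => ?_
  rw [hb.inner_veronese hs, hb.inner _ _ _ _ _ _ hs (by omega)]
  by_cases h : j = 0 ∧ k = 0 ∧ l = p
  · obtain ⟨rfl, rfl, rfl⟩ := h
    simp [symCoeff_right]
  · rw [if_neg h]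
    have : j ≠ 0 ∨ k ≠ 0 := by omega
    rcases this with h | h <;> simp [h]

theorem norm_eq_one (hb : IsSymPowerBasis p b Am Ap A3 Bm Bp B3) {j k l : ℕ}
    (hs : j + k + l = p) : ‖b j k l‖ = 1 := by
  have h := hb.inner j k l j k l hs hs
  rw [if_pos ⟨rfl, rfl, rfl⟩] at h
  rw [@norm_eq_sqrt_re_inner ℂ, h]
  simp

/-- The coordinate flows and the derivatives of `Φ_p` match generator by generator. The base value
is `b p 0 0`, on which the `B` operators, here the `U` operators, vanish. -/
theorem isCoherentMap (hb : IsSymPowerBasis p b (Tminus ρ) (Tplus ρ) (T3 ρ) (Uminus ρ) (Uplus ρ)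
    (U3 ρ)) (hρ : Continuous ρ) (hirr : IsIrreducibleRep ρ) :
    IsCoherentMap ρ p (veronese p b) := by
  have hact : ∀ g z, veronese p b (actC3 g z) = ρ g (veronese p b z) :=
    map_actC3_of_hasDerivAt hρ
      (fun z t => hb.hasDerivAt_A3 (hasDerivAt_actC3_genT3 z t).1 (hasDerivAt_actC3_genT3 z t).2.1
        (hasDerivAt_actC3_genT3 z t).2.2)
      (fun z t => hb.hasDerivAt_B3 (hasDerivAt_actC3_genU3 z t).1 (hasDerivAt_actC3_genU3 z t).2.1
        (hasDerivAt_actC3_genU3 z t).2.2)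
      (fun z t => hb.hasDerivAt_A2 (hasDerivAt_actC3_genT2 z t).1 (hasDerivAt_actC3_genT2 z t).2.1
        (hasDerivAt_actC3_genT2 z t).2.2)
      (fun z t => hb.hasDerivAt_B2 (hasDerivAt_actC3_genU2 z t).1 (hasDerivAt_actC3_genU2 z t).2.1
        (hasDerivAt_actC3_genU2 z t).2.2)
  have hnorm : ‖veronese p b baseVec‖ = 1 := by
    rw [hb.veronese_single_zero, hb.norm_eq_one (by omega)]
  refine ⟨hact, fun c z => ⟨c ^ p, norm_pow c p, veronese_smul p b c z⟩, contDiff_veronese p b,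
    fun A hA => hirr.separates_veronese (θ := id) Function.surjective_id hact (z₀ := baseVec)
      (fun h => by simp [id] at h; simp [h] at hnorm) hA, hnorm, ?_, ?_, ?_⟩
  · rw [hb.veronese_single_zero, hb.Bp_zero p 0 (by omega)]
  · rw [hb.veronese_single_zero, hb.Bm_zero p 0 (by omega)]
  · rw [hb.veronese_single_zero, hb.B3_apply p 0 0 (by omega)]
    simp

/-- Reversal and conjugation of the coordinates exchange the flows of the `T` and `U` generators,
and the signs in `σ` give the rotations their proper sense. The base value is `b 0 0 p` up to sign,
on which the `A` operators, now the `U` operators, vanish. -/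
theorem isCoherentMap_sigma (hb : IsSymPowerBasis p b (Uminus ρ) (Uplus ρ) (U3 ρ) (Tminus ρ)
    (Tplus ρ) (T3 ρ)) (hρ : Continuous ρ) (hirr : IsIrreducibleRep ρ) :
    IsCoherentMap ρ p (fun z => veronese p b (sigma z)) := by
  have h0 : ∀ {ζ : ℝ → C3} {c : ℂ} {t : ℝ}, HasDerivAt (fun t => ζ t 2) c t →
      HasDerivAt (fun t => sigma (ζ t) 0) (-conj c) t := fun h => h.star.fun_neg
  have h1 : ∀ {ζ : ℝ → C3} {c : ℂ} {t : ℝ}, HasDerivAt (fun t => ζ t 1) c t →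
      HasDerivAt (fun t => sigma (ζ t) 1) (conj c) t := fun h => h.star
  have h2 : ∀ {ζ : ℝ → C3} {c : ℂ} {t : ℝ}, HasDerivAt (fun t => ζ t 0) c t →
      HasDerivAt (fun t => sigma (ζ t) 2) (-conj c) t := fun h => h.star.fun_neg
  have hact : ∀ g z, veronese p b (sigma (actC3 g z)) = ρ g (veronese p b (sigma z)) := by
    refine map_actC3_of_hasDerivAt (Ψ := fun z => veronese p b (sigma z)) hρ ?_ ?_ ?_ ?_
    · intro z t
      obtain ⟨d0, d1, d2⟩ := hasDerivAt_actC3_genT3 z t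
      exact hb.hasDerivAt_B3 ((h0 d2).congr_deriv (by simp))
        ((h1 d1).congr_deriv (by simp [sigma, Complex.conj_ofNat]))
        ((h2 d0).congr_deriv (by simp [sigma, Complex.conj_ofNat]))
    · intro z t
      obtain ⟨d0, d1, d2⟩ := hasDerivAt_actC3_genU3 z t
      exact hb.hasDerivAt_A3 ((h0 d2).congr_deriv (by simp [sigma, Complex.conj_ofNat]))
        ((h1 d1).congr_deriv (by simp [sigma, Complex.conj_ofNat]))
        ((h2 d0).congr_deriv (by simp))
    · intro z t
      obtain ⟨d0, d1, d2⟩ := hasDerivAt_actC3_genT2 z t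
      exact hb.hasDerivAt_B2 ((h0 d2).congr_deriv (by simp))
        ((h1 d1).congr_deriv (by simp [sigma, Complex.conj_ofNat]))
        ((h2 d0).congr_deriv (by simp [sigma, Complex.conj_ofNat, neg_div]))
    · intro z t
      obtain ⟨d0, d1, d2⟩ := hasDerivAt_actC3_genU2 z t
      exact hb.hasDerivAt_A2 ((h0 d2).congr_deriv (by simp [sigma, Complex.conj_ofNat, neg_div]))
        ((h1 d1).congr_deriv (by simp [sigma, Complex.conj_ofNat]))
        ((h2 d0).congr_deriv (by simp))
  have hbase : veronese p b (sigma baseVec) = (-1 : ℂ) ^ p • b 0 0 p := by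
    rw [sigma_baseVec, veronese_smul, hb.veronese_single_two]
  have hnorm : ‖veronese p b (sigma baseVec)‖ = 1 := by
    rw [hbase, norm_smul, hb.norm_eq_one (by omega)]
    simp
  have hsmooth : ContDiff ℝ ∞ sigma := by
    have hc : ∀ i : Fin 3, ContDiff ℝ ∞ fun z : C3 => conj (z i) := fun i =>
      Complex.conjCLE.contDiff.comp ((EuclideanSpace.proj (𝕜 := ℂ) i).restrictScalars ℝ).contDiff
    refine (PiLp.contDiff_toLp (𝕜 := ℝ)).comp (contDiff_pi.2 fun i => ?_)
    fin_cases i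
    · exact (hc 2).neg
    · exact hc 1
    · exact (hc 0).neg
  refine ⟨hact, fun c z => ⟨conj c ^ p, by rw [norm_pow, Complex.norm_conj], ?_⟩,
    (contDiff_veronese p b).comp hsmooth,
    fun A hA => hirr.separates_veronese (θ := sigma) (fun z => ⟨sigma z, sigma_sigma z⟩) hact
      (z₀ := baseVec) (fun h => by simp [h] at hnorm) hA, hnorm, ?_, ?_, ?_⟩
  · rw [sigma_smul, veronese_smul]
  · rw [hbase, _root_.map_smul, hb.Ap_zero 0 p (by omega), smul_zero]
  · rw [hbase, _root_.map_smul, hb.Am_zero 0 p (by omega), smul_zero]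
  · rw [hbase, _root_.map_smul, hb.A3_apply 0 0 p (by omega)]
    simp

end IsSymPowerBasis

end QuarkSymbol

namespace QuarkSymbol

set_option linter.unusedSectionVars false

/-! ### Gelfand-Tsetlin bases of the symmetric powers -/

theorem GTPattern.extend_of_mem {a b : ℕ} {W : Type*} [Zero W] (e : GTPattern a b → W)
    (r : GTPattern a b) : GTPattern.extend e r.rp r.rm r.nu3 = e r := by
  rw [GTPattern.extend, dif_pos ⟨⟨r.rm_le, r.le_rp⟩, r.rp_le, r.rm_le_nu3, r.nu3_le_rp⟩]

theorem GTPattern.extend_of_not {a b : ℕ} {W : Type*} [Zero W] (e : GTPattern a b → W)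
    {x y z : ℕ} (h : ¬((y ≤ b ∧ b ≤ x) ∧ x ≤ a + b ∧ y ≤ z ∧ z ≤ x)) :
    GTPattern.extend e x y z = 0 := by
  rw [GTPattern.extend, dif_neg h]

section

variable {H : Type*} [NormedAddCommGroup H] [InnerProductSpace ℂ H] {p : ℕ}

/-- The pattern of `Q(p, 0)` of weight `(p - k - l, k, l)`. -/
def quarkPattern (p k l : ℕ) (h : k + l ≤ p) : GTPattern p 0 :=
  ⟨k + l, 0, l, le_rfl, Nat.zero_le _, h, Nat.zero_le _, Nat.le_add_left _ _⟩

/-- The pattern of `Q(0, p)` of weight `(p - l, p - k, k + l)`. -/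
def antiquarkPattern (p k l : ℕ) (h : k + l ≤ p) : GTPattern 0 p :=
  ⟨p, l, k + l, by omega, le_rfl, by omega, Nat.le_add_left _ _, h⟩

theorem quarkVector_eq (e : GTPattern p 0 → H) (j : ℕ) {k l : ℕ} (h : k + l ≤ p) :
    quarkVector e j k l = e (quarkPattern p k l h) :=
  GTPattern.extend_of_mem e (quarkPattern p k l h)

theorem antiquarkVector_eq (e : GTPattern 0 p → H) (j : ℕ) {k l : ℕ} (h : k + l ≤ p) :
    antiquarkVector e j k l = e (antiquarkPattern p k l h) :=
  GTPattern.extend_of_mem e (antiquarkPattern p k l h)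

theorem quarkPattern_coeffU (k l : ℕ) (h : k + l ≤ p) :
    (quarkPattern p k l h).coeffU = √((k : ℝ) * (l + 1)) := by
  rw [GTPattern.coeffU]
  congr 1
  simp only [GTPattern.J, GTPattern.u, GTPattern.ν₂, GTPattern.ν₃, quarkPattern]
  push_cast
  ring

/-- In `Q(p, 0)` the label `r₋` is always `0`, so `T₋` has only its second term. The denominator
cancels because `J` and `ν₃` are tied to `k` and `l`. -/
theorem quarkPattern_coeffT₂ {j k l : ℕ} (hs : j + k + l = p) (h : k + l ≤ p) :
    (quarkPattern p k l h).coeffT₂ = √((j : ℝ) * (k + 1)) := by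
  rw [GTPattern.coeffT₂]
  congr 1
  subst hs
  simp only [GTPattern.J, GTPattern.u, GTPattern.ν₂, GTPattern.ν₃, quarkPattern]
  push_cast
  have h1 : (k : ℝ) + l + 1 ≠ 0 := by positivity
  have h2 : (k : ℝ) + l + 2 ≠ 0 := by positivity
  rw [div_eq_iff (by
    have : 2 * (((k : ℝ) + l - 0) / 2 + 1) * (2 * (((k : ℝ) + l - 0) / 2) + 1) =
      (k + l + 2) * (k + l + 1) := by ring
    rw [this]
    exact mul_ne_zero h2 h1)]
  ring

theorem antiquarkPattern_coeffU {j k l : ℕ} (hs : j + k + l = p) (h : k + l ≤ p) :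
    (antiquarkPattern p k l h).coeffU = √((j : ℝ) * (k + 1)) := by
  rw [GTPattern.coeffU]
  congr 1
  subst hs
  simp only [GTPattern.J, GTPattern.u, GTPattern.ν₂, GTPattern.ν₃, antiquarkPattern]
  push_cast
  ring

/-- In `Q(0, p)` the label `r₊` is always `p`, so `T₋` has only its first term. Starting from `k +
1` ensures `J > 0`, so the denominator is nonzero. -/
theorem antiquarkPattern_coeffT₁ {j k l : ℕ} (hs : j + (k + 1) + l = p) (h : k + 1 + l ≤ p) :
    (antiquarkPattern p (k + 1) l h).coeffT₁ = √(((k : ℝ) + 1) * (l + 1)) := by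
  rw [GTPattern.coeffT₁]
  congr 1
  subst hs
  simp only [GTPattern.J, GTPattern.u, GTPattern.ν₂, GTPattern.ν₃, antiquarkPattern]
  push_cast
  have h1 : (j : ℝ) + k + 1 ≠ 0 := by positivity
  have h2 : (j : ℝ) + k + 2 ≠ 0 := by positivity
  rw [div_eq_iff (by
    have : 2 * (((j : ℝ) + (k + 1) + l - l) / 2) * (2 * (((j : ℝ) + (k + 1) + l - l) / 2) + 1) =
      (j + k + 1) * (j + k + 2) := by ring
    rw [this]
    exact mul_ne_zero h1 h2)]
  ring

variable [CompleteSpace H] {ρ : SU3 →* (H →L[ℂ] H)}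

theorem IsUnitaryRep.inner_T3 (hρ : IsUnitaryRep ρ) (v w : H) :
    ⟪T3 ρ v, w⟫_ℂ = ⟪v, T3 ρ w⟫_ℂ := by
  rw [T3_eq, hρ.inner_hermAct genT3_isHermitian genT3_trace]

theorem IsUnitaryRep.inner_U3 (hρ : IsUnitaryRep ρ) (v w : H) :
    ⟪U3 ρ v, w⟫_ℂ = ⟪v, U3 ρ w⟫_ℂ := by
  rw [U3_eq, hρ.inner_hermAct genU3_isHermitian genU3_trace]

theorem IsGTBasis.isSymPowerBasis_quark {e : GTPattern p 0 → H} (he : IsGTBasis ρ p 0 e)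
    (hρ : IsUnitaryRep ρ) :
    IsSymPowerBasis p (quarkVector e) (Tminus ρ) (Tplus ρ) (T3 ρ) (Uminus ρ) (Uplus ρ)
      (U3 ρ) where
  inner j k l j' k' l' hs hs' := by
    classical
    rw [quarkVector_eq e j (by omega), quarkVector_eq e j' (by omega),
      orthonormal_iff_ite.1 he.orthonormal]
    refine if_congr ?_ rfl rfl
    rw [GTPattern.ext_iff]
    simp only [quarkPattern, true_and]
    constructor <;> intro h <;> omega
  span_eq_top := by
    rw [← he.span_eq_top]
    congr 1
    ext v
    constructor
    · rintro ⟨j, k, l, hs, rfl⟩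
      exact ⟨_, (quarkVector_eq e j (by omega)).symm⟩
    · rintro ⟨r, rfl⟩
      have h1 := r.rm_le
      have h2 := r.nu3_le_rp
      have h3 := r.rp_le
      refine ⟨p - r.rp, r.rp - r.nu3, r.nu3, by omega, ?_⟩
      rw [quarkVector_eq e _ (by omega)]
      congr 1
      ext <;> simp only [quarkPattern] <;> omega
  Am_succ j k l hs := by
    rw [quarkVector_eq e _ (by omega), he.family.tminus,
      quarkPattern_coeffT₂ (j := j + 1) hs (by omega),
      GTPattern.extend_of_not e (by simp [quarkPattern]), smul_zero, zero_add, quarkVector]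
    simp only [quarkPattern]
    rw [show k + l + 1 = k + 1 + l by omega]
    push_cast
    rfl
  Am_zero k l hs := by
    rw [quarkVector_eq e _ (by omega), he.family.tminus,
      GTPattern.extend_of_not e (by simp [quarkPattern]),
      GTPattern.extend_of_not e (by simp only [quarkPattern]; omega), smul_zero, smul_zero,
      add_zero]
  Bm_succ j k l hs := by
    rw [quarkVector_eq e _ (by omega), he.family.uminus, quarkPattern_coeffU, quarkVector]
    simp only [quarkPattern]
    rw [show k + 1 + l = k + (l + 1) by omega]
    push_cast
    rfl
  Bm_zero j l hs := by
    rw [quarkVector_eq e _ (by omega), he.family.uminus,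
      GTPattern.extend_of_not e (by simp [quarkPattern]), smul_zero]
  A3_apply j k l hs := by
    rw [quarkVector_eq e _ (by omega), he.family.t3]
    congr 1
    subst hs
    simp only [GTPattern.t, GTPattern.ν₁, GTPattern.ν₂, quarkPattern]
    push_cast
    ring
  B3_apply j k l hs := by
    rw [quarkVector_eq e _ (by omega), he.family.u3]
    congr 1
    simp only [GTPattern.u, GTPattern.ν₂, GTPattern.ν₃, quarkPattern]
    push_cast
    ring
  inner_Ap := hρ.inner_Tplus
  inner_Bp := hρ.inner_Uplus
  inner_A3 := hρ.inner_T3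
  inner_B3 := hρ.inner_U3

/-- With weights `j(1,1,0) + k(1,0,1) + l(0,1,1)`, it is `U₋` that moves a unit from `j` to `k` and
`T₋` that moves one from `k` to `l`; hence the exchange of roles. -/
theorem IsGTBasis.isSymPowerBasis_antiquark {e : GTPattern 0 p → H} (he : IsGTBasis ρ 0 p e)
    (hρ : IsUnitaryRep ρ) :
    IsSymPowerBasis p (antiquarkVector e) (Uminus ρ) (Uplus ρ) (U3 ρ) (Tminus ρ) (Tplus ρ)
      (T3 ρ) where
  inner j k l j' k' l' hs hs' := by
    classical
    rw [antiquarkVector_eq e j (by omega), antiquarkVector_eq e j' (by omega),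
      orthonormal_iff_ite.1 he.orthonormal]
    refine if_congr ?_ rfl rfl
    rw [GTPattern.ext_iff]
    simp only [antiquarkPattern, true_and]
    constructor <;> intro h <;> omega
  span_eq_top := by
    rw [← he.span_eq_top]
    congr 1
    ext v
    constructor
    · rintro ⟨j, k, l, hs, rfl⟩
      exact ⟨_, (antiquarkVector_eq e j (by omega)).symm⟩
    · rintro ⟨r, rfl⟩
      have h1 := r.rm_le_nu3
      have h2 := r.nu3_le_rp
      have h3 := r.rp_le
      have h4 := r.le_rp
      refine ⟨p - r.nu3, r.nu3 - r.rm, r.rm, by omega, ?_⟩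
      rw [antiquarkVector_eq e _ (by omega)]
      congr 1
      ext <;> simp only [antiquarkPattern] <;> omega
  Am_succ j k l hs := by
    rw [antiquarkVector_eq e _ (by omega), he.family.uminus,
      antiquarkPattern_coeffU (j := j + 1) hs (by omega), antiquarkVector]
    simp only [antiquarkPattern]
    rw [show k + l + 1 = k + 1 + l by omega]
    push_cast
    rfl
  Am_zero k l hs := by
    rw [antiquarkVector_eq e _ (by omega), he.family.uminus,
      GTPattern.extend_of_not e (by simp only [antiquarkPattern]; omega), smul_zero]
  Bm_succ j k l hs := by
    rw [antiquarkVector_eq e _ (by omega), he.family.tminus, antiquarkPattern_coeffT₁ hs,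
      GTPattern.extend_of_not e (x := _ + 1) (by simp only [antiquarkPattern]; omega), smul_zero,
      add_zero, antiquarkVector]
    simp only [antiquarkPattern]
    rw [show k + 1 + l = k + (l + 1) by omega]
  Bm_zero j l hs := by
    rw [antiquarkVector_eq e _ (by omega), he.family.tminus,
      GTPattern.extend_of_not e (by simp only [antiquarkPattern]; omega),
      GTPattern.extend_of_not e (by simp only [antiquarkPattern]; omega), smul_zero, smul_zero,
      add_zero]
  A3_apply j k l hs := by
    rw [antiquarkVector_eq e _ (by omega), he.family.u3]
    congr 1
    subst hs
    simp only [GTPattern.u, GTPattern.ν₂, GTPattern.ν₃, antiquarkPattern]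
    push_cast
    ring
  B3_apply j k l hs := by
    rw [antiquarkVector_eq e _ (by omega), he.family.t3]
    congr 1
    subst hs
    simp only [GTPattern.t, GTPattern.ν₁, GTPattern.ν₂, antiquarkPattern]
    push_cast
    ring
  inner_Ap := hρ.inner_Uplus
  inner_Bp := hρ.inner_Tplus
  inner_A3 := hρ.inner_U3
  inner_B3 := hρ.inner_T3

/-- Weights are multiplicity free: `j - k`, `k - l` and the sum `p` determine `j`, `k`, `l`, and
self-adjointness makes a weight vector orthogonal to all other basis vectors. -/
theorem IsSymPowerBasis.eigenspace_inf_eigenspace {b : ℕ → ℕ → ℕ → H}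
    {Am Ap A3 Bm Bp B3 : H →L[ℂ] H} (hb : IsSymPowerBasis p b Am Ap A3 Bm Bp B3) {j k l : ℕ}
    (hs : j + k + l = p) :
    Module.End.eigenspace (A3 : H →ₗ[ℂ] H) (((j : ℂ) - k) / 2) ⊓
      Module.End.eigenspace (B3 : H →ₗ[ℂ] H) (((k : ℂ) - l) / 2) = ℂ ∙ b j k l := by
  apply le_antisymm
  · rintro v ⟨hA, hB⟩
    rw [SetLike.mem_coe, Module.End.mem_eigenspace_iff] at hA hB
    rw [ContinuousLinearMap.coe_coe] at hA hB
    rw [Submodule.mem_span_singleton]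
    refine ⟨⟪b j k l, v⟫_ℂ, hb.ext_inner fun j' k' l' hs' => ?_⟩
    rw [inner_smul_right, hb.inner _ _ _ _ _ _ hs' hs]
    by_cases h : j' = j ∧ k' = k ∧ l' = l
    · obtain ⟨rfl, rfl, rfl⟩ := h
      simp
    · rw [if_neg h, mul_zero]
      by_contra hne
      have e1 := hb.inner_A3 (b j' k' l') v
      have e2 := hb.inner_B3 (b j' k' l') v
      rw [hb.A3_apply _ _ _ hs', hA, inner_smul_left, inner_smul_right, map_div₀, map_sub,
        Complex.conj_natCast, Complex.conj_natCast, Complex.conj_ofNat] at e1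
      rw [hb.B3_apply _ _ _ hs', hB, inner_smul_left, inner_smul_right, map_div₀, map_sub,
        Complex.conj_natCast, Complex.conj_natCast, Complex.conj_ofNat] at e2
      have f1 := mul_right_cancel₀ (Ne.symm hne) e1
      have f2 := mul_right_cancel₀ (Ne.symm hne) e2
      have g1 : (j' : ℂ) + k = j + k' := by linear_combination 2 * f1
      have g2 : (k' : ℂ) + l = k + l' := by linear_combination 2 * f2
      have g1' : j' + k = j + k' := by exact_mod_cast g1
      have g2' : k' + l = k + l' := by exact_mod_cast g2
      omega
  · rw [Submodule.span_singleton_le_iff_mem]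
    refine ⟨?_, ?_⟩ <;>
      rw [SetLike.mem_coe, Module.End.mem_eigenspace_iff, ContinuousLinearMap.coe_coe]
    · exact hb.A3_apply j k l hs
    · exact hb.B3_apply j k l hs

end

/-! ### Weight projectors, Clebsch-Gordan coefficients and the final assembly -/

section

variable {H : Type*} [NormedAddCommGroup H] [InnerProductSpace ℂ H] [CompleteSpace H]
  [FiniteDimensional ℂ H] {ρ : SU3 →* (H →L[ℂ] H)} {p : ℕ}

theorem ketBra_smul {c : ℂ} (hc : ‖c‖ = 1) (v : H) : ketBra (c • v) = ketBra v := by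
  ext w
  rw [ketBra_apply, ketBra_apply, inner_smul_left, smul_smul, mul_right_comm, Complex.conj_mul', hc]
  simp

theorem weightProjector_eq_ketBra {a b c : ℤ} {v : H} (hv : ‖v‖ = 1)
    (h : weightSpace ρ a b c = ℂ ∙ v) : weightProjector ρ a b c = ketBra v := by
  ext w
  rw [weightProjector, ketBra_apply]
  simp only [h]
  exact Submodule.starProjection_unit_singleton ℂ hv w

theorem traceInner_ketBra (A : H →L[ℂ] H) (v : H) :
    traceInner A (ketBra v) = conj ⟪v, A v⟫_ℂ := by
  rw [traceInner, opTrace_mul_ketBra, ContinuousLinearMap.adjoint_inner_right, inner_conj_symm]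

/-- For dual labels `e ⊗ ě` is the phase of the dual basis times a rank-one projector, so the
coefficient is the conjugate of an expectation value up to sign. -/
theorem clebschGordan_eq_of_dual {a b : ℕ} (e : GTPattern a b → H) {r : GTPattern a b}
    {s : GTPattern b a} (hs : s.dual = r) (A : H →L[ℂ] H) :
    clebschGordan e r s A = (-1) ^ (r.ν₁ - r.ν₃) * conj ⟪e r, A (e r)⟫_ℂ := by
  have h : tensorOp (e r) (dualBasis e s) = ((-1 : ℂ) ^ (r.ν₁ - r.ν₃)) • ketBra (e r) := by
    ext w
    simp [tensorOp, dualBasis, ketBra, hs, smul_smul]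
  rw [clebschGordan, h, ← traceInnerₗ_apply, _root_.map_smul, traceInnerₗ_apply,
    traceInner_ketBra, smul_eq_mul]

theorem lowest_dual (p : ℕ) : (GTPattern.lowest 0 p).dual = GTPattern.highest p 0 := by
  ext <;> simp [GTPattern.lowest, GTPattern.highest, GTPattern.dual]

theorem highest_dual (p : ℕ) : (GTPattern.highest p 0).dual = GTPattern.lowest 0 p := by
  ext <;> simp [GTPattern.lowest, GTPattern.highest, GTPattern.dual]

/-- Reality of the Clebsch-Gordan coefficient removes the conjugate, and shows that the expectation
value is real. -/
theorem neg_one_pow_mul_eq_of_im_eq_zero {x y : ℂ} (hy : y = (-1) ^ p * conj x) (him : y.im = 0) :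
    (-1) ^ p * y = x ∧ x.im = 0 := by
  have h1 : ((-1 : ℂ) ^ p) * (-1) ^ p = 1 := by rw [← mul_pow]; norm_num
  have h2 : (-1) ^ p * y = conj x := by rw [hy, ← mul_assoc, h1, one_mul]
  have h3 : conj y = y := Complex.conj_eq_iff_im.2 him
  have h4 : x = conj x := by
    rw [← h2, ← Complex.conj_conj x, ← h2, map_mul, h3]
    simp
  exact ⟨h2.trans h4.symm, Complex.conj_eq_iff_im.1 h4.symm⟩

/-- The properties of the symbol correspondence of a coherent map. -/
theorem IsCoherentMap.exists_characteristicNumbers {V : ℕ → Type*}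
    [∀ n, NormedAddCommGroup (V n)] [∀ n, InnerProductSpace ℂ (V n)]
    [∀ n, FiniteDimensional ℂ (V n)] {τ : (n : ℕ) → SU3 →* (V n →L[ℂ] V n)}
    {f : (n : ℕ) → GTPattern n n → V n} {a b : ℕ} {e : GTPattern a b → H}
    {E : (n : ℕ) → GTPattern n n → (H →L[ℂ] H)} {Ψ : C3 → H}
    (hΨ : IsCoherentMap ρ p Ψ) (hab : a + b = p) (hp : 1 ≤ p)
    (hρ : IsUnitaryRep ρ) (hirr : IsIrreducibleRep ρ)
    (hdim : Module.finrank ℂ H * 2 = (p + 1) * (p + 2))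
    (hE : IsCoupledBasis ρ e E) (hτ : ∀ n, IsUnitaryRep (τ n))
    (hf : ∀ n, IsGTBasis (τ n) n n (f n)) {r : GTPattern a b} {s : GTPattern b a}
    (hs : s.dual = r) (hr : (-1 : ℂ) ^ (r.ν₁ - r.ν₃) = (-1) ^ p) {c : ℂ} (hc : ‖c‖ = 1)
    (hbase : Ψ baseVec = c • e r) :
    IsSymbolCorrespondence ρ p (coherentSymbol p Ψ) ∧ IsMappingPositive (coherentSymbol p Ψ) ∧
      IsOperatorKernel ρ (coherentSymbol p Ψ) (ketBra (e r)) ∧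
      ∃ d : ℕ → ℝ,
        (∀ n ≤ p, (d n : ℂ) =
          (-1) ^ p * (√(((p : ℝ) + 1) * (p + 2) / (2 * ((n : ℝ) + 1) ^ 3)) : ℝ) *
            clebschGordan e r s (E n (GTPattern.center n))) ∧
        IsCharacteristicNumbers p E (fun n => cp2Harmonic (τ n) (f n)) (coherentSymbol p Ψ)
          (ketBra (e r)) d := by
  have hdim' : (Module.finrank ℂ H : ℂ) = ((p : ℂ) + 1) * (p + 2) / 2 := by
    rw [eq_div_iff two_ne_zero]
    exact_mod_cast hdim
  have hket : ketBra (e r) = ketBra (Ψ baseVec) := by rw [hbase, ketBra_smul hc]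
  have hinner : ∀ A : H →L[ℂ] H, ⟪Ψ baseVec, A (Ψ baseVec)⟫_ℂ = ⟪e r, A (e r)⟫_ℂ := by
    intro A
    rw [hbase, _root_.map_smul, inner_smul_left, inner_smul_right, ← mul_assoc, Complex.conj_mul',
      hc]
    simp
  have hreal : ∀ n ≤ p, (-1) ^ p * clebschGordan e r s (E n (GTPattern.center n)) =
      ⟪e r, E n (GTPattern.center n) (e r)⟫_ℂ ∧
      (⟪e r, E n (GTPattern.center n) (e r)⟫_ℂ).im = 0 := fun n hn =>
    neg_one_pow_mul_eq_of_im_eq_zero (by rw [clebschGordan_eq_of_dual e hs, hr])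
      (hE.real n (hab ▸ hn) _ r s)
  have hre : ∀ n ≤ p, ((⟪e r, E n (GTPattern.center n) (e r)⟫_ℂ).re : ℂ) =
      ⟪e r, E n (GTPattern.center n) (e r)⟫_ℂ := fun n hn =>
    Complex.ext rfl (by rw [(hreal n hn).2, Complex.ofReal_im])
  refine ⟨hΨ.isSymbolCorrespondence hp hρ hirr hdim', hΨ.isMappingPositive hρ, ?_,
    fun n => √(((p : ℝ) + 1) * (p + 2) / (2 * ((n : ℝ) + 1) ^ 3)) *
      (⟪e r, E n (GTPattern.center n) (e r)⟫_ℂ).re, ?_, ?_⟩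
  · rw [hket]
    exact hΨ.isOperatorKernel hρ
  · intro n hn
    rw [Complex.ofReal_mul, hre n hn, ← (hreal n hn).1]
    ring
  · rw [hket]
    subst hab
    refine hΨ.isCharacteristicNumbers hp hρ hirr hdim' hE hτ hf fun n hn => ?_
    rw [Complex.ofReal_mul, hre n hn, hinner]

end

end QuarkSymbol

theorem proposition3p18 (p : ℕ) (hp : 1 ≤ p)
    -- representations of class `Q(n, n)` with Gelfand-Tsetlin bases, for the harmonics
    {V : ℕ → Type*} [∀ n, NormedAddCommGroup (V n)] [∀ n, InnerProductSpace ℂ (V n)]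
    [∀ n, FiniteDimensional ℂ (V n)]
    (τ : (n : ℕ) → SU3 →* (V n →L[ℂ] V n)) (hτ : ∀ n, IsOfClass (τ n) n n)
    (f : (n : ℕ) → GTPattern n n → V n) (hf : ∀ n, IsGTBasis (τ n) n n (f n))
    -- a quantum pure-quark system of class `Q(p, 0)`
    {H : Type*} [NormedAddCommGroup H] [InnerProductSpace ℂ H] [CompleteSpace H]
    [FiniteDimensional ℂ H]
    (ρ : SU3 →* (H →L[ℂ] H)) (hρ : IsOfClass ρ p 0)
    (e : GTPattern p 0 → H) (he : IsGTBasis ρ p 0 e)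
    (E : (n : ℕ) → GTPattern n n → (H →L[ℂ] H)) (hE : IsCoupledBasis ρ e E)
    -- a quantum pure-quark system of class `Q(0, p)`
    {H' : Type*} [NormedAddCommGroup H'] [InnerProductSpace ℂ H'] [CompleteSpace H']
    [FiniteDimensional ℂ H']
    (ρ' : SU3 →* (H' →L[ℂ] H')) (hρ' : IsOfClass ρ' 0 p)
    (e' : GTPattern 0 p → H') (he' : IsGTBasis ρ' 0 p e')
    (E' : (n : ℕ) → GTPattern n n → (H' →L[ℂ] H')) (hE' : IsCoupledBasis ρ' e' E') :
    (∃ B : (H →L[ℂ] H) →ₗ[ℂ] (CP2 → ℂ),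
      (∀ A n, B A (proj n) =
        inner ℂ (veronese p (quarkVector e) n) (A (veronese p (quarkVector e) n))) ∧
      IsSymbolCorrespondence ρ p B ∧ IsMappingPositive B ∧
      IsOperatorKernel ρ B (weightProjector ρ p 0 0) ∧
      ∃ b : ℕ → ℝ,
        (∀ n ≤ p, (b n : ℂ) =
          (-1) ^ p * (√(((p : ℝ) + 1) * (p + 2) / (2 * ((n : ℝ) + 1) ^ 3)) : ℝ) *
            clebschGordan e (GTPattern.highest p 0) (GTPattern.lowest 0 p)
              (E n (GTPattern.center n))) ∧
        IsCharacteristicNumbers p E (fun n => cp2Harmonic (τ n) (f n)) B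
          (weightProjector ρ p 0 0) b) ∧
    (∃ B : (H' →L[ℂ] H') →ₗ[ℂ] (CP2 → ℂ),
      (∀ A n, B A (proj n) =
        inner ℂ (veronese p (antiquarkVector e') (sigma n))
          (A (veronese p (antiquarkVector e') (sigma n)))) ∧
      IsSymbolCorrespondence ρ' p B ∧ IsMappingPositive B ∧
      IsOperatorKernel ρ' B (weightProjector ρ' 0 p p) ∧
      ∃ b : ℕ → ℝ,
        (∀ n ≤ p, (b n : ℂ) =
          (-1) ^ p * (√(((p : ℝ) + 1) * (p + 2) / (2 * ((n : ℝ) + 1) ^ 3)) : ℝ) *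
            clebschGordan e' (GTPattern.lowest 0 p) (GTPattern.highest p 0)
              (E' n (GTPattern.center n))) ∧
        IsCharacteristicNumbers p E' (fun n => cp2Harmonic (τ n) (f n)) B
          (weightProjector ρ' 0 p p) b) := by
  constructor
  · have hb := he.isSymPowerBasis_quark hρ.unitary
    have hΨ := hb.isCoherentMap hρ.unitary.continuous hρ.irreducible
    have hv : quarkVector e p 0 0 = e (GTPattern.highest p 0) :=
      quarkVector_eq e p (k := 0) (l := 0) (Nat.zero_le _)
    have hw : weightProjector ρ p 0 0 = ketBra (e (GTPattern.highest p 0)) := by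
      refine weightProjector_eq_ketBra (he.orthonormal.1 _) ?_
      rw [← hv, ← hb.eigenspace_inf_eigenspace (by omega), weightSpace]
      push_cast
      rfl
    rw [hw]
    exact ⟨coherentSymbol p (veronese p (quarkVector e)), hΨ.coherentSymbol_proj,
      hΨ.exists_characteristicNumbers (add_zero p) hp hρ.unitary hρ.irreducible
        hb.two_mul_finrank hE (fun n => (hτ n).unitary) hf (lowest_dual p)
        -- At the highest weight `(p, 0, 0)` the phase exponent `ν₁ - ν₃` is `p`.
        (by simp [GTPattern.ν₁, GTPattern.ν₃, GTPattern.highest]) (c := 1) norm_one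
        (by rw [hb.veronese_single_zero, hv, one_smul])⟩
  · have hb := he'.isSymPowerBasis_antiquark hρ'.unitary
    have hΨ := hb.isCoherentMap_sigma hρ'.unitary.continuous hρ'.irreducible
    have hv : antiquarkVector e' 0 0 p = e' (GTPattern.lowest 0 p) := by
      rw [antiquarkVector_eq e' 0 (by omega)]
      congr 1
      ext <;> simp [antiquarkPattern, GTPattern.lowest]
    have hw : weightProjector ρ' 0 p p = ketBra (e' (GTPattern.lowest 0 p)) := by
      refine weightProjector_eq_ketBra (he'.orthonormal.1 _) ?_
      -- The two eigenspaces are swapped because `U₃` plays the part of `A3` and `T₃` that of `B3`.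
      rw [← hv, ← hb.eigenspace_inf_eigenspace (by omega), weightSpace, inf_comm]
      push_cast
      simp
    rw [hw]
    exact ⟨coherentSymbol p (fun z => veronese p (antiquarkVector e') (sigma z)),
      hΨ.coherentSymbol_proj,
      hΨ.exists_characteristicNumbers (zero_add p) hp hρ'.unitary hρ'.irreducible
        hb.two_mul_finrank hE' (fun n => (hτ n).unitary) hf (highest_dual p)
        -- At the lowest weight `(0, p, p)` the exponent `ν₁ - ν₃` is `-p`, which gives the same
        -- sign. The scalar `c = (-1)^p` comes from `σ e₁ = -e₃` and drops out of the projector.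
        (by simp [GTPattern.ν₁, GTPattern.ν₃, GTPattern.lowest, two_mul, ← inv_pow, inv_neg]) (c := (-1) ^ p) (by simp)
        (by rw [sigma_baseVec, veronese_smul, hb.veronese_single_two, hv])⟩
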